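/- Let $R>0$, let $B_R=\{x\in\mathbb R^2:|x|<R\}$, and let $S\in L^2(\mathbb R^2)$ be real-valued with compact support contained in $B_R$. For every $k>0$ let $u^s(\cdot,k):\mathbb R^2\to\mathbb C$ be the radiating solution of $\Delta u^s+k^2u^s=-S$, i.e. the continuous function that solves this equation on $\mathbb R^2$ in the sense of distributions and satisfies the Sommerfeld radiation condition $\sqrt r\,(\partial_r u^s-iku^s)\to0$ as $r=|x|\to\infty$, uniformly in $x/|x|$. Let $J_1$ and $N_1=Y_1$ be the Bessel and Neumann functions of order one. For $0<K\le\infty$ and $z\in B_R$ put $$I_S^K(z)=\frac R{2\pi}\int_0^{2\pi}\Big[\frac{z-x}{|z-x|}\cdot(\cos\theta,\sin\theta)\Big]\int_0^{K}k^2\Big[\operatorname{Im}u^s(x,k)\,N_1(k|z-x|)+\operatorname{Re}u^s(x,k)\,J_1(k|z-x|)\Big]\,dk\,d\theta,\qquad x=R(\cos\theta,\sin\theta),$$ and $I_S=I_S^\infty$. Then $I_S=S$ on $B_R$, in the following sense. 1. For every finite $K>0$ the integral $I_S^K(z)$ converges absolutely for every $z\in B_R$, $I_S^K\in L^2(B_R)$,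 and $I_S^K\to S$ in $L^2(B_R)$ as $K\to\infty$ (that is, $I_S=S$ as elements of $L^2(B_R)$, the integral over $k\in(0,\infty)$ being the $L^2(B_R)$-limit of the integrals over $(0,K)$). 2. For almost every $z\in B_R$: if the double integral over $(\theta,k)\in(0,2\pi)\times(0,\infty)$ that defines $I_S(z)$ converges absolutely, then $I_S(z)=S(z)$. 3. If $S$ is $C^\infty$, then the double integral converges absolutely and $I_S(z)=S(z)$ for every $z\in B_R$. -/

import Mathlib

open MeasureTheory Filter Topology Set
open scoped ContDiff Nat Laplacian

noncomputable section

/-- The Euclidean plane. -/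
abbrev Plane : Type := EuclideanSpace ℝ (Fin 2)

/-- The Bessel function of the first kind `J_n`,
`J_n(t) = ∑_m (-1)^m / (m! (m+n)!) (t/2)^(2m+n)`. -/
def besselJ (n : ℕ) (t : ℝ) : ℝ :=
  ∑' m : ℕ, (-1 : ℝ) ^ m / ((m ! : ℝ) * ((m + n)! : ℝ)) * (t / 2) ^ (2 * m + n)

/-- The digamma function at the positive integer `m + 1`: `ψ(m+1) = -γ + (1 + 1/2 + ⋯ + 1/m)`. -/
def digammaSucc (m : ℕ) : ℝ :=
  -Real.eulerMascheroniConstant + (harmonic m : ℝ)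

/-- The Neumann function `N_n = Y_n` (Bessel function of the second kind) of integer order on
`t > 0`:
`N_n(t) = (2/π) log(t/2) J_n(t) - (1/π) ∑_{m<n} ((n-m-1)!/m!) (t/2)^(2m-n)
  - (1/π) ∑_m (ψ(m+1) + ψ(m+n+1)) (-1)^m / (m! (m+n)!) (t/2)^(2m+n)`. -/
def neumannN (n : ℕ) (t : ℝ) : ℝ :=
  2 / Real.pi * Real.log (t / 2) * besselJ n t
    - 1 / Real.pi * ∑ m ∈ Finset.range n,
        ((n - m - 1)! : ℝ) / (m ! : ℝ) * (t / 2) ^ (2 * (m : ℤ) - (n : ℤ))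
    - 1 / Real.pi * ∑' m : ℕ, (digammaSucc m + digammaSucc (m + n)) *
        ((-1 : ℝ) ^ m / ((m ! : ℝ) * ((m + n)! : ℝ)) * (t / 2) ^ (2 * m + n))

/-- `v` solves `Δv + k²v = -S` on the whole plane in the sense of distributions. -/
def IsHelmholtzSolution (k : ℝ) (S : Plane → ℝ) (v : Plane → ℂ) : Prop :=
  ∀ w : Plane → ℝ, ContDiff ℝ ∞ w → HasCompactSupport w →
    ∫ x, ((Δ w x + k ^ 2 * w x : ℝ) : ℂ) * v x = -∫ x, ((S x * w x : ℝ) : ℂ)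

/-- The radial derivative `∂v/∂r` at a point `x ≠ 0`. -/
def radialDeriv (v : Plane → ℂ) (x : Plane) : ℂ :=
  fderiv ℝ v x (‖x‖⁻¹ • x)

/-- The Sommerfeld radiation condition `r^(1/2) (∂v/∂r - ikv) → 0` as `r = |x| → ∞`, uniformly
in all directions `x/|x|` (this uniformity is convergence along the filter of complements of
bounded sets). -/
def SommerfeldCondition (k : ℝ) (v : Plane → ℂ) : Prop :=
  (∀ᶠ x in Bornology.cobounded Plane, DifferentiableAt ℝ v x) ∧
    Tendsto (fun x : Plane =>
        ((Real.sqrt ‖x‖ : ℝ) : ℂ) * (radialDeriv v x - Complex.I * (k : ℂ) * v x))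
      (Bornology.cobounded Plane) (𝓝 0)

/-- `v` is the (continuous representative of the) field radiated by the source `S` at the wave
number `k`. -/
structure IsRadiatingSolution (k : ℝ) (S : Plane → ℝ) (v : Plane → ℂ) : Prop where
  continuous : Continuous v
  helmholtz : IsHelmholtzSolution k S v
  radiating : SommerfeldCondition k v

/-- The unit vector `(cos θ, sin θ)`. -/
def unitVec (θ : ℝ) : Plane := !₂[Real.cos θ, Real.sin θ]

/-- The factor `((z-x)/|z-x|) · (cos θ, sin θ)` for `x = R (cos θ, sin θ)`. -/
def directionFactor (R : ℝ) (z : Plane) (θ : ℝ) : ℝ :=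
  inner ℝ (‖z - R • unitVec θ‖⁻¹ • (z - R • unitVec θ)) (unitVec θ)

/-- The wave number integrand
`k² [Im u(x,k) N_1(k|z-x|) + Re u(x,k) J_1(k|z-x|)]` for `x = R (cos θ, sin θ)`. -/
def waveIntegrand (R : ℝ) (u : Plane → ℝ → ℂ) (z : Plane) (θ k : ℝ) : ℝ :=
  k ^ 2 * ((u (R • unitVec θ) k).im * neumannN 1 (k * ‖z - R • unitVec θ‖)
    + (u (R • unitVec θ) k).re * besselJ 1 (k * ‖z - R • unitVec θ‖))

/-- The indicator built from the wave numbers in `A`: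
`(R/2π) ∫_0^{2π} [((z-x)/|z-x|) · (cos θ, sin θ)] ∫_A (wave number integrand) dk dθ`. -/
def indicatorOn (A : Set ℝ) (R : ℝ) (u : Plane → ℝ → ℂ) (z : Plane) : ℝ :=
  R / (2 * Real.pi) * ∫ θ in Ioc 0 (2 * Real.pi),
    directionFactor R z θ * ∫ k in A, waveIntegrand R u z θ k

/-- The integral that defines the indicator from the wave numbers in `A` converges absolutely
at `z`. -/
def IndicatorConvergesOn (A : Set ℝ) (R : ℝ) (u : Plane → ℝ → ℂ) (z : Plane) : Prop :=
  IntegrableOn (fun p : ℝ × ℝ => directionFactor R z p.1 * waveIntegrand R u z p.1 p.2)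
    (Ioc 0 (2 * Real.pi) ×ˢ A) (volume.prod volume)

end

/-! Write `Φ(x) = (i/4) H_0(k|x|)` with `H_0 = J_0 + i N_0`. The radiating solution is `u = Φ * S`,
so on the measurement circle `Im u = (1/4) ∫ J_0(k|x-y|) S(y) dy` and `Re u = -(1/4) ∫ N_0(k|x-y|)
S(y) dy`. Moreover `k N_1(k|x-z|)` and `k J_1(k|x-z|)`, multiplied by the direction factor, are the
normal derivatives of `N_0(k|x-z|)` and `J_0(k|x-z|)`. Hence a point source at `y` contributes to
the angular integral, up to the factor `k/4`, the pairing of `J_0(k|x-y|)` with `∂_ν N_0(k|x-z|)`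
minus that of `N_0(k|x-y|)` with `∂_ν J_0(k|x-z|)`.

This is not yet Green's formula, because in the second term `y` and `z` have changed places. Two
facts repair it. Green's identity proper gives `4 J_0(k|y-z|)/R` when the second term is
`N_0(k|x-z|) ∂_ν J_0(k|x-y|)` (`integral_wronskianForm_bessel_neumann`). And the pairing of `N_0`
with `∂_ν J_0` over the circle is symmetric in `y` and `z` (`neumann_bessel_pairing_symm`): by
rotation invariance it is a convolution on the circle, and its Fourier coefficients are symmetric
because a regular solution of the radial equation of order `n` is unique up to a scalar. Together
they are `bessel_neumann_kernel`.

The truncated indicator is therefore `(1/2π) ∫_0^K k ∫ S(y) J_0(k|z-y|) dy dk`. Since `J_0` is the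
circular mean of plane waves, this is the Fourier inversion integral of `S` over frequencies `|ξ| <
K/2π` (`frequencyCutoff_eq_lowPass`). Plancherel gives the convergence in `L²`; convergence almost
everywhere along a subsequence identifies the value wherever the full integral converges absolutely.
For smooth `S` the field on the circle decays like `k^(-9/2)`, because `k^4 u` is the field of `Δ²S`
off the support, so the integral converges absolutely, and Fourier inversion is pointwise.

Identifying `u` with `Φ * S` takes up much of the proof. Existence needs the size and the outgoing
asymptotics of `H_0`, read off from a Laplace integral that is matched with the power series at the
origin (`hankel_zero_eq_hankelIntegral`). Uniqueness (`IsRadiatingSolution.eq_zero`) reduces a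
continuous distributional solution to a smooth one by mean values, splits it into circular Fourier
modes, and excludes each mode by an energy estimate at infinity. -/

/-! ### Entire power series and the profiles of the Bessel and Neumann functions -/

/-- The sum of a power series. -/
noncomputable def powerSum (c : ℕ → ℝ) (s : ℝ) : ℝ := ∑' m : ℕ, c m * s ^ m

/-- Coefficients bounded by those of a multiple of the exponential series. -/
def ExpBounded (c : ℕ → ℝ) : Prop := ∃ C : ℝ, ∀ m, |c m| ≤ C / (m ! : ℝ)

theorem ExpBounded.summable {c : ℕ → ℝ} (hc : ExpBounded c) (s : ℝ) :
    Summable fun m => c m * s ^ m := by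
  obtain ⟨C, hC⟩ := hc
  refine Summable.of_norm_bounded (g := fun m => C * (|s| ^ m / (m ! : ℝ)))
    ((Real.summable_pow_div_factorial |s|).mul_left C) fun m => ?_
  rw [Real.norm_eq_abs, abs_mul, abs_pow]
  calc |c m| * |s| ^ m ≤ C / (m ! : ℝ) * |s| ^ m := by gcongr; exact hC m
    _ = _ := by ring

theorem ExpBounded.shift {c : ℕ → ℝ} (hc : ExpBounded c) :
    ExpBounded fun m => (m + 1 : ℝ) * c (m + 1) := by
  obtain ⟨C, hC⟩ := hc
  refine ⟨C, fun m => ?_⟩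
  rw [abs_mul, abs_of_pos (by positivity : (0 : ℝ) < m + 1)]
  calc (m + 1 : ℝ) * |c (m + 1)| ≤ (m + 1) * (C / ((m + 1)! : ℝ)) := by gcongr; exact hC _
    _ = C / (m ! : ℝ) := by
      rw [Nat.factorial_succ]; push_cast; field_simp

theorem powerSum_eq_add {c : ℕ → ℝ} (hc : ExpBounded c) (s : ℝ) :
    powerSum c s = c 0 + s * ∑' m, c (m + 1) * s ^ m := by
  rw [powerSum, (hc.summable s).tsum_eq_zero_add, ← tsum_mul_left]
  simp only [pow_zero, mul_one]
  congr 1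
  refine tsum_congr fun m => ?_
  ring

theorem powerSum_zero (c : ℕ → ℝ) : powerSum c 0 = c 0 := by
  rw [powerSum, tsum_eq_single 0]
  · simp
  · intro m hm; simp [hm]

theorem ExpBounded.hasDerivAt {c : ℕ → ℝ} (hc : ExpBounded c) (s : ℝ) :
    HasDerivAt (powerSum c) (powerSum (fun m => (m + 1 : ℝ) * c (m + 1)) s) s := by
  have hsum := hc.shift.summable s
  obtain ⟨C, hC⟩ := hc.shift
  have hC0 : 0 ≤ C := by simpa using (abs_nonneg _).trans (hC 0)
  have h1 : HasDerivAt (fun z => ∑' m : ℕ, c m * z ^ m) (∑' m : ℕ, c m * (m * s ^ (m - 1))) s := by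
    have hmem : s ∈ Metric.ball (0 : ℝ) (|s| + 1) := by
      rw [mem_ball_zero_iff, Real.norm_eq_abs]; linarith
    refine hasDerivAt_tsum_of_isPreconnected (g := fun m z => c m * z ^ m)
      (g' := fun m z => c m * (m * z ^ (m - 1))) (u := fun m : ℕ => |c m| * (m * (|s| + 1) ^ (m - 1)))
      (t := Metric.ball 0 (|s| + 1)) (y₀ := s) ?_ Metric.isOpen_ball
      (convex_ball _ _).isPreconnected ?_ ?_ hmem (hc.summable s) hmem
    · rw [← summable_nat_add_iff 1]
      have hpos : 0 ≤ |s| + 1 := by positivity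
      refine Summable.of_norm_bounded (g := fun m => C * ((|s| + 1) ^ m / (m ! : ℝ)))
        ((Real.summable_pow_div_factorial _).mul_left C) fun m => ?_
      have h2 := hC m
      rw [abs_mul, abs_of_pos (by positivity : (0 : ℝ) < m + 1)] at h2
      rw [Real.norm_of_nonneg (by positivity)]
      push_cast
      calc |c (m + 1)| * ((m + 1) * (|s| + 1) ^ m)
          = ((m + 1) * |c (m + 1)|) * (|s| + 1) ^ m := by ring
        _ ≤ C / (m ! : ℝ) * (|s| + 1) ^ m := by gcongr
        _ = _ := by ring
    · intro m y _
      exact (hasDerivAt_pow m y).const_mul (c m)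
    · intro m y hy
      rw [norm_mul, norm_mul, norm_pow]
      simp only [Real.norm_eq_abs, Nat.abs_cast]
      have : |y| ≤ |s| + 1 := by simpa using (mem_ball_zero_iff.1 hy).le
      gcongr
  have h3 : ∑' m : ℕ, c m * (m * s ^ (m - 1))
      = powerSum (fun m => (m + 1 : ℝ) * c (m + 1)) s := by
    have hs : Summable fun m : ℕ => c m * (m * s ^ (m - 1)) := by
      rw [← summable_nat_add_iff 1]
      refine hsum.congr fun m => ?_
      push_cast
      ring
    rw [hs.tsum_eq_zero_add, powerSum]
    simp only [Nat.cast_zero, zero_mul, mul_zero, zero_add]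
    refine tsum_congr fun m => ?_
    push_cast
    ring
  rw [← h3]
  exact h1

theorem ExpBounded.deriv {c : ℕ → ℝ} (hc : ExpBounded c) :
    deriv (powerSum c) = powerSum (fun m => (m + 1 : ℝ) * c (m + 1)) :=
  funext fun s => (hc.hasDerivAt s).deriv

theorem ExpBounded.contDiff {c : ℕ → ℝ} (hc : ExpBounded c) : ContDiff ℝ ∞ (powerSum c) := by
  refine contDiff_infty.2 fun n => ?_
  induction n generalizing c with
  | zero => exact contDiff_zero.2 (continuous_iff_continuousAt.2 fun s => (hc.hasDerivAt s).continuousAt)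
  | succ n ih =>
    rw [Nat.cast_succ, contDiff_succ_iff_deriv]
    refine ⟨fun s => (hc.hasDerivAt s).differentiableAt, by simp, ?_⟩
    rw [hc.deriv]
    exact ih hc.shift

/-! ### The profiles of `J_0` and `N_0` in the variable `(t/2)^2`. -/

/-- The coefficients of `J_0` in the variable `(t/2)^2`. -/
noncomputable def besselCoeff (m : ℕ) : ℝ := (-1) ^ m / ((m ! : ℝ) * (m ! : ℝ))

/-- The coefficients of the regular part of `N_0` in the variable `(t/2)^2`. -/
noncomputable def neumannCoeff (m : ℕ) : ℝ := digammaSucc m * besselCoeff m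

theorem besselCoeff_expBounded : ExpBounded besselCoeff := by
  refine ⟨1, fun m => ?_⟩
  have h : (1 : ℝ) ≤ (m ! : ℝ) := by exact_mod_cast Nat.one_le_iff_ne_zero.2 (Nat.factorial_ne_zero m)
  rw [besselCoeff, abs_div, abs_pow, abs_neg, abs_one, one_pow, abs_of_pos (by positivity)]
  gcongr
  nlinarith

theorem digammaSucc_succ (m : ℕ) : digammaSucc (m + 1) = digammaSucc m + 1 / (m + 1 : ℝ) := by
  simp only [digammaSucc, harmonic_succ]
  push_cast
  simp only [one_div]
  ring

/-- Linear growth is a crude bound for a logarithm, but it suffices: `besselCoeff` carries two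
factorials, and one of them absorbs the factor `m + 1`. -/
theorem abs_digammaSucc_le (m : ℕ) : |digammaSucc m| ≤ m + 1 := by
  induction m with
  | zero =>
    have h1 := Real.one_half_lt_eulerMascheroniConstant
    have h2 := Real.eulerMascheroniConstant_lt_two_thirds
    simp only [digammaSucc, harmonic_zero]
    rw [abs_le]
    constructor <;> · push_cast; linarith
  | succ m ih =>
    rw [digammaSucc_succ]
    have h : |1 / (m + 1 : ℝ)| ≤ 1 := by
      rw [abs_of_pos (by positivity), div_le_one (by positivity)]
      have : (0 : ℝ) ≤ m := by positivity
      linarith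
    calc _ ≤ |digammaSucc m| + |1 / (m + 1 : ℝ)| := abs_add_le _ _
      _ ≤ (m + 1) + 1 := by gcongr
      _ = _ := by push_cast; ring

theorem neumannCoeff_expBounded : ExpBounded neumannCoeff := by
  refine ⟨2, fun m => ?_⟩
  have h : (1 : ℝ) ≤ (m ! : ℝ) := by exact_mod_cast Nat.one_le_iff_ne_zero.2 (Nat.factorial_ne_zero m)
  have h' : (m : ℝ) ≤ (m ! : ℝ) := by exact_mod_cast Nat.self_le_factorial m
  rw [neumannCoeff, abs_mul, besselCoeff, abs_div, abs_pow, abs_neg, abs_one, one_pow,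
    abs_of_pos (by positivity : (0 : ℝ) < (m ! : ℝ) * (m ! : ℝ))]
  have h2 := abs_digammaSucc_le m
  rw [mul_one_div, div_le_div_iff₀ (by positivity) (by positivity)]
  nlinarith [abs_nonneg (digammaSucc m)]

/-- `J_0(t) = besselProfile ((t/2)^2)`. -/
noncomputable def besselProfile : ℝ → ℝ := powerSum besselCoeff

/-- `N_0(t) = neumannProfile ((t/2)^2)` for `t > 0`. -/
noncomputable def neumannProfile (s : ℝ) : ℝ :=
  1 / Real.pi * (Real.log s * besselProfile s - 2 * powerSum neumannCoeff s)

theorem besselProfile_contDiff : ContDiff ℝ ∞ besselProfile := besselCoeff_expBounded.contDiff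

theorem besselProfile_zero : besselProfile 0 = 1 := by
  simp [besselProfile, powerSum_zero, besselCoeff]

/-- In the variable `s = (t/2)^2` the Bessel equation of order zero reads `s f'' + f' + f = 0`, and
the operator sends coefficients `c m` to `(m+1)^2 c (m+1) + c m`. The right side `d` is kept general
because the regular part of `N_0` solves an inhomogeneous equation. -/
theorem powerSum_ode {c d : ℕ → ℝ} (hc : ExpBounded c)
    (h : ∀ m : ℕ, (m + 1 : ℝ) ^ 2 * c (m + 1) + c m = d m) (s : ℝ) :
    s * deriv (deriv (powerSum c)) s + deriv (powerSum c) s + powerSum c s = powerSum d s := by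
  have e1 : s * deriv (deriv (powerSum c)) s = ∑' m : ℕ, (m * (m + 1) * c (m + 1)) * s ^ m := by
    rw [hc.deriv, hc.shift.deriv, powerSum, ← tsum_mul_left]
    have hs : Summable fun m : ℕ => (m * (m + 1) * c (m + 1)) * s ^ m := by
      rw [← summable_nat_add_iff 1]
      refine ((hc.shift.shift.summable s).mul_left s).congr fun m => ?_
      push_cast; ring
    rw [hs.tsum_eq_zero_add]
    simp only [Nat.cast_zero, zero_mul, zero_add]
    refine tsum_congr fun m => ?_
    push_cast; ring
  have hs : Summable fun m : ℕ => (m * (m + 1) * c (m + 1)) * s ^ m := by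
    rw [← summable_nat_add_iff 1]
    refine ((hc.shift.shift.summable s).mul_left s).congr fun m => ?_
    push_cast; ring
  rw [e1, hc.deriv, powerSum, powerSum, powerSum, ← hs.tsum_add (hc.shift.summable s),
    ← (hs.add (hc.shift.summable s)).tsum_add (hc.summable s)]
  refine tsum_congr fun m => ?_
  rw [← h m]; ring

theorem besselCoeff_succ (m : ℕ) : (m + 1 : ℝ) ^ 2 * besselCoeff (m + 1) = -besselCoeff m := by
  simp only [besselCoeff, Nat.factorial_succ]
  push_cast
  field_simp
  ring

theorem besselProfile_ode (s : ℝ) :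
    s * deriv (deriv besselProfile) s + deriv besselProfile s + besselProfile s = 0 := by
  have := powerSum_ode besselCoeff_expBounded (d := 0)
    (fun m => by rw [besselCoeff_succ]; simp) s
  rw [besselProfile, this]
  simp [powerSum]

/-- The source term comes from the jump `1/(m+1)` between consecutive digamma values. It is what is
needed to cancel the term `2 * deriv besselProfile` that the operator produces when it meets `log s
* besselProfile s`. -/
theorem neumannCoeff_ode (s : ℝ) :
    s * deriv (deriv (powerSum neumannCoeff)) s + deriv (powerSum neumannCoeff) s
      + powerSum neumannCoeff s = deriv besselProfile s := by
  rw [besselProfile, besselCoeff_expBounded.deriv]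
  refine powerSum_ode neumannCoeff_expBounded (fun m => ?_) s
  have h := besselCoeff_succ m
  have hm : (m + 1 : ℝ) ≠ 0 := by positivity
  simp only [neumannCoeff, digammaSucc_succ]
  have h3 : besselCoeff m = -((m + 1 : ℝ) ^ 2 * besselCoeff (m + 1)) := by linarith
  rw [h3]
  field_simp
  ring

theorem besselProfile_hasDerivAt (s : ℝ) : HasDerivAt besselProfile (deriv besselProfile s) s :=
  (besselCoeff_expBounded.hasDerivAt s).differentiableAt.hasDerivAt

theorem deriv_besselProfile_hasDerivAt (s : ℝ) :
    HasDerivAt (deriv besselProfile) (deriv (deriv besselProfile) s) s := by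
  rw [besselProfile, besselCoeff_expBounded.deriv]
  exact (besselCoeff_expBounded.shift.hasDerivAt s).differentiableAt.hasDerivAt

theorem neumannProfile_hasDerivAt {s : ℝ} (hs : 0 < s) :
    HasDerivAt neumannProfile (1 / Real.pi * (s⁻¹ * besselProfile s
      + Real.log s * deriv besselProfile s - 2 * deriv (powerSum neumannCoeff) s)) s :=
  ((((Real.hasDerivAt_log hs.ne').mul (besselProfile_hasDerivAt s))).sub
    ((neumannCoeff_expBounded.hasDerivAt s).differentiableAt.hasDerivAt.const_mul 2)).const_mul _

theorem deriv_neumannProfile {s : ℝ} (hs : 0 < s) :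
    deriv neumannProfile s = 1 / Real.pi * (s⁻¹ * besselProfile s
      + Real.log s * deriv besselProfile s - 2 * deriv (powerSum neumannCoeff) s) :=
  (neumannProfile_hasDerivAt hs).deriv

theorem deriv_neumannProfile_hasDerivAt {s : ℝ} (hs : 0 < s) :
    HasDerivAt (deriv neumannProfile) (1 / Real.pi * (-(s ^ 2)⁻¹ * besselProfile s
      + 2 * (s⁻¹ * deriv besselProfile s)
      + Real.log s * deriv (deriv besselProfile) s
      - 2 * deriv (deriv (powerSum neumannCoeff)) s)) s := by
  have hA : HasDerivAt (deriv (powerSum neumannCoeff))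
      (deriv (deriv (powerSum neumannCoeff)) s) s := by
    rw [neumannCoeff_expBounded.deriv]
    exact (neumannCoeff_expBounded.shift.hasDerivAt s).differentiableAt.hasDerivAt
  have h := ((((hasDerivAt_inv hs.ne').mul (besselProfile_hasDerivAt s)).add
    ((Real.hasDerivAt_log hs.ne').mul (deriv_besselProfile_hasDerivAt s))).sub
    (hA.const_mul 2)).const_mul (1 / Real.pi)
  refine (h.congr_of_eventuallyEq ?_).congr_deriv ?_
  · filter_upwards [lt_mem_nhds hs] with x hx
    rw [deriv_neumannProfile hx]
    rfl
  · ring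

theorem neumannProfile_ode {s : ℝ} (hs : 0 < s) :
    s * deriv (deriv neumannProfile) s + deriv neumannProfile s + neumannProfile s = 0 := by
  rw [(deriv_neumannProfile_hasDerivAt hs).deriv, deriv_neumannProfile hs, neumannProfile]
  have h1 := besselProfile_ode s
  have h2 := neumannCoeff_ode s
  have hpi := Real.pi_pos.ne'
  field_simp
  linear_combination (Real.log s * s) * h1 - 2 * s * h2

theorem neumannProfile_contDiffAt {s : ℝ} (hs : 0 < s) : ContDiffAt ℝ ∞ neumannProfile s := by
  unfold neumannProfile
  exact contDiffAt_const.mul (((Real.contDiffAt_log.2 hs.ne').mul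
    besselProfile_contDiff.contDiffAt).sub
    (contDiffAt_const.mul neumannCoeff_expBounded.contDiff.contDiffAt))

theorem besselJ_zero_eq (t : ℝ) : besselJ 0 t = besselProfile ((t / 2) ^ 2) := by
  simp only [besselJ, besselProfile, powerSum, besselCoeff, add_zero, pow_mul]

theorem neumannN_zero_eq (t : ℝ) : neumannN 0 t = neumannProfile ((t / 2) ^ 2) := by
  have h : ∑' m : ℕ, (digammaSucc m + digammaSucc (m + 0)) *
        ((-1 : ℝ) ^ m / ((m ! : ℝ) * ((m + 0)! : ℝ)) * (t / 2) ^ (2 * m + 0))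
      = 2 * powerSum neumannCoeff ((t / 2) ^ 2) := by
    rw [powerSum, ← tsum_mul_left]
    refine tsum_congr fun m => ?_
    simp only [add_zero, neumannCoeff, besselCoeff, pow_mul]
    ring
  rw [neumannN, h, besselJ_zero_eq, neumannProfile, Real.log_pow]
  simp only [Finset.range_zero, Finset.sum_empty]
  push_cast
  ring

theorem besselJ_one_eq (t : ℝ) : besselJ 1 t = -(t / 2) * deriv besselProfile ((t / 2) ^ 2) := by
  rw [besselProfile, besselCoeff_expBounded.deriv, powerSum, besselJ, ← tsum_mul_left]
  refine tsum_congr fun m => ?_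
  simp only [besselCoeff, Nat.factorial_succ, pow_succ, pow_mul]
  push_cast
  field_simp

/-- This ties the series that defines `N_1` to `-N_0'`; afterwards the series itself is no longer
needed. -/
theorem neumannN_one_eq {t : ℝ} (ht : 0 < t) :
    neumannN 1 t = -(t / 2) * deriv neumannProfile ((t / 2) ^ 2) := by
  set s : ℝ := (t / 2) ^ 2 with hs
  have hs0 : 0 < s := by positivity
  have hpi := Real.pi_pos.ne'
  have hlog : Real.log s = 2 * Real.log (t / 2) := by rw [hs, Real.log_pow]; push_cast; ring
  rw [deriv_neumannProfile hs0, neumannN, besselJ_one_eq, ← hs, hlog]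
  have hA := neumannCoeff_expBounded.shift.summable s
  have hB := besselCoeff_expBounded.shift.summable s
  have hC : Summable fun m : ℕ => besselCoeff (m + 1) * s ^ m := by
    refine (((summable_nat_add_iff 1).2 (besselCoeff_expBounded.summable s)).mul_left s⁻¹).congr
      fun m => ?_
    rw [pow_succ]; field_simp
  -- The sum splits by `digammaSucc m + digammaSucc (m+1) = 2 * digammaSucc (m+1) - 1/(m+1)`: the
  -- first part is the derivative of the regular part of `N_0`, and the second collapses to the tail
  -- `(besselProfile s - 1) / s`.
  have hsum : ∑' m : ℕ, (digammaSucc m + digammaSucc (m + 1)) *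
        ((-1 : ℝ) ^ m / ((m ! : ℝ) * ((m + 1)! : ℝ)) * (t / 2) ^ (2 * m + 1))
      = (t / 2) * (-2 * deriv (powerSum neumannCoeff) s + (besselProfile s - 1) / s) := by
    rw [neumannCoeff_expBounded.deriv, besselProfile, powerSum_eq_add besselCoeff_expBounded,
      powerSum]
    have : besselCoeff 0 = 1 := by simp [besselCoeff]
    rw [this, add_sub_cancel_left, mul_div_cancel_left₀ _ hs0.ne', ← tsum_mul_left,
      ← (hA.mul_left _).tsum_add hC, ← tsum_mul_left]
    refine tsum_congr fun m => ?_
    simp only [neumannCoeff, besselCoeff, Nat.factorial_succ, digammaSucc_succ, pow_succ, pow_mul, ← hs]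
    push_cast
    field_simp
    ring
  rw [hsum]
  simp only [Finset.range_one, Finset.sum_singleton]
  norm_num
  have ht2 : s = t / 2 * (t / 2) := by rw [hs]; ring
  rw [ht2]
  field_simp
  ring

/-! ### Regular solutions of the radial equation -/

/-- `a` solves `r (r a')' = r q(r) a` on `(0, ρ)` with `b = r a'`, and is regular at the origin. -/
structure IsRegularMode (q : ℝ → ℝ) (ρ : ℝ) (a b : ℝ → ℂ) : Prop where
  hasDerivAt_fst : ∀ r ∈ Ioo 0 ρ, HasDerivAt a (b r / r) r
  hasDerivAt_snd : ∀ r ∈ Ioo 0 ρ, HasDerivAt b (q r * a r) r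
  tendsto_snd : Tendsto b (𝓝[>] 0) (𝓝 0)
  bounded_fst : ∃ C : ℝ, ∀ᶠ r in 𝓝[>] (0 : ℝ), ‖a r‖ ≤ C

theorem tendsto_mul_zero_of_norm_le {α : Type*} {l : Filter α} {f g : α → ℂ} {C : ℝ}
    (hf : ∀ᶠ x in l, ‖f x‖ ≤ C) (hg : Tendsto g l (𝓝 0)) :
    Tendsto (fun x => f x * g x) l (𝓝 0) := by
  have h : Tendsto (fun x => C * ‖g x‖) l (𝓝 0) := by simpa using hg.norm.const_mul C
  refine squeeze_zero_norm' ?_ h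
  filter_upwards [hf] with x hx
  rw [norm_mul]
  gcongr

/-- The Wronskian has zero derivative, since `q` cancels, and at the origin it tends to zero because
`a`, `a'` stay bounded while the fluxes `b`, `b'` vanish. -/
theorem IsRegularMode.wronskian_eq_zero {q : ℝ → ℝ} {ρ : ℝ} {a b a' b' : ℝ → ℂ}
    (h : IsRegularMode q ρ a b) (h' : IsRegularMode q ρ a' b') {r : ℝ} (hr : r ∈ Ioo 0 ρ) :
    a r * b' r - a' r * b r = 0 := by
  have hd : ∀ x ∈ Ioo 0 ρ, HasDerivAt (fun x => a x * b' x - a' x * b x) 0 x := fun x hx =>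
    (((h.hasDerivAt_fst x hx).mul (h'.hasDerivAt_snd x hx)).sub
      ((h'.hasDerivAt_fst x hx).mul (h.hasDerivAt_snd x hx))).congr_deriv (by ring)
  have hconst : ∀ x ∈ Ioo 0 ρ, a x * b' x - a' x * b x = a r * b' r - a' r * b r := fun x hx =>
    isOpen_Ioo.is_const_of_deriv_eq_zero isPreconnected_Ioo
      (fun y hy => (hd y hy).differentiableAt.differentiableWithinAt)
      (fun y hy => (hd y hy).deriv) hx hr
  have hlim : Tendsto (fun x => a x * b' x - a' x * b x) (𝓝[>] 0) (𝓝 0) := by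
    obtain ⟨C, hC⟩ := h.bounded_fst
    obtain ⟨C', hC'⟩ := h'.bounded_fst
    have h1 : Tendsto (fun x => a x * b' x) (𝓝[>] 0) (𝓝 0) :=
      tendsto_mul_zero_of_norm_le hC h'.tendsto_snd
    have h2 : Tendsto (fun x => a' x * b x) (𝓝[>] 0) (𝓝 0) :=
      tendsto_mul_zero_of_norm_le hC' h.tendsto_snd
    simpa using h1.sub h2
  refine tendsto_nhds_unique (tendsto_const_nhds.congr' ?_) hlim
  filter_upwards [Ioo_mem_nhdsGT (hr.1.trans hr.2)] with x hx
  exact (hconst x hx).symm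

/-- Uniqueness for the linear first-order system. The coefficients may blow up at the origin, so the
Lipschitz bound is taken on a compact interval of positive radii that contains both `s` and `r`. -/
theorem linear_system_eq_zero {q : ℝ → ℝ} {ρ : ℝ} (hq : ContinuousOn q (Ioi 0)) {c d : ℝ → ℂ}
    (hc : ∀ r ∈ Ioo 0 ρ, HasDerivAt c (d r / r) r)
    (hd : ∀ r ∈ Ioo 0 ρ, HasDerivAt d (q r * c r) r) {s r : ℝ} (hs : s ∈ Ioo 0 ρ)
    (hr : r ∈ Ioo 0 ρ) (hcs : c s = 0) (hds : d s = 0) : c r = 0 := by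
  set α := min s r / 2 with hα
  set β := (max s r + ρ) / 2 with hβ
  have hα0 : 0 < α := by have := lt_min hs.1 hr.1; positivity
  have hαs : α < min s r := by have := lt_min hs.1 hr.1; rw [hα]; linarith
  have hβρ : β < ρ := by have := max_lt hs.2 hr.2; rw [hβ]; linarith
  have hβs : max s r < β := by have := max_lt hs.2 hr.2; rw [hβ]; linarith
  have hsub : Icc α β ⊆ Ioi 0 := fun x hx => hα0.trans_le hx.1
  obtain ⟨K, hK⟩ := isCompact_Icc.exists_bound_of_continuousOn (hq.mono hsub)
  have hmem : ∀ x ∈ Ioo α β, x ∈ Ioo 0 ρ := fun x hx => ⟨hα0.trans hx.1, hx.2.trans hβρ⟩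
  -- In the sup norm of `ℂ × ℂ` the vector field has Lipschitz constant at most the larger of `|q| ≤
  -- K` and `1/t ≤ 1/α`.
  set M : ℝ := max K α⁻¹ with hM
  have hM0 : 0 ≤ M := (inv_nonneg.2 hα0.le).trans (le_max_right _ _)
  have key := ODE_solution_unique_of_mem_Ioo (E := ℂ × ℂ) (a := α) (b := β) (t₀ := s)
    (v := fun t x => (x.2 / t, q t * x.1)) (s := fun _ => univ) (K := M.toNNReal)
    (f := fun t => (c t, d t)) (g := fun _ => 0) ?_
    ⟨hαs.trans_le (min_le_left _ _), (le_max_left _ _).trans_lt hβs⟩ ?_ ?_ ?_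
  · exact congrArg Prod.fst
      (key ⟨hαs.trans_le (min_le_right _ _), (le_max_right _ _).trans_lt hβs⟩)
  · intro t ht
    have ht0 : 0 < t := hα0.trans ht.1
    refine (LipschitzWith.of_dist_le_mul fun x y => ?_).lipschitzOnWith
    rw [Real.coe_toNNReal _ hM0, dist_eq_norm, dist_eq_norm, Prod.norm_def, Prod.norm_def]
    simp only [Prod.fst_sub, Prod.snd_sub, ← sub_div, ← mul_sub]
    refine max_le ?_ ?_
    · rw [norm_div, Complex.norm_real, Real.norm_of_nonneg ht0.le, div_eq_inv_mul]
      refine mul_le_mul ?_ (le_max_right _ _) (norm_nonneg _) hM0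
      exact (inv_anti₀ hα0 ht.1.le).trans (le_max_right _ _)
    · rw [norm_mul, Complex.norm_real]
      exact mul_le_mul ((hK t ⟨ht.1.le, ht.2.le⟩).trans (le_max_left _ _)) (le_max_left _ _)
        (norm_nonneg _) hM0
  · exact fun t ht => ⟨(hc t (hmem t ht)).prodMk (hd t (hmem t ht)), mem_univ _⟩
  · intro t _
    refine ⟨(hasDerivAt_const t (0 : ℂ × ℂ)).congr_deriv ?_, mem_univ _⟩
    simp
    rfl
  · simp only [hcs, hds]; rfl

/-- Regular solutions span at most one dimension: the combination of the two that vanishes at `s`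
also has zero flux there, by the vanishing Wronskian. This plays the role of the Bessel functions
`J_n` for all `n` without ever naming them. -/
theorem IsRegularMode.proportional {q : ℝ → ℝ} {ρ : ℝ} (hq : ContinuousOn q (Ioi 0))
    {a b a' b' : ℝ → ℂ} (h : IsRegularMode q ρ a b) (h' : IsRegularMode q ρ a' b') {r s : ℝ}
    (hr : r ∈ Ioo 0 ρ) (hs : s ∈ Ioo 0 ρ) : a r * a' s = a s * a' r := by
  have := linear_system_eq_zero (c := fun r => a r * a' s - a s * a' r)
    (d := fun r => b r * a' s - a s * b' r) hq
    (fun x hx => (((h.hasDerivAt_fst x hx).mul_const _).sub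
      ((h'.hasDerivAt_fst x hx).const_mul _)).congr_deriv (by ring))
    (fun x hx => (((h.hasDerivAt_snd x hx).mul_const _).sub
      ((h'.hasDerivAt_snd x hx).const_mul _)).congr_deriv (by ring)) hs hr (by ring)
    (by linear_combination -(h.wronskian_eq_zero h' hs))
  exact sub_eq_zero.1 this

/-! ### The unit circle of the plane -/

/-- The counterclockwise unit tangent vector `(-sin θ, cos θ)`. -/
noncomputable def unitTangent (θ : ℝ) : Plane := !₂[-Real.sin θ, Real.cos θ]

theorem hasDerivAt_toLp {f g : ℝ → ℝ} {f' g' θ : ℝ} (hf : HasDerivAt f f' θ)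
    (hg : HasDerivAt g g' θ) :
    HasDerivAt (fun θ => (!₂[f θ, g θ] : Plane)) (!₂[f', g'] : Plane) θ := by
  have h : HasDerivAt (fun θ => ![f θ, g θ]) ![f', g'] θ := by
    rw [hasDerivAt_pi]
    intro i
    fin_cases i
    · exact hf
    · exact hg
  exact (PiLp.continuousLinearEquiv 2 ℝ (fun _ : Fin 2 => ℝ)).symm.hasFDerivAt.comp_hasDerivAt θ h

theorem unitVec_hasDerivAt (θ : ℝ) : HasDerivAt unitVec (unitTangent θ) θ :=
  hasDerivAt_toLp (Real.hasDerivAt_cos θ) (Real.hasDerivAt_sin θ)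

theorem unitTangent_hasDerivAt (θ : ℝ) : HasDerivAt unitTangent (-unitVec θ) θ := by
  refine (hasDerivAt_toLp (Real.hasDerivAt_sin θ).neg (Real.hasDerivAt_cos θ)).congr_deriv ?_
  ext i; fin_cases i <;> simp [unitVec]

@[fun_prop]
theorem continuous_unitVec : Continuous unitVec :=
  continuous_iff_continuousAt.2 fun θ => (unitVec_hasDerivAt θ).continuousAt

@[fun_prop]
theorem continuous_unitTangent : Continuous unitTangent :=
  continuous_iff_continuousAt.2 fun θ => (unitTangent_hasDerivAt θ).continuousAt

@[simp]
theorem norm_unitVec (θ : ℝ) : ‖unitVec θ‖ = 1 := by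
  simp [unitVec, EuclideanSpace.norm_eq]

theorem norm_smul_unitVec {r : ℝ} (hr : 0 ≤ r) (θ : ℝ) : ‖r • unitVec θ‖ = r := by
  rw [norm_smul, norm_unitVec, mul_one, Real.norm_of_nonneg hr]

theorem unitVec_periodic : Function.Periodic unitVec (2 * Real.pi) := fun θ => by
  simp [unitVec]

theorem unitTangent_periodic : Function.Periodic unitTangent (2 * Real.pi) := fun θ => by
  simp [unitTangent]

theorem exists_eq_smul_unitVec (x : Plane) : ∃ θ ∈ Ioc (-Real.pi) Real.pi, x = ‖x‖ • unitVec θ := by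
  have hn : ‖x‖ = ‖(⟨x 0, x 1⟩ : ℂ)‖ := by
    rw [EuclideanSpace.norm_eq, Complex.norm_eq_sqrt_sq_add_sq]
    simp [Fin.sum_univ_two]
  refine ⟨Complex.arg ⟨x 0, x 1⟩, Complex.arg_mem_Ioc _, ?_⟩
  ext i
  rw [hn]
  fin_cases i
  · simp [unitVec, Complex.norm_mul_cos_arg]
  · simp [unitVec, Complex.norm_mul_sin_arg]

theorem plane_eq_sum (x : Plane) :
    x = x 0 • EuclideanSpace.single 0 (1 : ℝ) + x 1 • EuclideanSpace.single 1 (1 : ℝ) := by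
  ext i; fin_cases i <;> simp

theorem bilinear_circle_trace (B : Plane →L[ℝ] Plane →L[ℝ] ℂ) (θ : ℝ) :
    B (unitVec θ) (unitVec θ) + B (unitTangent θ) (unitTangent θ)
      = ∑ i, B (EuclideanSpace.single i 1) (EuclideanSpace.single i 1) := by
  have h1 : unitVec θ = Real.cos θ • EuclideanSpace.single 0 (1 : ℝ)
      + Real.sin θ • EuclideanSpace.single 1 (1 : ℝ) := plane_eq_sum _
  have h2 : unitTangent θ = (-Real.sin θ) • EuclideanSpace.single 0 (1 : ℝ)
      + Real.cos θ • EuclideanSpace.single 1 (1 : ℝ) := plane_eq_sum _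
  rw [h1, h2, Fin.sum_univ_two]
  simp only [map_add, map_smul, add_apply, smul_apply,
    Complex.real_smul]
  have h3 : (Real.cos θ : ℂ) ^ 2 + (Real.sin θ : ℂ) ^ 2 = 1 := by
    exact_mod_cast Real.cos_sq_add_sin_sq θ
  push_cast
  push_cast at h3
  linear_combination (B (EuclideanSpace.single 0 1) (EuclideanSpace.single 0 1)
    + B (EuclideanSpace.single 1 1) (EuclideanSpace.single 1 1)) * h3

theorem laplacian_eq_sum_fderiv {F : Type*} [NormedAddCommGroup F] [NormedSpace ℝ F]
    (f : Plane → F) (x : Plane) :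
    Δ f x = ∑ i, fderiv ℝ (fderiv ℝ f) x (EuclideanSpace.single i 1)
      (EuclideanSpace.single i 1) := by
  rw [InnerProductSpace.laplacian_eq_iteratedFDeriv_orthonormalBasis f
    (EuclideanSpace.basisFun (Fin 2) ℝ)]
  simp [iteratedFDeriv_two_apply]

theorem laplacian_eq_circle (f : Plane → ℂ) (x : Plane) (θ : ℝ) :
    Δ f x = fderiv ℝ (fderiv ℝ f) x (unitVec θ) (unitVec θ)
      + fderiv ℝ (fderiv ℝ f) x (unitTangent θ) (unitTangent θ) := by
  rw [bilinear_circle_trace, laplacian_eq_sum_fderiv]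

/-! ### Integrals over the circle depending on a parameter -/

theorem hasDerivAt_circle_integral {F F' : ℝ → ℝ → ℂ} {I : Set ℝ} (hI : IsOpen I) {r : ℝ}
    (hr : r ∈ I) (hF : ∀ x ∈ I, Continuous (F x))
    (hF' : ContinuousOn (fun p : ℝ × ℝ => F' p.1 p.2) (I ×ˢ univ))
    (hd : ∀ x ∈ I, ∀ θ, HasDerivAt (fun y => F y θ) (F' x θ) x) (a b : ℝ) :
    HasDerivAt (fun x => ∫ θ in a..b, F x θ) (∫ θ in a..b, F' r θ) r := by
  obtain ⟨ε, hε, hball⟩ := Metric.isOpen_iff.1 hI r hr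
  have hsub : Metric.closedBall r (ε / 2) ⊆ I :=
    (Metric.closedBall_subset_ball (by linarith)).trans hball
  obtain ⟨C, hC⟩ := ((isCompact_closedBall r (ε / 2)).prod
    (isCompact_uIcc (a := a) (b := b))).exists_bound_of_continuousOn
    (hF'.mono (prod_mono hsub (subset_univ _)))
  have hFr : Continuous (F' r) := by
    rw [← continuousOn_univ]
    exact hF'.comp (f := fun θ => (r, θ)) (by fun_prop) fun θ _ => ⟨hr, mem_univ _⟩
  refine (intervalIntegral.hasDerivAt_integral_of_dominated_loc_of_deriv_le
    (s := Metric.ball r (ε / 2)) (bound := fun _ => C) (Metric.ball_mem_nhds r (by linarith)) ?_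
    ((hF r hr).intervalIntegrable _ _) hFr.aestronglyMeasurable ?_ (by simp) ?_).2
  · filter_upwards [hI.mem_nhds hr] with x hx
    exact (hF x hx).aestronglyMeasurable
  · refine Eventually.of_forall fun θ hθ x hx => hC (x, θ) ⟨Metric.ball_subset_closedBall hx, ?_⟩
    exact uIoc_subset_uIcc hθ
  · exact Eventually.of_forall fun θ _ x hx => hd x (hsub (Metric.ball_subset_closedBall hx)) θ

/-- The character `exp(-inθ)` of the circle. -/
noncomputable def circleChar (n : ℤ) (θ : ℝ) : ℂ := Complex.exp (-(n * θ) * Complex.I)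

@[fun_prop]
theorem continuous_circleChar (n : ℤ) : Continuous (circleChar n) := by
  unfold circleChar; fun_prop

theorem circleChar_hasDerivAt (n : ℤ) (θ : ℝ) :
    HasDerivAt (circleChar n) (-(n * Complex.I) * circleChar n θ) θ := by
  have h : HasDerivAt (fun θ : ℝ => -((n : ℂ) * (θ : ℂ)) * Complex.I) (-(n * 1) * Complex.I) θ :=
    (((Complex.ofRealCLM.hasDerivAt (x := θ)).const_mul (n : ℂ)).neg).mul_const _
  exact h.cexp.congr_deriv (by rw [circleChar]; ring)

theorem circleChar_periodic (n : ℤ) : Function.Periodic (circleChar n) (2 * Real.pi) := fun θ => by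
  rw [circleChar, circleChar, Complex.exp_eq_exp_iff_exists_int]
  exact ⟨-n, by push_cast; ring⟩

theorem norm_circleChar (n : ℤ) (θ : ℝ) : ‖circleChar n θ‖ = 1 := by
  rw [circleChar, show -((n : ℂ) * (θ : ℂ)) * Complex.I = ((-(n * θ) : ℝ) : ℂ) * Complex.I by
    push_cast; ring]
  exact Complex.norm_exp_ofReal_mul_I _

theorem integral_circleChar_mul_deriv (n : ℤ) {g g' : ℝ → ℂ} (hg : Function.Periodic g (2 * Real.pi))
    (hd : ∀ θ, HasDerivAt g (g' θ) θ) (hg' : Continuous g') :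
    ∫ θ in (0)..(2 * Real.pi), circleChar n θ * g' θ
      = n * Complex.I * ∫ θ in (0)..(2 * Real.pi), circleChar n θ * g θ := by
  have hgc : Continuous g := continuous_iff_continuousAt.2 fun θ => (hd θ).continuousAt
  have h := intervalIntegral.integral_eq_sub_of_hasDerivAt (a := 0) (b := 2 * Real.pi)
    (f := fun θ => circleChar n θ * g θ)
    (f' := fun θ => -(n * Complex.I) * (circleChar n θ * g θ) + circleChar n θ * g' θ)
    (fun θ _ => ((circleChar_hasDerivAt n θ).mul (hd θ)).congr_deriv (by ring))
    (Continuous.intervalIntegrable (by fun_prop) _ _)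
  have hp : circleChar n (2 * Real.pi) * g (2 * Real.pi) = circleChar n 0 * g 0 := by
    have h1 := circleChar_periodic n 0
    have h2 := hg 0
    rw [zero_add] at h1 h2
    rw [h1, h2]
  rw [intervalIntegral.integral_add (Continuous.intervalIntegrable (by fun_prop) _ _)
    (Continuous.intervalIntegrable (by fun_prop) _ _), intervalIntegral.integral_const_mul, hp,
    sub_self] at h
  linear_combination h

/-- The Fourier mode `∫ exp(-inθ) f(r (cos θ, sin θ)) dθ`. -/
noncomputable def circleMode (n : ℤ) (f : Plane → ℂ) (r : ℝ) : ℂ :=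
  ∫ θ in (0)..(2 * Real.pi), circleChar n θ * f (r • unitVec θ)

/-- The Fourier mode of `r ∂_r f`. -/
noncomputable def circleFluxMode (n : ℤ) (f : Plane → ℂ) (r : ℝ) : ℂ :=
  ∫ θ in (0)..(2 * Real.pi), circleChar n θ * (r * fderiv ℝ f (r • unitVec θ) (unitVec θ))

theorem smul_unitVec_mem_ball {ρ r : ℝ} (hr : r ∈ Ioo (-ρ) ρ) (θ : ℝ) :
    r • unitVec θ ∈ Metric.ball (0 : Plane) ρ := by
  rw [mem_ball_zero_iff, norm_smul, norm_unitVec, mul_one, Real.norm_eq_abs, abs_lt]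
  exact hr

theorem circle_mapsTo {ρ : ℝ} : MapsTo (fun p : ℝ × ℝ => p.1 • unitVec p.2)
    (Ioo (-ρ) ρ ×ˢ univ) (Metric.ball (0 : Plane) ρ) :=
  fun p hp => smul_unitVec_mem_ball hp.1 p.2

theorem ContinuousOn.comp_circle {X : Type*} [TopologicalSpace X] {ρ : ℝ} {f : Plane → X}
    (hf : ContinuousOn f (Metric.ball 0 ρ)) :
    ContinuousOn (fun p : ℝ × ℝ => f (p.1 • unitVec p.2)) (Ioo (-ρ) ρ ×ˢ univ) :=
  hf.comp (by fun_prop) circle_mapsTo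

theorem ContinuousOn.comp_circle_const {X : Type*} [TopologicalSpace X] {ρ : ℝ} {f : Plane → X}
    (hf : ContinuousOn f (Metric.ball 0 ρ)) {r : ℝ} (hr : r ∈ Ioo (-ρ) ρ) :
    Continuous (fun θ : ℝ => f (r • unitVec θ)) := by
  rw [← continuousOn_univ]
  exact hf.comp (by fun_prop) fun θ _ => smul_unitVec_mem_ball hr θ

section mode
variable {f : Plane → ℂ} {ρ : ℝ}

theorem circleMode_hasDerivAt (hf : ContDiffOn ℝ 2 f (Metric.ball 0 ρ)) (n : ℤ) {r : ℝ}
    (hr : r ∈ Ioo 0 ρ) : HasDerivAt (circleMode n f) (circleFluxMode n f r / r) r := by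
  have hr' : r ∈ Ioo (-ρ) ρ := ⟨by linarith [hr.1, hr.2], hr.2⟩
  have h1 := hf.continuousOn_fderiv_of_isOpen Metric.isOpen_ball (by norm_num)
  have hr0 : (r : ℂ) ≠ 0 := by exact_mod_cast hr.1.ne'
  refine (hasDerivAt_circle_integral
    (F' := fun r θ => circleChar n θ * fderiv ℝ f (r • unitVec θ) (unitVec θ))
    isOpen_Ioo hr' ?_ ?_ ?_ 0 (2 * Real.pi)).congr_deriv ?_
  · intro x hx
    exact (continuous_circleChar n).mul (hf.continuousOn.comp_circle_const hx)
  · exact ((continuous_circleChar n).comp continuous_snd).continuousOn.mul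
      (h1.comp_circle.clm_apply (by fun_prop))
  · intro x hx θ
    have hx' := (hf.contDiffAt (Metric.isOpen_ball.mem_nhds (smul_unitVec_mem_ball hx θ))
      ).differentiableAt (by norm_num)
    have h2 : HasDerivAt (fun y : ℝ => y • unitVec θ) (unitVec θ) x := by
      simpa using (hasDerivAt_id x).smul_const (unitVec θ)
    exact (hx'.hasFDerivAt.comp_hasDerivAt x h2).const_mul _
  · rw [circleFluxMode, eq_div_iff hr0, ← intervalIntegral.integral_mul_const]
    refine intervalIntegral.integral_congr fun θ _ => ?_
    ring

/-- The bracket is the second `θ`-derivative of `f(r (cos θ, sin θ))`; its radial term appears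
because the tangent vector itself turns. Two integrations by parts against the character give
`(in)^2`. -/
theorem circleMode_angular (hf : ContDiffOn ℝ 2 f (Metric.ball 0 ρ)) (n : ℤ) {r : ℝ}
    (hr : r ∈ Ioo 0 ρ) :
    ∫ θ in (0)..(2 * Real.pi), circleChar n θ *
      (r ^ 2 * fderiv ℝ (fderiv ℝ f) (r • unitVec θ) (unitTangent θ) (unitTangent θ)
        - r * fderiv ℝ f (r • unitVec θ) (unitVec θ)) = -(n ^ 2) * circleMode n f r := by
  have hr' : r ∈ Ioo (-ρ) ρ := ⟨by linarith [hr.1, hr.2], hr.2⟩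
  have hc1 := hf.continuousOn_fderiv_of_isOpen Metric.isOpen_ball (by norm_num)
  have hf1 : ContDiffOn ℝ 1 (fderiv ℝ f) (Metric.ball 0 ρ) :=
    hf.fderiv_of_isOpen Metric.isOpen_ball (by norm_num)
  have hc2 := hf1.continuousOn_fderiv_of_isOpen Metric.isOpen_ball (by norm_num)
  have hv : ∀ θ, HasDerivAt (fun θ => r • unitVec θ) (r • unitTangent θ) θ := fun θ =>
    (unitVec_hasDerivAt θ).const_smul r
  have hat : ∀ θ, r • unitVec θ ∈ Metric.ball (0 : Plane) ρ := smul_unitVec_mem_ball hr'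
  have e1 : ∀ θ, HasDerivAt (fun θ => f (r • unitVec θ))
      (r * fderiv ℝ f (r • unitVec θ) (unitTangent θ)) θ := fun θ => by
    have h := ((hf.contDiffAt (Metric.isOpen_ball.mem_nhds (hat θ))).differentiableAt
      (by norm_num)).hasFDerivAt.comp_hasDerivAt θ (hv θ)
    exact h.congr_deriv (by simp)
  have e2 : ∀ θ, HasDerivAt (fun θ => (r : ℂ) * fderiv ℝ f (r • unitVec θ) (unitTangent θ))
      (r ^ 2 * fderiv ℝ (fderiv ℝ f) (r • unitVec θ) (unitTangent θ) (unitTangent θ)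
        - r * fderiv ℝ f (r • unitVec θ) (unitVec θ)) θ := fun θ => by
    have h := ((hf1.contDiffAt (Metric.isOpen_ball.mem_nhds (hat θ))).differentiableAt
      (by norm_num)).hasFDerivAt.comp_hasDerivAt θ (hv θ)
    exact ((h.clm_apply (unitTangent_hasDerivAt θ)).const_mul (r : ℂ)).congr_deriv
      (by simp; ring)
  have c1 : Continuous fun θ => fderiv ℝ f (r • unitVec θ) := hc1.comp_circle_const hr'
  have c2 : Continuous fun θ => fderiv ℝ (fderiv ℝ f) (r • unitVec θ) := hc2.comp_circle_const hr'
  rw [integral_circleChar_mul_deriv n (fun θ => by rw [unitVec_periodic, unitTangent_periodic]) e2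
    (by fun_prop), integral_circleChar_mul_deriv n (fun θ => by rw [unitVec_periodic]) e1
    (by fun_prop), circleMode]
  linear_combination (n : ℂ) ^ 2 * (∫ θ in (0)..(2 * Real.pi), circleChar n θ * f (r • unitVec θ))
    * Complex.I_sq

/-- The Laplacian in polar coordinates: `∂_r (r ∂_r f)` equals `r Δf` minus `1/r` times the second
angular derivative, and the latter acts on the mode as `-n^2`. -/
theorem circleFluxMode_hasDerivAt (hf : ContDiffOn ℝ 2 f (Metric.ball 0 ρ)) (n : ℤ) {r : ℝ}
    (hr : r ∈ Ioo 0 ρ) :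
    HasDerivAt (circleFluxMode n f) (n ^ 2 / r * circleMode n f r + r * circleMode n (Δ f) r) r := by
  have hr' : r ∈ Ioo (-ρ) ρ := ⟨by linarith [hr.1, hr.2], hr.2⟩
  have hr0 : (r : ℂ) ≠ 0 := by exact_mod_cast hr.1.ne'
  have hc1 := hf.continuousOn_fderiv_of_isOpen Metric.isOpen_ball (by norm_num)
  have hf1 : ContDiffOn ℝ 1 (fderiv ℝ f) (Metric.ball 0 ρ) :=
    hf.fderiv_of_isOpen Metric.isOpen_ball (by norm_num)
  have hc2 := hf1.continuousOn_fderiv_of_isOpen Metric.isOpen_ball (by norm_num)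
  have c0 : Continuous fun θ => f (r • unitVec θ) := hf.continuousOn.comp_circle_const hr'
  have c1 : Continuous fun θ => fderiv ℝ f (r • unitVec θ) := hc1.comp_circle_const hr'
  have c2 : Continuous fun θ => fderiv ℝ (fderiv ℝ f) (r • unitVec θ) := hc2.comp_circle_const hr'
  refine (hasDerivAt_circle_integral
    (F' := fun r θ => circleChar n θ * (fderiv ℝ f (r • unitVec θ) (unitVec θ)
      + r * fderiv ℝ (fderiv ℝ f) (r • unitVec θ) (unitVec θ) (unitVec θ)))
    isOpen_Ioo hr' ?_ ?_ ?_ 0 (2 * Real.pi)).congr_deriv ?_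
  · intro x hx
    have := hc1.comp_circle_const hx
    fun_prop
  · have d1 := hc1.comp_circle.clm_apply (g := fun p : ℝ × ℝ => unitVec p.2) (by fun_prop)
    have d2 := (hc2.comp_circle.clm_apply (g := fun p : ℝ × ℝ => unitVec p.2)
      (by fun_prop)).clm_apply (g := fun p : ℝ × ℝ => unitVec p.2) (by fun_prop)
    refine ((continuous_circleChar n).comp continuous_snd).continuousOn.mul (d1.add ?_)
    exact (Continuous.continuousOn (by fun_prop)).mul d2
  · intro x hx θ
    have hx' := (hf1.contDiffAt (Metric.isOpen_ball.mem_nhds (smul_unitVec_mem_ball hx θ))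
      ).differentiableAt (by norm_num)
    have h2 : HasDerivAt (fun y : ℝ => y • unitVec θ) (unitVec θ) x := by
      simpa using (hasDerivAt_id x).smul_const (unitVec θ)
    have h3 : HasDerivAt (fun y : ℝ => fderiv ℝ f (y • unitVec θ))
        (fderiv ℝ (fderiv ℝ f) (x • unitVec θ) (unitVec θ)) x :=
      hx'.hasFDerivAt.comp_hasDerivAt x h2
    have h4 : HasDerivAt (fun y : ℝ => fderiv ℝ f (y • unitVec θ) (unitVec θ))
        (fderiv ℝ (fderiv ℝ f) (x • unitVec θ) (unitVec θ) (unitVec θ)) x :=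
      (h3.clm_apply (hasDerivAt_const x (unitVec θ))).congr_deriv (by simp)
    have h5 : HasDerivAt (fun y : ℝ => (y : ℂ)) 1 x := Complex.ofRealCLM.hasDerivAt
    exact ((h5.mul h4).const_mul (circleChar n θ)).congr_deriv (by rw [one_mul])
  · have key := circleMode_angular hf n hr
    have e : ∫ θ in (0)..(2 * Real.pi), circleChar n θ * (fderiv ℝ f (r • unitVec θ) (unitVec θ)
          + r * fderiv ℝ (fderiv ℝ f) (r • unitVec θ) (unitVec θ) (unitVec θ))
        = (∫ θ in (0)..(2 * Real.pi), r * (circleChar n θ * Δ f (r • unitVec θ)))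
          - ∫ θ in (0)..(2 * Real.pi), (r : ℂ)⁻¹ * (circleChar n θ *
      (r ^ 2 * fderiv ℝ (fderiv ℝ f) (r • unitVec θ) (unitTangent θ) (unitTangent θ)
        - r * fderiv ℝ f (r • unitVec θ) (unitVec θ))) := by
      simp_rw [fun θ => laplacian_eq_circle f (r • unitVec θ) θ]
      rw [← intervalIntegral.integral_sub (Continuous.intervalIntegrable (by fun_prop) _ _)
        (Continuous.intervalIntegrable (by fun_prop) _ _)]
      refine intervalIntegral.integral_congr fun θ _ => ?_
      field_simp
      ring
    rw [e, intervalIntegral.integral_const_mul, intervalIntegral.integral_const_mul, key,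
      circleMode, circleMode]
    field_simp
    ring

theorem tendsto_circleFluxMode (hρ : 0 < ρ) (hf : ContDiffOn ℝ 2 f (Metric.ball 0 ρ)) (n : ℤ) :
    Tendsto (circleFluxMode n f) (𝓝[>] 0) (𝓝 0) := by
  have hc1 := (hf.continuousOn_fderiv_of_isOpen Metric.isOpen_ball (by norm_num)).continuousAt
    (Metric.ball_mem_nhds (0 : Plane) hρ)
  obtain ⟨δ, hδ, hb⟩ := Metric.continuousAt_iff.1 hc1 1 one_pos
  set C := ‖fderiv ℝ f 0‖ + 1
  have hlim : Tendsto (fun r : ℝ => r * C * |2 * Real.pi - 0|) (𝓝[>] 0) (𝓝 0) := by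
    have : Tendsto (fun r : ℝ => r * C * |2 * Real.pi - 0|) (𝓝 0) (𝓝 (0 * C * |2 * Real.pi - 0|)) :=
      Continuous.tendsto (by fun_prop) 0
    simpa using this.mono_left nhdsWithin_le_nhds
  refine squeeze_zero_norm' ?_ hlim
  filter_upwards [Ioo_mem_nhdsGT hδ] with r hr
  refine intervalIntegral.norm_integral_le_of_norm_le_const fun θ _ => ?_
  have h1 : ‖fderiv ℝ f (r • unitVec θ)‖ ≤ C := by
    have h2 := hb (x := r • unitVec θ) (by
      rw [dist_zero_right, norm_smul_unitVec hr.1.le]; exact hr.2)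
    rw [dist_eq_norm] at h2
    have := norm_le_insert' (fderiv ℝ f (r • unitVec θ)) (fderiv ℝ f 0)
    linarith
  rw [norm_mul, norm_circleChar, one_mul, norm_mul, Complex.norm_real, Real.norm_of_nonneg hr.1.le]
  refine mul_le_mul_of_nonneg_left ?_ hr.1.le
  exact ((fderiv ℝ f (r • unitVec θ)).le_opNorm _).trans (by simpa using h1)

theorem bounded_circleMode (hρ : 0 < ρ) (hf : ContinuousOn f (Metric.ball 0 ρ)) (n : ℤ) :
    ∃ C : ℝ, ∀ᶠ r in 𝓝[>] (0 : ℝ), ‖circleMode n f r‖ ≤ C := by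
  have hc := hf.continuousAt (Metric.ball_mem_nhds (0 : Plane) hρ)
  obtain ⟨δ, hδ, hb⟩ := Metric.continuousAt_iff.1 hc 1 one_pos
  refine ⟨(‖f 0‖ + 1) * |2 * Real.pi - 0|, ?_⟩
  filter_upwards [Ioo_mem_nhdsGT hδ] with r hr
  refine intervalIntegral.norm_integral_le_of_norm_le_const fun θ _ => ?_
  have h2 := hb (x := r • unitVec θ) (by
    rw [dist_zero_right, norm_smul_unitVec hr.1.le]; exact hr.2)
  rw [dist_eq_norm] at h2
  have := norm_le_insert' (f (r • unitVec θ)) (f 0)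
  rw [norm_mul, norm_circleChar, one_mul]
  linarith

/-- Separation of variables: smoothness at the centre of the disc supplies the regularity at `r = 0`
that makes each mode unique up to a scalar. -/
theorem isRegularMode_circleMode (hρ : 0 < ρ) (hf : ContDiffOn ℝ 2 f (Metric.ball 0 ρ)) {k : ℝ}
    (hk : ∀ x ∈ Metric.ball (0 : Plane) ρ, Δ f x = -(k : ℂ) ^ 2 * f x) (n : ℤ) :
    IsRegularMode (fun r => n ^ 2 / r - k ^ 2 * r) ρ (circleMode n f) (circleFluxMode n f) where
  hasDerivAt_fst _ hr := circleMode_hasDerivAt hf n hr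
  hasDerivAt_snd r hr := by
    refine (circleFluxMode_hasDerivAt hf n hr).congr_deriv ?_
    have : circleMode n (Δ f) r = -(k : ℂ) ^ 2 * circleMode n f r := by
      rw [circleMode, circleMode, ← intervalIntegral.integral_const_mul]
      refine intervalIntegral.integral_congr fun θ _ => ?_
      rw [hk _ (smul_unitVec_mem_ball ⟨by linarith [hr.1, hr.2], hr.2⟩ θ)]
      ring
    rw [this]
    push_cast
    ring
  tendsto_snd := tendsto_circleFluxMode hρ hf n
  bounded_fst := bounded_circleMode hρ hf.continuousOn n

theorem continuousOn_modeCoefficient (n : ℤ) (k : ℝ) :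
    ContinuousOn (fun r : ℝ => (n : ℝ) ^ 2 / r - k ^ 2 * r) (Ioi 0) := by
  refine ContinuousOn.sub (ContinuousOn.div (by fun_prop) (by fun_prop) fun x hx => ?_)
    (by fun_prop)
  exact (mem_Ioi.1 hx).ne'

end mode

/-! ### The Laplace integral of the Hankel function -/

/-- The square root of `s - 2i` with positive real part. -/
noncomputable def shiftedSqrt (s : ℝ) : ℂ := Complex.exp (Complex.log (s - 2 * Complex.I) / 2)

theorem shift_mem_slitPlane (s : ℝ) : (s : ℂ) - 2 * Complex.I ∈ Complex.slitPlane := by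
  rw [Complex.mem_slitPlane_iff]; right; simp

theorem shiftedSqrt_sq (s : ℝ) : shiftedSqrt s ^ 2 = s - 2 * Complex.I := by
  rw [shiftedSqrt, ← Complex.exp_nat_mul]
  push_cast
  rw [mul_div_cancel₀ _ (two_ne_zero), Complex.exp_log (Complex.slitPlane_ne_zero (shift_mem_slitPlane s))]

theorem shiftedSqrt_ne_zero (s : ℝ) : shiftedSqrt s ≠ 0 := Complex.exp_ne_zero _

theorem shiftedSqrt_re_pos (s : ℝ) : 0 < (shiftedSqrt s).re := by
  rw [shiftedSqrt, Complex.exp_re]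
  refine mul_pos (Real.exp_pos _) (Real.cos_pos_of_mem_Ioo ?_)
  have h1 := Complex.neg_pi_lt_arg ((s : ℂ) - 2 * Complex.I)
  have h2 := Complex.arg_le_pi ((s : ℂ) - 2 * Complex.I)
  have h3 := Complex.slitPlane_arg_ne_pi (shift_mem_slitPlane s)
  have h4 := lt_of_le_of_ne h2 h3
  have h5 : (Complex.log ((s : ℂ) - 2 * Complex.I) / 2).im
      = ((s : ℂ) - 2 * Complex.I).arg / 2 := by
    rw [Complex.div_im]; simp [Complex.log_im]
    ring
  rw [h5]
  constructor <;> linarith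

theorem norm_shiftedSqrt_sq (s : ℝ) : ‖shiftedSqrt s‖ ^ 2 = √(s ^ 2 + 4) := by
  rw [← norm_pow, shiftedSqrt_sq, Complex.norm_eq_sqrt_sq_add_sq]
  congr 1
  simp; norm_num

theorem two_le_norm_shiftedSqrt_sq (s : ℝ) : 2 ≤ ‖shiftedSqrt s‖ ^ 2 := by
  rw [norm_shiftedSqrt_sq]
  exact Real.le_sqrt_of_sq_le (by nlinarith [sq_nonneg s])

theorem one_le_norm_shiftedSqrt (s : ℝ) : 1 ≤ ‖shiftedSqrt s‖ := by
  have := two_le_norm_shiftedSqrt_sq s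
  nlinarith [norm_nonneg (shiftedSqrt s)]

theorem shiftedSqrt_hasDerivAt (s : ℝ) :
    HasDerivAt shiftedSqrt ((2 * shiftedSqrt s)⁻¹) s := by
  have h1 : HasDerivAt (fun s : ℝ => (s : ℂ) - 2 * Complex.I) 1 s :=
    (Complex.ofRealCLM.hasDerivAt (x := s)).sub_const _
  have h2 := ((h1.clog_real (shift_mem_slitPlane s)).div_const 2).cexp
  have := shiftedSqrt_ne_zero s
  refine h2.congr_deriv ?_
  change shiftedSqrt s * _ = _
  rw [← shiftedSqrt_sq]
  field_simp

@[fun_prop]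
theorem continuous_shiftedSqrt : Continuous shiftedSqrt :=
  continuous_iff_continuousAt.2 fun s => (shiftedSqrt_hasDerivAt s).continuousAt

/-- The moment `∫ s^p e^{-ts} (s - 2i)^{-1/2} ds`. -/
noncomputable def hankelMoment (p t : ℝ) : ℂ :=
  ∫ s in Ioi (0 : ℝ), ((s ^ p * Real.exp (-(t * s)) : ℝ) : ℂ) * (shiftedSqrt s)⁻¹

theorem integrableOn_rpow_mul_exp {p t : ℝ} (hp : -1 < p) (ht : 0 < t) :
    IntegrableOn (fun s : ℝ => s ^ p * Real.exp (-(t * s))) (Ioi 0) := by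
  simpa using integrableOn_rpow_mul_exp_neg_mul_rpow hp one_pos ht

theorem norm_hankelIntegrand_le (p t : ℝ) {s : ℝ} (hs : 0 < s) :
    ‖((s ^ p * Real.exp (-(t * s)) : ℝ) : ℂ) * (shiftedSqrt s)⁻¹‖
      ≤ s ^ p * Real.exp (-(t * s)) := by
  have h0 : 0 ≤ s ^ p * Real.exp (-(t * s)) := by positivity
  rw [norm_mul, Complex.norm_real, Real.norm_of_nonneg h0, norm_inv]
  exact mul_le_of_le_one_right h0 (inv_le_one_of_one_le₀ (one_le_norm_shiftedSqrt s))

theorem aestronglyMeasurable_hankelIntegrand (p t : ℝ) :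
    AEStronglyMeasurable
      (fun s : ℝ => ((s ^ p * Real.exp (-(t * s)) : ℝ) : ℂ) * (shiftedSqrt s)⁻¹)
      (volume.restrict (Ioi 0)) := by
  refine ContinuousOn.aestronglyMeasurable (fun s hs => ?_) measurableSet_Ioi
  have h1 : ContinuousAt (fun s : ℝ => s ^ p) s :=
    Real.continuousAt_rpow_const _ _ (Or.inl (mem_Ioi.1 hs).ne')
  have h2 : ContinuousAt (fun s : ℝ => ((s ^ p * Real.exp (-(t * s)) : ℝ) : ℂ)) s :=
    Complex.continuous_ofReal.continuousAt.comp (h1.mul (by fun_prop))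
  exact (h2.mul (continuous_shiftedSqrt.continuousAt.inv₀
    (shiftedSqrt_ne_zero s))).continuousWithinAt

theorem integrableOn_hankelIntegrand {p t : ℝ} (hp : -1 < p) (ht : 0 < t) :
    IntegrableOn (fun s : ℝ => ((s ^ p * Real.exp (-(t * s)) : ℝ) : ℂ) * (shiftedSqrt s)⁻¹)
      (Ioi 0) := by
  refine (integrableOn_rpow_mul_exp hp ht).mono' (aestronglyMeasurable_hankelIntegrand p t) ?_
  exact (ae_restrict_iff' measurableSet_Ioi).2 (Eventually.of_forall fun s hs =>
    norm_hankelIntegrand_le p t hs)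

theorem norm_hankelMoment_le {p t : ℝ} (hp : -1 < p) (ht : 0 < t) :
    ‖hankelMoment p t‖ ≤ Real.Gamma (p + 1) * (1 / t) ^ (p + 1) := by
  have h := Real.integral_rpow_mul_exp_neg_mul_Ioi (a := p + 1) (r := t) (by linarith) ht
  rw [add_sub_cancel_right] at h
  rw [mul_comm, ← h]
  refine norm_integral_le_of_norm_le (integrableOn_rpow_mul_exp hp ht) ?_
  exact (ae_restrict_iff' measurableSet_Ioi).2 (Eventually.of_forall fun s hs =>
    norm_hankelIntegrand_le p t hs)

theorem hankelMoment_hasDerivAt {p t : ℝ} (hp : -1 < p) (ht : 0 < t) :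
    HasDerivAt (hankelMoment p) (-hankelMoment (p + 1) t) t := by
  have h := hasDerivAt_integral_of_dominated_loc_of_deriv_le (μ := volume.restrict (Ioi 0))
    (F := fun t s => ((s ^ p * Real.exp (-(t * s)) : ℝ) : ℂ) * (shiftedSqrt s)⁻¹)
    (F' := fun t s => -(((s ^ (p + 1) * Real.exp (-(t * s)) : ℝ) : ℂ) * (shiftedSqrt s)⁻¹))
    (x₀ := t) (s := Ioi (t / 2)) (bound := fun s => s ^ (p + 1) * Real.exp (-(t / 2 * s)))
    (Ioi_mem_nhds (by linarith))
    (Eventually.of_forall fun x => aestronglyMeasurable_hankelIntegrand p x)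
    (integrableOn_hankelIntegrand hp ht) (aestronglyMeasurable_hankelIntegrand (p + 1) t).neg
    ((ae_restrict_iff' measurableSet_Ioi).2 (Eventually.of_forall fun s hs x hx => ?_))
    (integrableOn_rpow_mul_exp (by linarith) (by linarith))
    ((ae_restrict_iff' measurableSet_Ioi).2 (Eventually.of_forall fun s hs x hx => ?_))
  · refine h.2.congr_deriv ?_
    rw [integral_neg, hankelMoment]
  · rw [norm_neg]
    refine (norm_hankelIntegrand_le _ _ hs).trans ?_
    have h1 : (0 : ℝ) < s := hs
    have h2 : t / 2 < x := hx
    gcongr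
  · have h1 : HasDerivAt (fun x : ℝ => s ^ p * Real.exp (-(x * s)))
        (-(s ^ (p + 1) * Real.exp (-(x * s)))) x := by
      have h2 := (((hasDerivAt_id x).mul_const s).neg.exp).const_mul (s ^ p)
      refine h2.congr_deriv ?_
      rw [Real.rpow_add hs, Real.rpow_one]
      simp
      ring
    refine (h1.ofReal_comp.mul_const _).congr_deriv ?_
    push_cast
    ring

theorem hasDerivAt_exp_neg_mul (t s : ℝ) :
    HasDerivAt (fun s : ℝ => Real.exp (-(t * s))) (-t * Real.exp (-(t * s))) s :=
  (((hasDerivAt_id s).const_mul t).neg.exp).congr_deriv (by simp; ring)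

/-- Integration by parts, which gives the Bessel equation. -/
theorem hankelMoment_parts {t : ℝ} (ht : 0 < t) :
    (t : ℂ) * (hankelMoment (3 / 2) t - 2 * Complex.I * hankelMoment (1 / 2) t)
      = hankelMoment (1 / 2) t - Complex.I * hankelMoment (-1 / 2) t := by
  have i1 := integrableOn_hankelIntegrand (p := 3 / 2) (by norm_num) ht
  have i2 := integrableOn_hankelIntegrand (p := 1 / 2) (by norm_num) ht
  have i3 := integrableOn_hankelIntegrand (p := -1 / 2) (by norm_num) ht
  set E : ℝ → ℝ → ℂ := fun p s => ((s ^ p * Real.exp (-(t * s)) : ℝ) : ℂ) * (shiftedSqrt s)⁻¹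
    with hE
  have hint : IntegrableOn (fun s => -(t : ℂ) * (E (3 / 2) s - 2 * Complex.I * E (1 / 2) s)
      + (E (1 / 2) s - Complex.I * E (-1 / 2) s)) (Ioi 0) :=
    ((i1.sub (i2.const_mul _)).const_mul _).add (i2.sub (i3.const_mul _))
  -- The identity is the integral of the total derivative of `√s * exp(-ts) * √(s - 2i)`, a function
  -- that vanishes at both ends.
  have key := integral_Ioi_of_hasDerivAt_of_tendsto
    (f := fun s : ℝ => ((√s * Real.exp (-(t * s)) : ℝ) : ℂ) * shiftedSqrt s)
    (m := 0) (a := 0) (Continuous.continuousWithinAt (by fun_prop)) ?_ hint ?_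
  · have e1 : ∫ s in Ioi 0, (-(t : ℂ) * (E (3 / 2) s - 2 * Complex.I * E (1 / 2) s)
      + (E (1 / 2) s - Complex.I * E (-1 / 2) s))
      = -(t : ℂ) * (hankelMoment (3 / 2) t - 2 * Complex.I * hankelMoment (1 / 2) t)
        + (hankelMoment (1 / 2) t - Complex.I * hankelMoment (-1 / 2) t) := by
      have j1 : IntegrableOn (E (3 / 2)) (Ioi 0) := i1
      have j2 : IntegrableOn (E (1 / 2)) (Ioi 0) := i2
      have j3 : IntegrableOn (E (-1 / 2)) (Ioi 0) := i3
      have k1 : IntegrableOn (fun s => E (3 / 2) s - 2 * Complex.I * E (1 / 2) s) (Ioi 0) :=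
        j1.sub (j2.const_mul _)
      have k2 : IntegrableOn (fun s => E (1 / 2) s - Complex.I * E (-1 / 2) s) (Ioi 0) :=
        j2.sub (j3.const_mul _)
      rw [integral_add (k1.const_mul _) k2, integral_const_mul, integral_sub j1 (j2.const_mul _),
        integral_sub j2 (j3.const_mul _), integral_const_mul, integral_const_mul]
      rfl
    rw [e1] at key
    simp only [Real.sqrt_zero, zero_mul, Complex.ofReal_zero, sub_zero] at key
    linear_combination -key
  · intro s hs
    have hs0 : (0 : ℝ) < s := hs
    have hsq : (√s : ℂ) ^ 2 = s := by exact_mod_cast Real.sq_sqrt hs0.le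
    have hne : (√s : ℂ) ≠ 0 := by exact_mod_cast (Real.sqrt_pos.2 hs0).ne'
    have h0 : HasDerivAt (fun s : ℝ => √s * Real.exp (-(t * s)))
        (1 / (2 * √s) * Real.exp (-(t * s)) + √s * (-t * Real.exp (-(t * s)))) s :=
      (Real.hasDerivAt_sqrt hs0.ne').mul (hasDerivAt_exp_neg_mul t s)
    refine (h0.ofReal_comp.mul (shiftedSqrt_hasDerivAt s)).congr_deriv ?_
    have p1 : s ^ (1 / 2 : ℝ) = √s := (Real.sqrt_eq_rpow s).symm
    have p2 : s ^ (3 / 2 : ℝ) = s * √s := by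
      rw [show (3 / 2 : ℝ) = 1 + 1 / 2 by norm_num, Real.rpow_add hs0, p1, Real.rpow_one]
    have p3 : s ^ (-1 / 2 : ℝ) = (√s)⁻¹ := by
      rw [show (-1 / 2 : ℝ) = -(1 / 2) by norm_num, Real.rpow_neg hs0.le, p1]
    have hw := shiftedSqrt_sq s
    have hwne := shiftedSqrt_ne_zero s
    simp only [hE, p1, p2, p3]
    push_cast
    rw [← hsq] at hw ⊢
    field_simp
    linear_combination (1 - 2 * t * (√s : ℂ) ^ 2) * hw
  · have h1 : Tendsto (fun s : ℝ => s ^ (1 / 2 : ℝ) * Real.exp (-t * s) + 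
        s ^ (3 / 2 : ℝ) * Real.exp (-t * s) + 2 * (s ^ (1 / 2 : ℝ) * Real.exp (-t * s)))
        atTop (𝓝 0) := by
      have a1 := tendsto_rpow_mul_exp_neg_mul_atTop_nhds_zero (1 / 2) t ht
      have a2 := tendsto_rpow_mul_exp_neg_mul_atTop_nhds_zero (3 / 2) t ht
      simpa using (a1.add a2).add (a1.const_mul 2)
    refine squeeze_zero_norm' ?_ h1
    filter_upwards [eventually_gt_atTop 0] with s hs
    have hn : ‖shiftedSqrt s‖ ≤ 1 + s + 2 := by
      have h2 : ‖shiftedSqrt s‖ ^ 2 ≤ s + 2 := by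
        rw [norm_shiftedSqrt_sq]
        exact Real.sqrt_le_iff.2 ⟨by linarith, by nlinarith⟩
      nlinarith [norm_nonneg (shiftedSqrt s)]
    have p2 : s ^ (3 / 2 : ℝ) = s * √s := by
      rw [show (3 / 2 : ℝ) = 1 + 1 / 2 by norm_num, Real.rpow_add hs, ← Real.sqrt_eq_rpow,
        Real.rpow_one]
    rw [norm_mul, Complex.norm_real, Real.norm_of_nonneg (by positivity), p2, ← Real.sqrt_eq_rpow]
    calc √s * Real.exp (-(t * s)) * ‖shiftedSqrt s‖ ≤ √s * Real.exp (-(t * s)) * (1 + s + 2) := by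
          gcongr
      _ = _ := by rw [neg_mul]; ring

/-! ### Laplace integrals of the logarithm, and Euler's constant. -/

theorem integral_log_mul_exp_neg :
    ∫ x in Ioi (0 : ℝ), Real.log x * Real.exp (-x) = -Real.eulerMascheroniConstant := by
  -- The integral is the derivative of Gamma at `1`, computed once under the integral sign and once
  -- as `-γ`.
  have h1 := Complex.hasDerivAt_GammaIntegral (s := 1) (by simp)
  have h2 : HasDerivAt Complex.GammaIntegral (-(Real.eulerMascheroniConstant : ℂ)) 1 := by
    refine Complex.hasDerivAt_Gamma_one.congr_of_eventuallyEq ?_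
    have : ∀ᶠ z : ℂ in 𝓝 1, 0 < z.re :=
      (Complex.continuous_re.tendsto 1).eventually (lt_mem_nhds (by simp))
    filter_upwards [this] with z hz
    exact (Complex.Gamma_eq_integral hz).symm
  have h3 := h1.unique h2
  have h4 : ∫ x in Ioi (0 : ℝ), ((Real.log x * Real.exp (-x) : ℝ) : ℂ)
      = -(Real.eulerMascheroniConstant : ℂ) := by
    rw [← h3]
    refine setIntegral_congr_fun measurableSet_Ioi fun x _ => ?_
    simp
  rw [integral_complex_ofReal] at h4
  exact_mod_cast h4

/-- A function that is not integrable has Bochner integral zero, whereas this integral is `-γ ≠ 0`.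
-/
theorem integrableOn_log_mul_exp_neg :
    IntegrableOn (fun x => Real.log x * Real.exp (-x)) (Ioi 0) := by
  refine Integrable.of_integral_ne_zero ?_
  rw [integral_log_mul_exp_neg]
  have := Real.one_half_lt_eulerMascheroniConstant
  linarith

theorem integral_exp_neg_mul_Ioi {t : ℝ} (ht : 0 < t) :
    ∫ s in Ioi (0 : ℝ), Real.exp (-(t * s)) = t⁻¹ := by
  have := Real.integral_rpow_mul_exp_neg_mul_Ioi (a := 1) one_pos ht
  simpa using this

theorem integrableOn_exp_neg_mul {t : ℝ} (ht : 0 < t) :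
    IntegrableOn (fun s : ℝ => Real.exp (-(t * s))) (Ioi 0) := by
  simpa using integrableOn_rpow_mul_exp (p := 0) (by norm_num) ht

theorem integrableOn_exp_mul_log {t : ℝ} (ht : 0 < t) :
    IntegrableOn (fun s : ℝ => Real.exp (-(t * s)) * Real.log s) (Ioi 0) := by
  have h1 : IntegrableOn (fun s : ℝ => Real.log (t * s) * Real.exp (-(t * s))) (Ioi 0) := by
    have := (integrableOn_Ioi_comp_mul_left_iff
      (fun x => Real.log x * Real.exp (-x)) 0 ht).2 (by simpa using integrableOn_log_mul_exp_neg)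
    exact this
  refine (h1.sub ((integrableOn_exp_neg_mul ht).const_mul (Real.log t))).congr_fun
    (fun s hs => ?_) measurableSet_Ioi
  simp only [Pi.sub_apply]
  rw [Real.log_mul ht.ne' (ne_of_gt hs)]
  ring

theorem integral_exp_mul_log {t : ℝ} (ht : 0 < t) :
    t * ∫ s in Ioi (0 : ℝ), Real.exp (-(t * s)) * Real.log s
      = -Real.eulerMascheroniConstant - Real.log t := by
  have h := integral_comp_mul_left_Ioi (fun x => Real.log x * Real.exp (-x)) 0 ht
  rw [mul_zero, integral_log_mul_exp_neg] at h
  have h2 : ∫ s in Ioi (0 : ℝ), Real.log (t * s) * Real.exp (-(t * s))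
      = (∫ s in Ioi (0 : ℝ), Real.exp (-(t * s)) * Real.log s) + Real.log t * t⁻¹ := by
    rw [← integral_exp_neg_mul_Ioi ht, ← integral_const_mul,
      ← integral_add (integrableOn_exp_mul_log ht) ((integrableOn_exp_neg_mul ht).const_mul _)]
    refine setIntegral_congr_fun measurableSet_Ioi fun s hs => ?_
    rw [Real.log_mul ht.ne' (ne_of_gt hs)]
    ring
  rw [h2] at h
  simp only [smul_eq_mul] at h
  field_simp at h
  linarith

/-- A primitive of `(s (s - 2i))^{-1/2}`. -/
noncomputable def hankelPrimitive (s : ℝ) : ℂ := 2 * Complex.log ((√s : ℝ) + shiftedSqrt s)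

theorem sqrt_add_re_pos (s : ℝ) : 0 < (((√s : ℝ) : ℂ) + shiftedSqrt s).re := by
  rw [Complex.add_re, Complex.ofReal_re]
  exact add_pos_of_nonneg_of_pos (Real.sqrt_nonneg s) (shiftedSqrt_re_pos s)

theorem sqrt_add_mem_slitPlane (s : ℝ) :
    ((√s : ℝ) : ℂ) + shiftedSqrt s ∈ Complex.slitPlane :=
  Complex.mem_slitPlane_iff.2 (Or.inl (sqrt_add_re_pos s))

theorem hankelPrimitive_hasDerivAt {s : ℝ} (hs : 0 < s) :
    HasDerivAt hankelPrimitive (((√s : ℝ) : ℂ) * shiftedSqrt s)⁻¹ s := by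
  have h0 : HasDerivAt (fun s : ℝ => ((√s : ℝ) : ℂ) + shiftedSqrt s)
      (((1 / (2 * √s) : ℝ) : ℂ) + (2 * shiftedSqrt s)⁻¹) s :=
    (Real.hasDerivAt_sqrt hs.ne').ofReal_comp.add (shiftedSqrt_hasDerivAt s)
  refine ((h0.clog_real (sqrt_add_mem_slitPlane s)).const_mul 2).congr_deriv ?_
  have h2 := shiftedSqrt_ne_zero s
  have h3 : ((√s : ℝ) : ℂ) ≠ 0 := by exact_mod_cast (Real.sqrt_pos.2 hs).ne'
  have h4 := Complex.slitPlane_ne_zero (sqrt_add_mem_slitPlane s)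
  push_cast
  field_simp
  ring

theorem continuous_hankelPrimitive : Continuous hankelPrimitive := by
  unfold hankelPrimitive
  refine continuous_const.mul (Continuous.clog (by fun_prop) sqrt_add_mem_slitPlane)

/-- At `s = 0` the primitive is `log(-2i)` on the principal branch. Its imaginary part `-π/2` is
what later yields the term `J_0(0) = 1` in the expansion of the Hankel function. -/
theorem hankelPrimitive_zero :
    hankelPrimitive 0 = Real.log 2 - Real.pi / 2 * Complex.I := by
  have h1 : Complex.log (((0 : ℝ) : ℂ) - 2 * Complex.I) = Real.log 2 - Real.pi / 2 * Complex.I := by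
    rw [show ((0 : ℝ) : ℂ) - 2 * Complex.I = ((2 : ℝ) : ℂ) * (-Complex.I) by push_cast; ring,
      Complex.log_ofReal_mul two_pos (by simp), Complex.log_neg_I]
    ring
  have h2 : (((Real.log 2 : ℂ) - Real.pi / 2 * Complex.I) / 2).im = -(Real.pi / 4) := by
    rw [show ((Real.log 2 : ℂ) - Real.pi / 2 * Complex.I) / 2
      = ((Real.log 2 / 2 : ℝ) : ℂ) + ((-(Real.pi / 4) : ℝ) : ℂ) * Complex.I by push_cast; ring,
      Complex.add_im, Complex.ofReal_im, Complex.im_ofReal_mul, Complex.I_im]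
    ring
  have hpi := Real.pi_pos
  rw [hankelPrimitive, Real.sqrt_zero, Complex.ofReal_zero, zero_add, shiftedSqrt, h1,
    Complex.log_exp (by rw [h2]; linarith) (by rw [h2]; linarith)]
  ring

theorem norm_log_le_of_half_le_re {z : ℂ} (hz : 1 / 2 ≤ z.re) : ‖Complex.log z‖ ≤ 2 * ‖z - 1‖ := by
  have h := Convex.norm_image_sub_le_of_norm_hasDerivWithin_le (𝕜 := ℂ) (f := Complex.log)
    (f' := fun z => z⁻¹) (s := {w : ℂ | 1 / 2 ≤ w.re}) (C := 2) (x := 1) (y := z)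
    (fun w hw => (Complex.hasDerivAt_log (Complex.mem_slitPlane_iff.2 (Or.inl
      ((by norm_num : (0 : ℝ) < 1 / 2).trans_le hw)))).hasDerivWithinAt)
    (fun w hw => by
      rw [norm_inv]
      have h1 : 1 / 2 ≤ ‖w‖ := (le_trans hw (le_abs_self _)).trans (Complex.abs_re_le_norm w)
      calc ‖w‖⁻¹ ≤ (1 / 2)⁻¹ := inv_anti₀ (by norm_num) h1
        _ = 2 := by norm_num)
    (convex_halfSpace_re_ge _) (by simp; norm_num) hz
  simpa using h

/-- For large `s` the sum `√s + √(s-2i)` is close to `2√s`. The quotient `z` of the two satisfies `z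
- 1 = -i / (√s (√s + √(s-2i)))`, and the logarithm is Lipschitz with constant `2` on `Re z ≥ 1/2`.
The bound holds down to `s = 0`, where it is still integrable. -/
theorem norm_hankelPrimitive_sub_le {s : ℝ} (hs : 0 < s) :
    ‖hankelPrimitive s - (Real.log s + 2 * Real.log 2)‖ ≤ 4 * s ^ (-1 / 2 : ℝ) := by
  set q : ℝ := √s with hq
  have hq0 : 0 < q := Real.sqrt_pos.2 hs
  have hqc : (q : ℂ) ≠ 0 := by exact_mod_cast hq0.ne'
  set w := shiftedSqrt s with hw
  have hne := Complex.slitPlane_ne_zero (sqrt_add_mem_slitPlane s)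
  have hsq : (q : ℂ) ^ 2 = s := by exact_mod_cast Real.sq_sqrt hs.le
  set z : ℂ := (q + w) / (2 * q) with hz
  have e1 : (q : ℂ) + w = ((2 * q : ℝ) : ℂ) * z := by rw [hz]; push_cast; field_simp
  have hz0 : z ≠ 0 := fun h => hne (by rw [← hq, ← hw, e1, h, mul_zero])
  have hlog : hankelPrimitive s - (Real.log s + 2 * Real.log 2) = 2 * Complex.log z := by
    rw [hankelPrimitive, ← hq, ← hw, e1, Complex.log_ofReal_mul (by positivity) hz0,
      Real.log_mul two_ne_zero hq0.ne', hq, Real.log_sqrt hs.le]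
    push_cast; ring
  have hre : 1 / 2 ≤ z.re := by
    have : z = ((1 / (2 * q) : ℝ) : ℂ) * (q + w) := by rw [hz]; push_cast; field_simp
    rw [this, Complex.re_ofReal_mul, Complex.add_re, Complex.ofReal_re]
    have h1 := shiftedSqrt_re_pos s
    rw [← hw] at h1
    have h2 : 1 / (2 * q) * q = 1 / 2 := by field_simp
    have h3 : 0 < 1 / (2 * q) * w.re := by positivity
    rw [mul_add, h2]
    linarith
  have hz1 : z - 1 = -Complex.I / (q * (q + w)) := by
    have h2 := shiftedSqrt_sq s
    rw [← hw, ← hsq] at h2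
    rw [hz, div_sub_one (by simpa using hqc), div_eq_div_iff (by simpa using hqc)
      (mul_ne_zero hqc hne)]
    linear_combination q * h2
  have hnorm : 1 ≤ ‖(q : ℂ) + w‖ := by
    have h1 : ‖w‖ ^ 2 ≤ ‖(q : ℂ) + w‖ ^ 2 := by
      rw [Complex.sq_norm, Complex.sq_norm, Complex.normSq_apply, Complex.normSq_apply]
      simp only [Complex.add_re, Complex.add_im, Complex.ofReal_re, Complex.ofReal_im, zero_add]
      have := shiftedSqrt_re_pos s
      rw [← hw] at this
      nlinarith
    have h2 := two_le_norm_shiftedSqrt_sq s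
    rw [← hw] at h2
    nlinarith [norm_nonneg ((q : ℂ) + w)]
  have hp : s ^ (-1 / 2 : ℝ) = q⁻¹ := by
    rw [show (-1 / 2 : ℝ) = -(1 / 2) by norm_num, Real.rpow_neg hs.le, hq, Real.sqrt_eq_rpow]
  rw [hlog, norm_mul, hp]
  have h3 : ‖z - 1‖ ≤ q⁻¹ := by
    rw [hz1, norm_div, norm_neg, Complex.norm_I, norm_mul, Complex.norm_real,
      Real.norm_of_nonneg hq0.le, one_div]
    refine inv_anti₀ hq0 ?_
    nlinarith
  have h4 := norm_log_le_of_half_le_re hre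
  simp only [Complex.norm_ofNat]
  linarith

theorem integrableOn_exp_mul_hankelPrimitive {t : ℝ} (ht : 0 < t) :
    IntegrableOn (fun s : ℝ => ((Real.exp (-(t * s)) : ℝ) : ℂ)
      * (hankelPrimitive s - (Real.log s + 2 * Real.log 2))) (Ioi 0) := by
  refine ((integrableOn_rpow_mul_exp (p := -1 / 2) (by norm_num) ht).const_mul 4).mono' ?_ ?_
  · refine ContinuousOn.aestronglyMeasurable (fun s hs => ?_) measurableSet_Ioi
    have h1 : ContinuousAt (fun s : ℝ => ((Real.log s : ℝ) : ℂ)) s :=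
      Complex.continuous_ofReal.continuousAt.comp (Real.continuousAt_log (ne_of_gt hs))
    have h2 := continuous_hankelPrimitive.continuousAt (x := s)
    exact (ContinuousAt.mul (by fun_prop) (h2.sub (h1.add continuousAt_const))).continuousWithinAt
  · refine (ae_restrict_iff' measurableSet_Ioi).2 (Eventually.of_forall fun s hs => ?_)
    rw [norm_mul, Complex.norm_real, Real.norm_of_nonneg (Real.exp_pos _).le]
    have := norm_hankelPrimitive_sub_le hs
    have h0 := Real.exp_pos (-(t * s))
    nlinarith

/-- Integrate by parts against the primitive, then replace the primitive by its asymptotic form `log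
s + 2 log 2`, whose Laplace transform is explicit. The logarithm of `t` and Euler's constant come
from there; the last integral is an error term. -/
theorem hankelMoment_eq_primitive {t : ℝ} (ht : 0 < t) :
    hankelMoment (-1 / 2) t + Real.log t
      = -hankelPrimitive 0 - Real.eulerMascheroniConstant + 2 * Real.log 2
        + t * ∫ s in Ioi (0 : ℝ), ((Real.exp (-(t * s)) : ℝ) : ℂ)
          * (hankelPrimitive s - (Real.log s + 2 * Real.log 2)) := by
  have i1 := integrableOn_exp_mul_hankelPrimitive ht
  have i2 : IntegrableOn (fun s : ℝ => ((Real.exp (-(t * s)) * Real.log s : ℝ) : ℂ)) (Ioi 0) :=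
    (integrableOn_exp_mul_log ht).ofReal
  have i3 : IntegrableOn (fun s : ℝ => ((Real.exp (-(t * s)) : ℝ) : ℂ) * (2 * Real.log 2))
    (Ioi 0) := (integrableOn_exp_neg_mul ht).ofReal.mul_const _
  have i4 : IntegrableOn (fun s : ℝ => ((Real.exp (-(t * s)) : ℝ) : ℂ) * hankelPrimitive s)
      (Ioi 0) := by
    refine ((i1.add i2).add i3).congr_fun (fun s _ => ?_) measurableSet_Ioi
    simp only [Pi.add_apply]
    push_cast
    ring
  have i5 := integrableOn_hankelIntegrand (p := -1 / 2) (by norm_num) ht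
  have hint : IntegrableOn (fun s : ℝ => -(t : ℂ) *
      (((Real.exp (-(t * s)) : ℝ) : ℂ) * hankelPrimitive s)
      + ((s ^ (-1 / 2 : ℝ) * Real.exp (-(t * s)) : ℝ) : ℂ) * (shiftedSqrt s)⁻¹) (Ioi 0) :=
    (i4.const_mul _).add i5
  have key := integral_Ioi_of_hasDerivAt_of_tendsto
    (f := fun s : ℝ => ((Real.exp (-(t * s)) : ℝ) : ℂ) * hankelPrimitive s)
    (m := 0) (a := 0) (Continuous.continuousWithinAt ?_) ?_ hint ?_
  · rw [integral_add (i4.const_mul _) i5, integral_const_mul] at key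
    have e4 : ∫ s in Ioi (0 : ℝ), ((Real.exp (-(t * s)) : ℝ) : ℂ) * hankelPrimitive s
        = (∫ s in Ioi (0 : ℝ), ((Real.exp (-(t * s)) : ℝ) : ℂ)
          * (hankelPrimitive s - (Real.log s + 2 * Real.log 2)))
          + ((∫ s in Ioi (0 : ℝ), Real.exp (-(t * s)) * Real.log s : ℝ) : ℂ)
          + (t⁻¹ : ℝ) * (2 * Real.log 2) := by
      rw [← integral_exp_neg_mul_Ioi ht, ← integral_complex_ofReal, ← integral_complex_ofReal,
        ← integral_mul_const, ← integral_add i1 i2]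
      refine Eq.trans ?_ (integral_add (i1.add i2) i3)
      refine setIntegral_congr_fun measurableSet_Ioi fun s _ => ?_
      push_cast
      ring
    have e5 := congrArg (Complex.ofReal) (integral_exp_mul_log ht)
    rw [e4] at key
    have e6 : (t : ℂ) * ((t⁻¹ : ℝ) : ℂ) = 1 := by
      push_cast; exact mul_inv_cancel₀ (by exact_mod_cast ht.ne')
    push_cast at e5 e6 key
    simp only [mul_zero, neg_zero, Complex.exp_zero, one_mul, zero_sub] at key
    have e7 : hankelMoment (-1 / 2) t = ∫ (x : ℝ) in Ioi 0, (((x ^ (-1 / 2 : ℝ) : ℝ) : ℂ)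
      * Complex.exp (-(t * x))) * (shiftedSqrt x)⁻¹ := by
      rw [hankelMoment]
      push_cast
      rfl
    rw [← e7] at key
    push_cast
    linear_combination key + e5 + 2 * (Real.log 2 : ℂ) * e6
  · have := continuous_hankelPrimitive
    fun_prop
  · intro s hs
    have hs0 : (0 : ℝ) < s := hs
    refine (((hasDerivAt_exp_neg_mul t s).ofReal_comp).mul
      (hankelPrimitive_hasDerivAt hs0)).congr_deriv ?_
    rw [show (-1 / 2 : ℝ) = -(1 / 2) by norm_num, Real.rpow_neg hs0.le, ← Real.sqrt_eq_rpow]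
    push_cast
    rw [mul_inv]
    ring
  · have a0 := tendsto_rpow_mul_exp_neg_mul_atTop_nhds_zero (-1 / 2) t ht
    have a1 := tendsto_rpow_mul_exp_neg_mul_atTop_nhds_zero 1 t ht
    have a2 := tendsto_rpow_mul_exp_neg_mul_atTop_nhds_zero 0 t ht
    have h1 : Tendsto (fun s : ℝ => 4 * (s ^ (-1 / 2 : ℝ) * Real.exp (-t * s))
        + s ^ (1 : ℝ) * Real.exp (-t * s) + (2 * Real.log 2) * (s ^ (0 : ℝ) * Real.exp (-t * s)))
        atTop (𝓝 0) := by
      simpa using ((a0.const_mul 4).add a1).add (a2.const_mul (2 * Real.log 2))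
    refine squeeze_zero_norm' ?_ h1
    filter_upwards [eventually_gt_atTop 1] with s hs
    have hs0 : 0 < s := by linarith
    have b1 := norm_hankelPrimitive_sub_le hs0
    have b2 : ‖((Real.log s : ℂ) + 2 * Real.log 2)‖ ≤ s + 2 * Real.log 2 := by
      have e : ((Real.log s : ℂ) + 2 * Real.log 2) = ((Real.log s + 2 * Real.log 2 : ℝ) : ℂ) := by
        push_cast; ring
      have l1 := Real.log_nonneg hs.le
      have l2 := Real.log_nonneg one_le_two
      have l3 := Real.log_le_sub_one_of_pos hs0
      rw [e, Complex.norm_real, Real.norm_of_nonneg (by positivity)]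
      linarith
    have b3 : ‖hankelPrimitive s‖ ≤ 4 * s ^ (-1 / 2 : ℝ) + (s + 2 * Real.log 2) := by
      calc ‖hankelPrimitive s‖ = ‖(hankelPrimitive s - (Real.log s + 2 * Real.log 2))
            + (Real.log s + 2 * Real.log 2)‖ := by rw [sub_add_cancel]
        _ ≤ _ := (norm_add_le _ _).trans (add_le_add b1 b2)
    rw [norm_mul, Complex.norm_real, Real.norm_of_nonneg (Real.exp_pos _).le, Real.rpow_one,
      Real.rpow_zero, neg_mul]
    calc Real.exp (-(t * s)) * ‖hankelPrimitive s‖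
        ≤ Real.exp (-(t * s)) * (4 * s ^ (-1 / 2 : ℝ) + (s + 2 * Real.log 2)) := by gcongr
      _ = _ := by ring

theorem tendsto_rpow_nhdsGT_zero {p : ℝ} (hp : 0 < p) :
    Tendsto (fun t : ℝ => t ^ p) (𝓝[>] 0) (𝓝 0) := by
  have h := (Real.continuousAt_rpow_const 0 p (Or.inr hp.le)).tendsto
  rw [Real.zero_rpow hp.ne'] at h
  exact h.mono_left nhdsWithin_le_nhds

/-- The error term of `hankelMoment_eq_primitive` is at most `4 Γ(1/2) t^(1/2)`, so only the
constants survive. -/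
theorem tendsto_hankelMoment_add_log :
    Tendsto (fun t : ℝ => hankelMoment (-1 / 2) t + Real.log t) (𝓝[>] 0)
      (𝓝 (Real.log 2 - Real.eulerMascheroniConstant + Real.pi / 2 * Complex.I)) := by
  have h1 : Tendsto (fun t : ℝ => (t : ℂ) * ∫ s in Ioi (0 : ℝ), ((Real.exp (-(t * s)) : ℝ) : ℂ)
          * (hankelPrimitive s - (Real.log s + 2 * Real.log 2))) (𝓝[>] 0) (𝓝 0) := by
    have h2 : Tendsto (fun t : ℝ => 4 * Real.Gamma (1 / 2) * t ^ (1 / 2 : ℝ)) (𝓝[>] 0) (𝓝 0) := by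
      simpa using (tendsto_rpow_nhdsGT_zero (p := 1 / 2) (by norm_num)).const_mul
        (4 * Real.Gamma (1 / 2))
    refine squeeze_zero_norm' ?_ h2
    filter_upwards [self_mem_nhdsWithin] with t ht
    have ht0 : (0 : ℝ) < t := ht
    have h3 : ‖∫ s in Ioi (0 : ℝ), ((Real.exp (-(t * s)) : ℝ) : ℂ)
          * (hankelPrimitive s - (Real.log s + 2 * Real.log 2))‖
        ≤ ∫ s in Ioi (0 : ℝ), 4 * (s ^ (-1 / 2 : ℝ) * Real.exp (-(t * s))) := by
      refine norm_integral_le_of_norm_le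
        ((integrableOn_rpow_mul_exp (p := -1 / 2) (by norm_num) ht).const_mul 4) ?_
      refine (ae_restrict_iff' measurableSet_Ioi).2 (Eventually.of_forall fun s hs => ?_)
      rw [norm_mul, Complex.norm_real, Real.norm_of_nonneg (Real.exp_pos _).le]
      have := norm_hankelPrimitive_sub_le hs
      have h0 := Real.exp_pos (-(t * s))
      nlinarith
    have h4 := Real.integral_rpow_mul_exp_neg_mul_Ioi (a := 1 / 2) (by norm_num) ht0
    norm_num at h4
    rw [integral_const_mul, show (-1 / 2 : ℝ) = -(1 / 2) by norm_num, h4] at h3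
    rw [norm_mul, Complex.norm_real, Real.norm_of_nonneg ht0.le]
    have h5 : t * (t⁻¹ ^ (1 / 2 : ℝ)) = t ^ (1 / 2 : ℝ) := by
      rw [Real.inv_rpow ht0.le, ← Real.rpow_neg ht0.le]
      nth_rewrite 1 [← Real.rpow_one t]
      rw [← Real.rpow_add ht0]
      norm_num
    rw [← h5]
    refine (mul_le_mul_of_nonneg_left h3 ht0.le).trans_eq ?_
    ring
  have h2 := h1.const_add (-hankelPrimitive 0 - Real.eulerMascheroniConstant + 2 * Real.log 2)
  have e : -hankelPrimitive 0 - Real.eulerMascheroniConstant + 2 * Real.log 2 + 0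
      = Real.log 2 - Real.eulerMascheroniConstant + Real.pi / 2 * Complex.I := by
    rw [hankelPrimitive_zero]; ring
  rw [e] at h2
  refine h2.congr' ?_
  filter_upwards [self_mem_nhdsWithin] with t ht
  exact (hankelMoment_eq_primitive ht).symm

/-! ### Derivatives and the behaviour at the origin -/

theorem half_sq_hasDerivAt (t : ℝ) : HasDerivAt (fun t : ℝ => (t / 2) ^ 2) (t / 2) t :=
  (((hasDerivAt_id t).div_const 2).pow 2).congr_deriv (by simp; ring)

theorem besselJ_zero_hasDerivAt (t : ℝ) : HasDerivAt (besselJ 0) (-besselJ 1 t) t := by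
  have h := (besselProfile_hasDerivAt ((t / 2) ^ 2)).comp t (half_sq_hasDerivAt t)
  have e : besselJ 0 = besselProfile ∘ fun t => (t / 2) ^ 2 := funext besselJ_zero_eq
  rw [e]
  refine h.congr_deriv ?_
  rw [besselJ_one_eq]; ring

theorem neumannN_zero_hasDerivAt {t : ℝ} (ht : 0 < t) :
    HasDerivAt (neumannN 0) (-neumannN 1 t) t := by
  have hs : 0 < (t / 2) ^ 2 := by positivity
  have h := (neumannProfile_hasDerivAt hs).differentiableAt.hasDerivAt.comp t (half_sq_hasDerivAt t)
  have e : neumannN 0 = neumannProfile ∘ fun t => (t / 2) ^ 2 := funext neumannN_zero_eq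
  rw [e]
  refine h.congr_deriv ?_
  rw [neumannN_one_eq ht]; ring

theorem mul_besselJ_one_hasDerivAt (t : ℝ) :
    HasDerivAt (fun t => t * besselJ 1 t) (t * besselJ 0 t) t := by
  have h1 := (deriv_besselProfile_hasDerivAt ((t / 2) ^ 2)).comp t (half_sq_hasDerivAt t)
  have h2 := ((half_sq_hasDerivAt t).mul h1).const_mul (-2)
  have e : (fun t => t * besselJ 1 t)
      = fun t => -2 * ((t / 2) ^ 2 * (deriv besselProfile ∘ fun t => (t / 2) ^ 2) t) := by
    funext t; rw [besselJ_one_eq, Function.comp]; ring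
  rw [e]
  refine h2.congr_deriv ?_
  have := besselProfile_ode ((t / 2) ^ 2)
  rw [besselJ_zero_eq, Function.comp]
  linear_combination t * (-this)

theorem mul_neumannN_one_hasDerivAt {t : ℝ} (ht : 0 < t) :
    HasDerivAt (fun t => t * neumannN 1 t) (t * neumannN 0 t) t := by
  have hs : 0 < (t / 2) ^ 2 := by positivity
  have h1 := (deriv_neumannProfile_hasDerivAt hs).differentiableAt.hasDerivAt.comp t
    (half_sq_hasDerivAt t)
  have h2 := ((half_sq_hasDerivAt t).mul h1).const_mul (-2)
  refine (h2.congr_deriv ?_).congr_of_eventuallyEq ?_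
  · have := neumannProfile_ode hs
    rw [neumannN_zero_eq, Function.comp]
    linear_combination t * (-this)
  · filter_upwards [lt_mem_nhds ht] with x hx
    simp only [Pi.mul_apply, Function.comp]
    rw [neumannN_one_eq hx]; ring

theorem continuous_besselJ_zero : Continuous (besselJ 0) :=
  continuous_iff_continuousAt.2 fun t => (besselJ_zero_hasDerivAt t).continuousAt

theorem continuous_besselJ_one : Continuous (besselJ 1) := by
  have e : besselJ 1 = fun t => -(t / 2) * deriv besselProfile ((t / 2) ^ 2) :=
    funext besselJ_one_eq
  rw [e]
  have : Continuous (deriv besselProfile) :=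
    continuous_iff_continuousAt.2 fun t => (deriv_besselProfile_hasDerivAt t).continuousAt
  fun_prop

theorem besselJ_zero_zero : besselJ 0 0 = 1 := by
  rw [besselJ_zero_eq]; simp [besselProfile_zero]

theorem tendsto_half_sq : Tendsto (fun t : ℝ => (t / 2) ^ 2) (𝓝[>] 0) (𝓝[>] 0) := by
  refine tendsto_nhdsWithin_iff.2 ⟨?_, ?_⟩
  · have : Tendsto (fun t : ℝ => (t / 2) ^ 2) (𝓝 0) (𝓝 ((0 / 2) ^ 2)) :=
      Continuous.tendsto (by fun_prop) 0
    simpa using this.mono_left nhdsWithin_le_nhds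
  · filter_upwards [self_mem_nhdsWithin] with t ht
    have : (0 : ℝ) < t := ht
    exact mem_Ioi.2 (by positivity)

theorem tendsto_log_mul_self : Tendsto (fun s : ℝ => Real.log s * s) (𝓝[>] 0) (𝓝 0) := by
  simpa using tendsto_log_mul_rpow_nhdsGT_zero one_pos

theorem digammaSucc_zero : digammaSucc 0 = -Real.eulerMascheroniConstant := by
  simp [digammaSucc]

theorem tendsto_neumannN_zero_sub_log :
    Tendsto (fun t => neumannN 0 t - 2 / Real.pi * Real.log t) (𝓝[>] 0)
      (𝓝 (2 / Real.pi * (Real.eulerMascheroniConstant - Real.log 2))) := by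
  have h1 : Tendsto (fun s : ℝ => Real.log s * (besselProfile s - 1)) (𝓝[>] 0) (𝓝 0) := by
    have h2 := (besselProfile_hasDerivAt 0).tendsto_slope.mono_left
      (nhdsWithin_mono 0 (fun x (hx : 0 < x) => ne_of_gt hx) : 𝓝[>] (0 : ℝ) ≤ 𝓝[≠] 0)
    have h3 := tendsto_log_mul_self.mul h2
    rw [zero_mul] at h3
    refine h3.congr' ?_
    filter_upwards [self_mem_nhdsWithin] with s hs
    have hs0 : s ≠ 0 := ne_of_gt hs
    rw [slope_def_field, besselProfile_zero, sub_zero]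
    field_simp
  have h4 : Tendsto (powerSum neumannCoeff) (𝓝[>] 0) (𝓝 (-Real.eulerMascheroniConstant)) := by
    have := (neumannCoeff_expBounded.contDiff.continuous.tendsto 0).mono_left
      (nhdsWithin_le_nhds (s := Ioi 0))
    rw [powerSum_zero] at this
    simpa [neumannCoeff, besselCoeff, digammaSucc_zero] using this
  have h5 := (((h1.sub (h4.const_mul 2)).comp tendsto_half_sq).const_mul (1 / Real.pi)).sub_const
    (2 / Real.pi * Real.log 2)
  have e : 1 / Real.pi * (0 - 2 * -Real.eulerMascheroniConstant) - 2 / Real.pi * Real.log 2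
      = 2 / Real.pi * (Real.eulerMascheroniConstant - Real.log 2) := by ring
  rw [e] at h5
  refine h5.congr' ?_
  filter_upwards [self_mem_nhdsWithin] with t ht
  rw [neumannN_zero_eq, neumannProfile, Function.comp, Real.log_pow,
    Real.log_div (ne_of_gt ht) two_ne_zero]
  push_cast
  ring

theorem tendsto_mul_neumannN_one :
    Tendsto (fun t => t * neumannN 1 t) (𝓝[>] 0) (𝓝 (-(2 / Real.pi))) := by
  have c1 : Continuous (deriv besselProfile) :=
    continuous_iff_continuousAt.2 fun t => (deriv_besselProfile_hasDerivAt t).continuousAt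
  have c2 : Continuous (deriv (powerSum neumannCoeff)) := by
    rw [neumannCoeff_expBounded.deriv]
    exact neumannCoeff_expBounded.shift.contDiff.continuous
  have l0 := (besselProfile_contDiff.continuous.tendsto 0).mono_left
    (nhdsWithin_le_nhds (s := Ioi (0 : ℝ)))
  have l1 := (c1.tendsto 0).mono_left (nhdsWithin_le_nhds (s := Ioi (0 : ℝ)))
  have l2 := (c2.tendsto 0).mono_left (nhdsWithin_le_nhds (s := Ioi (0 : ℝ)))
  have l3 : Tendsto (fun s : ℝ => s) (𝓝[>] 0) (𝓝 0) := nhdsWithin_le_nhds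
  have h := ((((l0.add (tendsto_log_mul_self.mul l1)).sub ((l3.mul l2).const_mul 2)).const_mul
    (-(2 / Real.pi))).comp tendsto_half_sq)
  rw [besselProfile_zero] at h
  have e : -(2 / Real.pi) * (1 + 0 * deriv besselProfile 0
      - 2 * (0 * deriv (powerSum neumannCoeff) 0)) = -(2 / Real.pi) := by ring
  rw [e] at h
  refine h.congr' ?_
  filter_upwards [self_mem_nhdsWithin] with t ht
  have ht0 : (0 : ℝ) < t := ht
  have hs : 0 < (t / 2) ^ 2 := by positivity
  rw [neumannN_one_eq ht0, deriv_neumannProfile hs, Function.comp]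
  field_simp

theorem neumannN_zero_continuousAt {t : ℝ} (ht : 0 < t) : ContinuousAt (neumannN 0) t :=
  (neumannN_zero_hasDerivAt ht).continuousAt

theorem neumannN_one_hasDerivAt {t : ℝ} (ht : 0 < t) :
    HasDerivAt (neumannN 1) (neumannN 0 t - neumannN 1 t / t) t := by
  have h := (mul_neumannN_one_hasDerivAt ht).div (hasDerivAt_id t) ht.ne'
  refine (h.congr_deriv ?_).congr_of_eventuallyEq ?_
  · simp only [id]
    field_simp
  · filter_upwards [lt_mem_nhds ht] with x hx
    simp only [Pi.div_apply, id]
    field_simp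

theorem neumannN_one_continuousAt {t : ℝ} (ht : 0 < t) : ContinuousAt (neumannN 1) t :=
  (neumannN_one_hasDerivAt ht).continuousAt

theorem besselJ_one_hasDerivAt {t : ℝ} (ht : 0 < t) :
    HasDerivAt (besselJ 1) (besselJ 0 t - besselJ 1 t / t) t := by
  have h := (mul_besselJ_one_hasDerivAt t).div (hasDerivAt_id t) ht.ne'
  refine (h.congr_deriv ?_).congr_of_eventuallyEq ?_
  · simp only [id]
    field_simp
  · filter_upwards [lt_mem_nhds ht] with x hx
    simp only [Pi.div_apply, id]
    field_simp

/-! ### The Hankel function -/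

/-- The Hankel function `H_n = J_n + i N_n` of the first kind. -/
noncomputable def hankel (n : ℕ) (t : ℝ) : ℂ := besselJ n t + neumannN n t * Complex.I

theorem hankel_zero_hasDerivAt {t : ℝ} (ht : 0 < t) :
    HasDerivAt (hankel 0) (-hankel 1 t) t :=
  ((besselJ_zero_hasDerivAt t).ofReal_comp.add
    ((neumannN_zero_hasDerivAt ht).ofReal_comp.mul_const Complex.I)).congr_deriv
    (by rw [hankel]; push_cast; ring)

theorem hankel_one_hasDerivAt {t : ℝ} (ht : 0 < t) :
    HasDerivAt (hankel 1) (hankel 0 t - hankel 1 t / t) t :=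
  ((besselJ_one_hasDerivAt ht).ofReal_comp.add
    ((neumannN_one_hasDerivAt ht).ofReal_comp.mul_const Complex.I)).congr_deriv
    (by rw [hankel, hankel]; push_cast; ring)

theorem mul_hankel_one_hasDerivAt {t : ℝ} (ht : 0 < t) :
    HasDerivAt (fun t : ℝ => (t : ℂ) * hankel 1 t) (t * hankel 0 t) t :=
  ((Complex.ofRealCLM.hasDerivAt (x := t)).mul (hankel_one_hasDerivAt ht)).congr_deriv (by
    have : (t : ℂ) ≠ 0 := by exact_mod_cast ht.ne'
    simp
    field_simp
    ring)

/-- The Laplace integral representing the Hankel function. -/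
noncomputable def hankelIntegral (t : ℝ) : ℂ :=
  2 / (Real.pi * Complex.I) * (Complex.exp (t * Complex.I) * hankelMoment (-1 / 2) t)

/-- The derivative of `hankelIntegral`. -/
noncomputable def hankelIntegralDeriv (t : ℝ) : ℂ :=
  2 / (Real.pi * Complex.I) * (Complex.exp (t * Complex.I)
    * (Complex.I * hankelMoment (-1 / 2) t - hankelMoment (1 / 2) t))

theorem exp_mul_I_hasDerivAt (t : ℝ) : HasDerivAt (fun t : ℝ => Complex.exp (t * Complex.I))
    (Complex.I * Complex.exp (t * Complex.I)) t := by
  have h := ((Complex.ofRealCLM.hasDerivAt (x := t)).mul_const Complex.I).cexp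
  exact h.congr_deriv (by simp; ring)

theorem hankelIntegral_hasDerivAt {t : ℝ} (ht : 0 < t) :
    HasDerivAt hankelIntegral (hankelIntegralDeriv t) t := by
  have h := ((exp_mul_I_hasDerivAt t).mul (hankelMoment_hasDerivAt (p := -1 / 2)
    (by norm_num) ht)).const_mul (2 / (Real.pi * Complex.I))
  refine h.congr_deriv ?_
  rw [hankelIntegralDeriv, show (-1 / 2 + 1 : ℝ) = 1 / 2 by norm_num]
  ring

/-- This is the Bessel equation `(t y')' = -t y` for the Laplace integral; it rests on
`hankelMoment_parts`. -/
theorem mul_hankelIntegralDeriv_hasDerivAt {t : ℝ} (ht : 0 < t) :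
    HasDerivAt (fun t : ℝ => (t : ℂ) * hankelIntegralDeriv t) (-t * hankelIntegral t) t := by
  have h0 := hankelMoment_hasDerivAt (p := -1 / 2) (by norm_num) ht
  have h1 := hankelMoment_hasDerivAt (p := 1 / 2) (by norm_num) ht
  have h := (Complex.ofRealCLM.hasDerivAt (x := t)).mul (((exp_mul_I_hasDerivAt t).mul
    ((h0.const_mul Complex.I).sub h1)).const_mul (2 / (Real.pi * Complex.I)))
  refine h.congr_deriv ?_
  have hp := hankelMoment_parts ht
  rw [show (-1 / 2 + 1 : ℝ) = 1 / 2 by norm_num, show (1 / 2 + 1 : ℝ) = 3 / 2 by norm_num,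
    hankelIntegral]
  simp only [Complex.ofRealCLM_apply, Complex.ofReal_one, Pi.mul_apply, Pi.sub_apply]
  linear_combination (2 / (Real.pi * Complex.I)) * Complex.exp (t * Complex.I) * hp
    + (2 / (Real.pi * Complex.I)) * Complex.exp (t * Complex.I) * t *
      hankelMoment (-1 / 2) t * Complex.I_sq

theorem tendsto_mul_hankelMoment_neg_half :
    Tendsto (fun t : ℝ => (t : ℂ) * hankelMoment (-1 / 2) t) (𝓝[>] 0) (𝓝 0) := by
  have h2 : Tendsto (fun t : ℝ => Real.Gamma (1 / 2) * t ^ (1 / 2 : ℝ)) (𝓝[>] 0) (𝓝 0) := by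
    simpa using (tendsto_rpow_nhdsGT_zero (p := 1 / 2) (by norm_num)).const_mul
      (Real.Gamma (1 / 2))
  refine squeeze_zero_norm' ?_ h2
  filter_upwards [self_mem_nhdsWithin] with t ht
  have ht0 : (0 : ℝ) < t := ht
  have h3 := norm_hankelMoment_le (p := -1 / 2) (by norm_num) ht0
  rw [norm_mul, Complex.norm_real, Real.norm_of_nonneg ht0.le]
  norm_num at h3 ⊢
  have h5 : t * (t⁻¹ ^ (1 / 2 : ℝ)) = t ^ (1 / 2 : ℝ) := by
    rw [Real.inv_rpow ht0.le, ← Real.rpow_neg ht0.le]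
    nth_rewrite 1 [← Real.rpow_one t]
    rw [← Real.rpow_add ht0]
    norm_num
  rw [← h5]
  refine (mul_le_mul_of_nonneg_left h3 ht0.le).trans_eq ?_
  ring

theorem norm_sqrt_div_shiftedSqrt_sub_one_le {s : ℝ} (hs : 0 < s) :
    ‖((√s : ℝ) : ℂ) * (shiftedSqrt s)⁻¹ - 1‖ ≤ 2 * s ^ (-1 / 2 : ℝ) := by
  set q : ℝ := √s with hq
  have hq0 : 0 < q := Real.sqrt_pos.2 hs
  set w := shiftedSqrt s with hw
  have hwne : w ≠ 0 := shiftedSqrt_ne_zero s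
  have hne := Complex.slitPlane_ne_zero (sqrt_add_mem_slitPlane s)
  rw [← hq, ← hw] at hne
  have hsq : (q : ℂ) ^ 2 = s := by exact_mod_cast Real.sq_sqrt hs.le
  have e1 : (q : ℂ) * w⁻¹ - 1 = 2 * Complex.I / (w * (q + w)) := by
    have h2 := shiftedSqrt_sq s
    rw [← hw, ← hsq] at h2
    field_simp
    linear_combination -h2
  have hp : s ^ (-1 / 2 : ℝ) = q⁻¹ := by
    rw [show (-1 / 2 : ℝ) = -(1 / 2) by norm_num, Real.rpow_neg hs.le, hq, Real.sqrt_eq_rpow]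
  have h1 : 1 ≤ ‖w‖ := one_le_norm_shiftedSqrt s
  have h2 : q ≤ ‖(q : ℂ) + w‖ := by
    refine le_trans ?_ (Complex.abs_re_le_norm _)
    have := shiftedSqrt_re_pos s
    rw [Complex.add_re, Complex.ofReal_re, abs_of_pos (by rw [hw]; positivity)]
    rw [hw]; linarith
  rw [e1, hp, norm_div, norm_mul, norm_mul, Complex.norm_I, Complex.norm_ofNat, mul_one,
    div_eq_mul_inv]
  refine mul_le_mul_of_nonneg_left (inv_anti₀ hq0 ?_) zero_le_two
  nlinarith

/-- For large `s` the weight `√s (s-2i)^(-1/2)` tends to `1`, so for small `t` the moment behaves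
like `∫ exp(-ts) ds = 1/t`. -/
theorem tendsto_mul_hankelMoment_half :
    Tendsto (fun t : ℝ => (t : ℂ) * hankelMoment (1 / 2) t) (𝓝[>] 0) (𝓝 1) := by
  rw [tendsto_iff_norm_sub_tendsto_zero]
  have h2 : Tendsto (fun t : ℝ => 2 * (Real.Gamma (1 / 2) * t ^ (1 / 2 : ℝ))) (𝓝[>] 0) (𝓝 0) := by
    simpa using ((tendsto_rpow_nhdsGT_zero (p := 1 / 2) (by norm_num)).const_mul
      (Real.Gamma (1 / 2))).const_mul 2
  refine squeeze_zero' (Eventually.of_forall fun _ => norm_nonneg _) ?_ h2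
  filter_upwards [self_mem_nhdsWithin] with t ht
  have ht0 : (0 : ℝ) < t := ht
  have i1 := integrableOn_hankelIntegrand (p := 1 / 2) (by norm_num) ht0
  have i2 : IntegrableOn (fun s : ℝ => ((Real.exp (-(t * s)) : ℝ) : ℂ)) (Ioi 0) :=
    (integrableOn_exp_neg_mul ht0).ofReal
  have e1 : (t : ℂ) * hankelMoment (1 / 2) t - 1
      = t * ∫ s in Ioi (0 : ℝ), (((s ^ (1 / 2 : ℝ) * Real.exp (-(t * s)) : ℝ) : ℂ)
        * (shiftedSqrt s)⁻¹ - ((Real.exp (-(t * s)) : ℝ) : ℂ)) := by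
    rw [integral_sub i1 i2, integral_complex_ofReal, integral_exp_neg_mul_Ioi ht0, mul_sub,
      hankelMoment]
    congr 1
    push_cast
    exact (mul_inv_cancel₀ (by exact_mod_cast ht0.ne')).symm
  have h3 : ‖∫ s in Ioi (0 : ℝ), (((s ^ (1 / 2 : ℝ) * Real.exp (-(t * s)) : ℝ) : ℂ)
        * (shiftedSqrt s)⁻¹ - ((Real.exp (-(t * s)) : ℝ) : ℂ))‖
      ≤ ∫ s in Ioi (0 : ℝ), 2 * (s ^ (-1 / 2 : ℝ) * Real.exp (-(t * s))) := by
    refine norm_integral_le_of_norm_le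
      ((integrableOn_rpow_mul_exp (p := -1 / 2) (by norm_num) ht0).const_mul 2) ?_
    refine (ae_restrict_iff' measurableSet_Ioi).2 (Eventually.of_forall fun s hs => ?_)
    have e2 : ((s ^ (1 / 2 : ℝ) * Real.exp (-(t * s)) : ℝ) : ℂ)
        * (shiftedSqrt s)⁻¹ - ((Real.exp (-(t * s)) : ℝ) : ℂ)
        = ((Real.exp (-(t * s)) : ℝ) : ℂ) * (((√s : ℝ) : ℂ) * (shiftedSqrt s)⁻¹ - 1) := by
      rw [← Real.sqrt_eq_rpow]; push_cast; ring
    rw [e2, norm_mul, Complex.norm_real, Real.norm_of_nonneg (Real.exp_pos _).le]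
    have := norm_sqrt_div_shiftedSqrt_sub_one_le hs
    have h0 := Real.exp_pos (-(t * s))
    nlinarith
  have h4 := Real.integral_rpow_mul_exp_neg_mul_Ioi (a := 1 / 2) (by norm_num) ht0
  rw [show (1 / 2 - 1 : ℝ) = -1 / 2 by norm_num] at h4
  rw [integral_const_mul, h4, one_div t] at h3
  rw [e1, norm_mul, Complex.norm_real, Real.norm_of_nonneg ht0.le]
  have h5 : t * (t⁻¹ ^ (1 / 2 : ℝ)) = t ^ (1 / 2 : ℝ) := by
    rw [Real.inv_rpow ht0.le, ← Real.rpow_neg ht0.le]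
    nth_rewrite 1 [← Real.rpow_one t]
    rw [← Real.rpow_add ht0]
    norm_num
  rw [← h5]
  refine (mul_le_mul_of_nonneg_left h3 ht0.le).trans_eq ?_
  ring

theorem tendsto_exp_mul_I : Tendsto (fun t : ℝ => Complex.exp (t * Complex.I)) (𝓝[>] 0) (𝓝 1) := by
  have : Tendsto (fun t : ℝ => Complex.exp (t * Complex.I)) (𝓝 0)
      (𝓝 (Complex.exp ((0 : ℝ) * Complex.I))) := Continuous.tendsto (by fun_prop) 0
  simpa using this.mono_left nhdsWithin_le_nhds

theorem two_div_pi_I : (2 : ℂ) / (Real.pi * Complex.I) = -(2 / Real.pi) * Complex.I := by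
  have : (Real.pi : ℂ) ≠ 0 := by exact_mod_cast Real.pi_pos.ne'
  field_simp
  rw [Complex.I_sq, neg_neg]

/-- Both functions have the singular part `(2i/π) log t` and the same constant `1 + (2i/π)(γ - log
2)`. Agreement of the constants matters: matching logarithms alone would leave a multiple of `J_0`
undetermined. -/
theorem tendsto_hankel_sub_hankelIntegral :
    Tendsto (fun t => hankel 0 t - hankelIntegral t) (𝓝[>] 0) (𝓝 0) := by
  have a1 : Tendsto (fun t : ℝ => ((besselJ 0 t : ℝ) : ℂ)) (𝓝[>] 0) (𝓝 1) := by
    have := ((Complex.continuous_ofReal.comp continuous_besselJ_zero).tendsto 0).mono_left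
      (nhdsWithin_le_nhds (s := Ioi (0 : ℝ)))
    simpa [besselJ_zero_zero, Function.comp_def] using this
  have a2 := (Complex.continuous_ofReal.tendsto _).comp tendsto_neumannN_zero_sub_log
  have a3 := tendsto_hankelMoment_add_log
  have a4 : Tendsto (fun t : ℝ => (Complex.exp (t * Complex.I) - 1) * hankelMoment (-1 / 2) t)
      (𝓝[>] 0) (𝓝 0) := by
    have hsl : Tendsto (fun t : ℝ => (Complex.exp (t * Complex.I) - 1) / t) (𝓝[>] 0)
        (𝓝 Complex.I) := by
      have h := (exp_mul_I_hasDerivAt 0).tendsto_slope.mono_left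
        (nhdsWithin_mono 0 (fun x (hx : 0 < x) => ne_of_gt hx) : 𝓝[>] (0 : ℝ) ≤ 𝓝[≠] 0)
      simp only [Complex.ofReal_zero, zero_mul, Complex.exp_zero, mul_one] at h
      refine h.congr fun t => ?_
      simp [slope_def_module]
      ring
    have h := hsl.mul tendsto_mul_hankelMoment_neg_half
    rw [mul_zero] at h
    refine h.congr' ?_
    filter_upwards [self_mem_nhdsWithin] with t ht
    have : (t : ℂ) ≠ 0 := by exact_mod_cast (ne_of_gt ht)
    field_simp
  have hh := (a1.add (a2.mul_const Complex.I)).sub ((a4.add a3).const_mul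
    (2 / (Real.pi * Complex.I)))
  have e : (1 : ℂ) + ((2 / Real.pi * (Real.eulerMascheroniConstant - Real.log 2) : ℝ) : ℂ) * Complex.I
      - 2 / (Real.pi * Complex.I) * (0 + (Real.log 2 - Real.eulerMascheroniConstant
        + Real.pi / 2 * Complex.I)) = 0 := by
    have : (Real.pi : ℂ) ≠ 0 := by exact_mod_cast Real.pi_pos.ne'
    rw [two_div_pi_I]
    simp only [Complex.ofReal_mul, Complex.ofReal_div, Complex.ofReal_sub, Complex.ofReal_ofNat]
    field_simp
    linear_combination (Real.pi : ℂ) * Complex.I_sq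
  rw [e] at hh
  refine hh.congr fun t => ?_
  rw [hankel, hankelIntegral, two_div_pi_I, Function.comp]
  push_cast
  ring

theorem tendsto_mul_hankel_one_add :
    Tendsto (fun t : ℝ => -(t * hankel 1 t) - t * hankelIntegralDeriv t) (𝓝[>] 0) (𝓝 0) := by
  have a1 : Tendsto (fun t : ℝ => ((t * besselJ 1 t : ℝ) : ℂ)) (𝓝[>] 0) (𝓝 0) := by
    have hc : Continuous fun t : ℝ => ((t * besselJ 1 t : ℝ) : ℂ) :=
      Complex.continuous_ofReal.comp (continuous_id.mul continuous_besselJ_one)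
    have := (hc.tendsto 0).mono_left (nhdsWithin_le_nhds (s := Ioi (0 : ℝ)))
    simpa using this
  have a2 := (Complex.continuous_ofReal.tendsto _).comp tendsto_mul_neumannN_one
  have a3 := tendsto_exp_mul_I.mul
    ((tendsto_mul_hankelMoment_neg_half.const_mul Complex.I).sub tendsto_mul_hankelMoment_half)
  have hh := ((a1.add (a2.mul_const Complex.I)).neg).sub
    (a3.const_mul (2 / (Real.pi * Complex.I)))
  have e : -(0 + ((-(2 / Real.pi) : ℝ) : ℂ) * Complex.I)
      - 2 / (Real.pi * Complex.I) * (1 * (Complex.I * 0 - 1)) = 0 := by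
    rw [two_div_pi_I]; push_cast; ring
  rw [e] at hh
  refine hh.congr fun t => ?_
  rw [hankel, hankelIntegralDeriv, Function.comp]
  push_cast
  ring

theorem isRegularMode_besselJ_zero (ρ : ℝ) :
    IsRegularMode (fun r => ((0 : ℤ) : ℝ) ^ 2 / r - 1 ^ 2 * r) ρ
      (fun t => (besselJ 0 t : ℂ)) (fun t => -((t * besselJ 1 t : ℝ) : ℂ)) where
  hasDerivAt_fst r hr := by
    have : (r : ℂ) ≠ 0 := by exact_mod_cast hr.1.ne'
    refine (besselJ_zero_hasDerivAt r).ofReal_comp.congr_deriv ?_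
    push_cast
    field_simp
  hasDerivAt_snd r _ := by
    refine (mul_besselJ_one_hasDerivAt r).ofReal_comp.neg.congr_deriv ?_
    push_cast
    ring
  tendsto_snd := by
    have hc : Continuous fun t : ℝ => -((t * besselJ 1 t : ℝ) : ℂ) :=
      (Complex.continuous_ofReal.comp (continuous_id.mul continuous_besselJ_one)).neg
    have := (hc.tendsto 0).mono_left (nhdsWithin_le_nhds (s := Ioi (0 : ℝ)))
    simpa using this
  bounded_fst := by
    have hc : Continuous fun t : ℝ => ‖((besselJ 0 t : ℝ) : ℂ)‖ :=
      (Complex.continuous_ofReal.comp continuous_besselJ_zero).norm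
    refine ⟨‖((besselJ 0 0 : ℝ) : ℂ)‖ + 1, ?_⟩
    exact nhdsWithin_le_nhds ((hc.tendsto 0).eventually_le_const (by linarith))

/-- The difference solves the Bessel equation and is regular at the origin, hence proportional to
`J_0`. It tends to `0` there while `J_0(0) = 1`, so it vanishes. -/
theorem hankel_zero_eq_hankelIntegral {t : ℝ} (ht : 0 < t) : hankel 0 t = hankelIntegral t := by
  have hd : IsRegularMode (fun r => ((0 : ℤ) : ℝ) ^ 2 / r - 1 ^ 2 * r) (t + 1)
      (fun t => hankel 0 t - hankelIntegral t)
      (fun t => -(t * hankel 1 t) - t * hankelIntegralDeriv t) :=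
    { hasDerivAt_fst := fun r hr => by
        have : (r : ℂ) ≠ 0 := by exact_mod_cast hr.1.ne'
        refine ((hankel_zero_hasDerivAt hr.1).sub (hankelIntegral_hasDerivAt hr.1)).congr_deriv ?_
        field_simp
      hasDerivAt_snd := fun r hr => by
        refine ((mul_hankel_one_hasDerivAt hr.1).neg.sub
          (mul_hankelIntegralDeriv_hasDerivAt hr.1)).congr_deriv ?_
        push_cast
        ring
      tendsto_snd := tendsto_mul_hankel_one_add
      bounded_fst := ⟨1, by
        have := tendsto_hankel_sub_hankelIntegral.norm
        rw [norm_zero] at this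
        exact this.eventually_le_const one_pos⟩ }
  have htm : t ∈ Ioo 0 (t + 1) := ⟨ht, by linarith⟩
  have h1 : Tendsto (fun s : ℝ => (hankel 0 t - hankelIntegral t) * (besselJ 0 s : ℂ)) (𝓝[>] 0)
      (𝓝 ((hankel 0 t - hankelIntegral t) * 1)) := by
    refine Tendsto.const_mul _ ?_
    have := ((Complex.continuous_ofReal.comp continuous_besselJ_zero).tendsto 0).mono_left
      (nhdsWithin_le_nhds (s := Ioi (0 : ℝ)))
    simpa [besselJ_zero_zero, Function.comp_def] using this
  have h2 := tendsto_hankel_sub_hankelIntegral.mul_const (besselJ 0 t : ℂ)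
  have h3 := tendsto_nhds_unique (h1.congr' ?_) h2
  · rw [mul_one, zero_mul] at h3
    exact sub_eq_zero.1 h3
  · filter_upwards [Ioo_mem_nhdsGT (show (0 : ℝ) < t + 1 by linarith)] with s hs
    exact hd.proportional (continuousOn_modeCoefficient 0 1) (isRegularMode_besselJ_zero _) htm hs

theorem neg_hankel_one_eq {t : ℝ} (ht : 0 < t) : -hankel 1 t = hankelIntegralDeriv t := by
  refine (hankel_zero_hasDerivAt ht).unique ((hankelIntegral_hasDerivAt ht).congr_of_eventuallyEq ?_)
  filter_upwards [lt_mem_nhds ht] with x hx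
  exact hankel_zero_eq_hankelIntegral hx

theorem norm_two_div_pi_I_le : ‖(2 : ℂ) / (Real.pi * Complex.I)‖ ≤ 1 := by
  rw [norm_div, norm_mul, Complex.norm_I, Complex.norm_real, Real.norm_of_nonneg Real.pi_pos.le,
    Complex.norm_ofNat, mul_one, div_le_one Real.pi_pos]
  exact Real.two_le_pi

theorem exists_norm_hankel_zero_le :
    ∃ C : ℝ, 0 ≤ C ∧ ∀ t : ℝ, 0 < t → ‖hankel 0 t‖ ≤ C * t ^ (-1 / 2 : ℝ) := by
  refine ⟨Real.Gamma (1 / 2), (Real.Gamma_pos_of_pos (by norm_num)).le, fun t ht => ?_⟩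
  rw [hankel_zero_eq_hankelIntegral ht, hankelIntegral, norm_mul, norm_mul,
    Complex.norm_exp_ofReal_mul_I, one_mul]
  have h := norm_hankelMoment_le (p := -1 / 2) (by norm_num) ht
  rw [show (-1 / 2 + 1 : ℝ) = 1 / 2 by norm_num, one_div t, Real.inv_rpow ht.le,
    ← Real.rpow_neg ht.le, show (-(1 / 2) : ℝ) = -1 / 2 by norm_num] at h
  exact (mul_le_of_le_one_left (norm_nonneg _) norm_two_div_pi_I_le).trans h

/-- Since `H_1 = -H_0'`, the factor `exp(it)` differentiates to a term that cancels `i H_0`, and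
only the moment of order `1/2` remains, one power of `t` smaller. This is the outgoing behaviour
behind the radiation condition. -/
theorem exists_norm_hankel_one_add_le :
    ∃ C : ℝ, 0 ≤ C ∧ ∀ t : ℝ, 0 < t →
      ‖hankel 1 t + Complex.I * hankel 0 t‖ ≤ C * t ^ (-3 / 2 : ℝ) := by
  refine ⟨Real.Gamma (3 / 2), (Real.Gamma_pos_of_pos (by norm_num)).le, fun t ht => ?_⟩
  have e : hankel 1 t + Complex.I * hankel 0 t = 2 / (Real.pi * Complex.I)
      * (Complex.exp (t * Complex.I) * hankelMoment (1 / 2) t) := by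
    rw [hankel_zero_eq_hankelIntegral ht, ← neg_neg (hankel 1 t), neg_hankel_one_eq ht,
      hankelIntegral, hankelIntegralDeriv]
    ring
  rw [e, norm_mul, norm_mul, Complex.norm_exp_ofReal_mul_I, one_mul]
  have h := norm_hankelMoment_le (p := 1 / 2) (by norm_num) ht
  rw [show (1 / 2 + 1 : ℝ) = 3 / 2 by norm_num, one_div t, Real.inv_rpow ht.le,
    ← Real.rpow_neg ht.le, show (-(3 / 2) : ℝ) = -3 / 2 by norm_num] at h
  exact (mul_le_of_le_one_left (norm_nonneg _) norm_two_div_pi_I_le).trans h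

theorem exists_norm_hankel_one_le :
    ∃ C : ℝ, 0 ≤ C ∧ ∀ t : ℝ, 0 < t →
      ‖hankel 1 t‖ ≤ C * (t ^ (-1 / 2 : ℝ) + t ^ (-3 / 2 : ℝ)) := by
  obtain ⟨C, hC, h1⟩ := exists_norm_hankel_zero_le
  obtain ⟨C', hC', h2⟩ := exists_norm_hankel_one_add_le
  refine ⟨C + C', by positivity, fun t ht => ?_⟩
  have e : hankel 1 t = (hankel 1 t + Complex.I * hankel 0 t) - Complex.I * hankel 0 t := by ring
  have h3 : ‖hankel 1 t‖ ≤ C' * t ^ (-3 / 2 : ℝ) + C * t ^ (-1 / 2 : ℝ) := by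
    rw [e]
    refine (norm_sub_le _ _).trans (add_le_add (h2 t ht) ?_)
    rw [norm_mul, Complex.norm_I, one_mul]
    exact h1 t ht
  have h4 : 0 ≤ t ^ (-1 / 2 : ℝ) := by positivity
  have h5 : 0 ≤ t ^ (-3 / 2 : ℝ) := by positivity
  nlinarith

/-! ### Radial functions on the plane -/

theorem two_le_infty : (2 : WithTop ℕ∞) ≤ ∞ := ENat.LEInfty.out

theorem radial_hasFDerivAt {g : ℝ → ℂ} {g' : ℂ} {c : ℝ} {x : Plane}
    (h : HasDerivAt g g' (c * ‖x‖ ^ 2)) :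
    HasFDerivAt (fun x : Plane => g (c * ‖x‖ ^ 2)) ((innerSL ℝ x).smulRight (2 * c * g')) x := by
  have h1 := ((hasStrictFDerivAt_norm_sq x).hasFDerivAt.const_mul c)
  refine (h.hasFDerivAt.comp x h1).congr_fderiv ?_
  ext v
  simp [Complex.real_smul]
  ring

/-- In two dimensions a function of `s = c|x|^2` has Laplacian `4c (s g'' + g')`, the operator of
`powerSum_ode`; with `c = k^2/4` the profiles therefore solve the Helmholtz equation. -/
theorem radial_laplacian {g g' : ℝ → ℂ} {g'' : ℂ} {c : ℝ} {x : Plane}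
    (hg : ContDiffAt ℝ 2 (fun x : Plane => g (c * ‖x‖ ^ 2)) x)
    (h : ∀ᶠ s in 𝓝 (c * ‖x‖ ^ 2), HasDerivAt g (g' s) s)
    (h' : HasDerivAt g' g'' (c * ‖x‖ ^ 2)) :
    Δ (fun x : Plane => g (c * ‖x‖ ^ 2)) x
      = 4 * c * ((c * ‖x‖ ^ 2 : ℝ) * g'' + g' (c * ‖x‖ ^ 2)) := by
  have hcont : Tendsto (fun x : Plane => c * ‖x‖ ^ 2) (𝓝 x) (𝓝 (c * ‖x‖ ^ 2)) :=
    Continuous.tendsto (by fun_prop) x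
  have h1 : ∀ v : Plane, fderiv ℝ (fderiv ℝ fun x : Plane => g (c * ‖x‖ ^ 2)) x v v
      = 2 * c * (‖v‖ ^ 2 * g' (c * ‖x‖ ^ 2) + 2 * c * (inner ℝ x v) ^ 2 * g'') := by
    intro v
    have hd : DifferentiableAt ℝ (fderiv ℝ fun x : Plane => g (c * ‖x‖ ^ 2)) x :=
      (hg.fderiv_right (m := 1) (by norm_num)).differentiableAt (by norm_num)
    have e1 : fderiv ℝ (fun y => fderiv ℝ (fun x : Plane => g (c * ‖x‖ ^ 2)) y v) x v
        = fderiv ℝ (fderiv ℝ fun x : Plane => g (c * ‖x‖ ^ 2)) x v v := by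
      rw [fderiv_clm_apply hd (differentiableAt_const v)]
      simp
    have e2 : (fun y => fderiv ℝ (fun x : Plane => g (c * ‖x‖ ^ 2)) y v)
        =ᶠ[𝓝 x] fun y => ((inner ℝ y v : ℝ) : ℂ) * (2 * c * g' (c * ‖y‖ ^ 2)) := by
      filter_upwards [hcont.eventually h] with y hy
      rw [(radial_hasFDerivAt hy).fderiv]
      simp
    rw [← e1, e2.fderiv_eq]
    have d1 : HasFDerivAt (fun y : Plane => ((inner ℝ y v : ℝ) : ℂ))
        (Complex.ofRealCLM.comp (innerSL ℝ v)) x := by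
      have : (fun y : Plane => ((inner ℝ y v : ℝ) : ℂ)) = Complex.ofRealCLM.comp (innerSL ℝ v) := by
        funext y; simp [real_inner_comm]
      rw [this]
      exact ContinuousLinearMap.hasFDerivAt _
    have d2 := (radial_hasFDerivAt h').const_mul (2 * c : ℂ)
    have d3 : HasFDerivAt (fun y : Plane => ((inner ℝ y v : ℝ) : ℂ) * (2 * c * g' (c * ‖y‖ ^ 2)))
        _ x := d1.mul d2
    rw [d3.fderiv]
    simp
    ring
  rw [laplacian_eq_sum_fderiv, Fin.sum_univ_two, h1, h1]
  have hx : ‖x‖ ^ 2 = x 0 ^ 2 + x 1 ^ 2 := by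
    rw [EuclideanSpace.norm_sq_eq]; simp [Fin.sum_univ_two]
  rw [hx]
  simp [EuclideanSpace.inner_single_right]
  ring

/-- `J_0(k|x|)` as a function on the plane. -/
noncomputable def planeBessel (k : ℝ) (x : Plane) : ℂ := besselJ 0 (k * ‖x‖)

/-- `N_0(k|x|)` as a function on the plane. -/
noncomputable def planeNeumann (k : ℝ) (x : Plane) : ℂ := neumannN 0 (k * ‖x‖)

theorem planeBessel_eq (k : ℝ) :
    planeBessel k = fun x : Plane => ((besselProfile (k ^ 2 / 4 * ‖x‖ ^ 2) : ℝ) : ℂ) := by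
  funext x
  rw [planeBessel, besselJ_zero_eq]
  congr 2
  ring

theorem planeNeumann_eq (k : ℝ) :
    planeNeumann k = fun x : Plane => ((neumannProfile (k ^ 2 / 4 * ‖x‖ ^ 2) : ℝ) : ℂ) := by
  funext x
  rw [planeNeumann, neumannN_zero_eq]
  congr 2
  ring

theorem planeBessel_contDiff (k : ℝ) : ContDiff ℝ ∞ (planeBessel k) := by
  rw [planeBessel_eq]
  have h1 : ContDiff ℝ ∞ fun x : Plane => k ^ 2 / 4 * ‖x‖ ^ 2 :=
    contDiff_const.mul (contDiff_norm_sq ℝ)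
  exact Complex.ofRealCLM.contDiff.comp (besselProfile_contDiff.comp h1)

theorem planeNeumann_contDiffAt {k : ℝ} (hk : 0 < k) {x : Plane} (hx : x ≠ 0) :
    ContDiffAt ℝ ∞ (planeNeumann k) x := by
  rw [planeNeumann_eq]
  have h1 : ContDiff ℝ ∞ fun x : Plane => k ^ 2 / 4 * ‖x‖ ^ 2 :=
    contDiff_const.mul (contDiff_norm_sq ℝ)
  have hpos : 0 < ‖x‖ := norm_pos_iff.2 hx
  exact Complex.ofRealCLM.contDiff.contDiffAt.comp x
    ((neumannProfile_contDiffAt (by positivity)).comp x h1.contDiffAt)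

theorem laplacian_planeBessel (k : ℝ) (x : Plane) :
    Δ (planeBessel k) x = -(k : ℂ) ^ 2 * planeBessel k x := by
  have hc := (planeBessel_contDiff k).contDiffAt (x := x) |>.of_le (m := 2) two_le_infty
  have e := planeBessel_eq k
  rw [e] at hc ⊢
  rw [radial_laplacian (g := fun s => ((besselProfile s : ℝ) : ℂ))
    (g' := fun s => ((deriv besselProfile s : ℝ) : ℂ)) hc
    (Eventually.of_forall fun s => (besselProfile_hasDerivAt s).ofReal_comp)
    (deriv_besselProfile_hasDerivAt _).ofReal_comp]
  have h := congrArg Complex.ofReal (besselProfile_ode (k ^ 2 / 4 * ‖x‖ ^ 2))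
  simp only [Complex.ofReal_add, Complex.ofReal_mul, Complex.ofReal_zero, Complex.ofReal_div,
    Complex.ofReal_pow, Complex.ofReal_ofNat] at h ⊢
  linear_combination (k : ℂ) ^ 2 * h

theorem laplacian_planeNeumann {k : ℝ} (hk : 0 < k) {x : Plane} (hx : x ≠ 0) :
    Δ (planeNeumann k) x = -(k : ℂ) ^ 2 * planeNeumann k x := by
  have hc := (planeNeumann_contDiffAt hk hx).of_le (m := 2) two_le_infty
  have e := planeNeumann_eq k
  have hpos : 0 < ‖x‖ := norm_pos_iff.2 hx
  have hs : 0 < k ^ 2 / 4 * ‖x‖ ^ 2 := by positivity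
  rw [e] at hc ⊢
  rw [radial_laplacian (g := fun s => ((neumannProfile s : ℝ) : ℂ))
    (g' := fun s => ((deriv neumannProfile s : ℝ) : ℂ)) hc ?_
    (deriv_neumannProfile_hasDerivAt hs).differentiableAt.hasDerivAt.ofReal_comp]
  · have h := congrArg Complex.ofReal (neumannProfile_ode hs)
    simp only [Complex.ofReal_add, Complex.ofReal_mul, Complex.ofReal_zero, Complex.ofReal_div,
      Complex.ofReal_pow, Complex.ofReal_ofNat] at h ⊢
    linear_combination (k : ℂ) ^ 2 * h
  · filter_upwards [lt_mem_nhds hs] with s hs'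
    exact (neumannProfile_hasDerivAt hs').differentiableAt.hasDerivAt.ofReal_comp

theorem fderiv_planeBessel (k : ℝ) {x : Plane} (hx : x ≠ 0) (v : Plane) :
    fderiv ℝ (planeBessel k) x v
      = ((-(k * (inner ℝ x v / ‖x‖) * besselJ 1 (k * ‖x‖)) : ℝ) : ℂ) := by
  have hpos : 0 < ‖x‖ := norm_pos_iff.2 hx
  rw [planeBessel_eq, (radial_hasFDerivAt (besselProfile_hasDerivAt _).ofReal_comp).fderiv,
    besselJ_one_eq, show (k * ‖x‖ / 2) ^ 2 = k ^ 2 / 4 * ‖x‖ ^ 2 by ring]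
  simp only [ContinuousLinearMap.smulRight_apply, innerSL_apply_apply, Complex.real_smul]
  have : (‖x‖ : ℂ) ≠ 0 := by exact_mod_cast hpos.ne'
  push_cast
  field_simp
  ring

theorem fderiv_planeNeumann {k : ℝ} (hk : 0 < k) {x : Plane} (hx : x ≠ 0) (v : Plane) :
    fderiv ℝ (planeNeumann k) x v
      = ((-(k * (inner ℝ x v / ‖x‖) * neumannN 1 (k * ‖x‖)) : ℝ) : ℂ) := by
  have hpos : 0 < ‖x‖ := norm_pos_iff.2 hx
  have hs : 0 < k ^ 2 / 4 * ‖x‖ ^ 2 := by positivity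
  rw [planeNeumann_eq, (radial_hasFDerivAt
    (neumannProfile_hasDerivAt hs).differentiableAt.hasDerivAt.ofReal_comp).fderiv,
    neumannN_one_eq (by positivity), show (k * ‖x‖ / 2) ^ 2 = k ^ 2 / 4 * ‖x‖ ^ 2 by ring]
  simp only [ContinuousLinearMap.smulRight_apply, innerSL_apply_apply, Complex.real_smul]
  have : (‖x‖ : ℂ) ≠ 0 := by exact_mod_cast hpos.ne'
  push_cast
  field_simp
  ring

theorem laplacian_comp_sub {f : Plane → ℂ} (a x : Plane) :
    Δ (fun x => f (x - a)) x = Δ f (x - a) := by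
  rw [laplacian_eq_sum_fderiv, laplacian_eq_sum_fderiv]
  refine Finset.sum_congr rfl fun i _ => ?_
  have : fderiv ℝ (fun x => f (x - a)) = fun x => fderiv ℝ f (x - a) :=
    funext fun x => fderiv_comp_sub a
  rw [this, fderiv_comp_sub (f := fderiv ℝ f) a]

/-! ### The mean value property -/

theorem circleMode_zero_apply (n : ℤ) (f : Plane → ℂ) :
    circleMode n f 0 = (∫ θ in (0)..(2 * Real.pi), circleChar n θ) * f 0 := by
  simp [circleMode]

theorem continuousOn_circleMode {f : Plane → ℂ} {ρ : ℝ} (hf : ContinuousOn f (Metric.ball 0 ρ))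
    (n : ℤ) : ContinuousOn (circleMode n f) (Ioo (-ρ) ρ) := by
  have h : ContinuousOn (fun p : ℝ × ℝ => circleChar n p.2 * f (p.1 • unitVec p.2))
      (Ioo (-ρ) ρ ×ˢ univ) :=
    ((continuous_circleChar n).comp continuous_snd).continuousOn.mul hf.comp_circle
  rw [continuousOn_iff_continuous_domRestrict]
  refine intervalIntegral.continuous_parametric_intervalIntegral_of_continuous'
    (f := fun (r : Ioo (-ρ) ρ) θ => circleChar n θ * f ((r : ℝ) • unitVec θ)) ?_ _ _
  exact h.comp_continuous (f := fun p : Ioo (-ρ) ρ × ℝ => ((p.1 : ℝ), p.2)) (by fun_prop)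
    fun p => ⟨p.1.2, mem_univ _⟩

theorem tendsto_circleMode_zero {f : Plane → ℂ} {ρ : ℝ} (hρ : 0 < ρ)
    (hf : ContinuousOn f (Metric.ball 0 ρ)) (n : ℤ) :
    Tendsto (circleMode n f) (𝓝[>] 0) (𝓝 (circleMode n f 0)) :=
  (((continuousOn_circleMode hf n).continuousAt
    (Ioo_mem_nhds (by linarith) hρ)).tendsto).mono_left nhdsWithin_le_nhds

/-- The proportionality of regular modes, extended to radius zero by continuity so that values at
the centre can be compared. -/
theorem circleMode_proportional {f g : Plane → ℂ} {ρ : ℝ}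
    (hf : ContDiffOn ℝ 2 f (Metric.ball 0 ρ)) (hg : ContDiffOn ℝ 2 g (Metric.ball 0 ρ)) {k : ℝ}
    (hkf : ∀ x ∈ Metric.ball (0 : Plane) ρ, Δ f x = -(k : ℂ) ^ 2 * f x)
    (hkg : ∀ x ∈ Metric.ball (0 : Plane) ρ, Δ g x = -(k : ℂ) ^ 2 * g x) (n : ℤ) {r s : ℝ}
    (hr : r ∈ Ico 0 ρ) (hs : s ∈ Ico 0 ρ) :
    circleMode n f r * circleMode n g s = circleMode n f s * circleMode n g r := by
  have hρ : 0 < ρ := hr.1.trans_lt hr.2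
  have key : ∀ r ∈ Ioo 0 ρ, ∀ s ∈ Ioo 0 ρ,
      circleMode n f r * circleMode n g s = circleMode n f s * circleMode n g r := fun r hr s hs =>
    (isRegularMode_circleMode hρ hf hkf n).proportional (continuousOn_modeCoefficient n k)
      (isRegularMode_circleMode hρ hg hkg n) hr hs
  have tf := tendsto_circleMode_zero hρ hf.continuousOn n
  have tg := tendsto_circleMode_zero hρ hg.continuousOn n
  have key0 : ∀ r ∈ Ioo 0 ρ,
      circleMode n f r * circleMode n g 0 = circleMode n f 0 * circleMode n g r := fun r hr => by
    refine tendsto_nhds_unique (tg.const_mul _) ((tf.mul_const _).congr' ?_)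
    filter_upwards [Ioo_mem_nhdsGT hρ] with s hs
    exact (key r hr s hs).symm
  rcases hr.1.eq_or_lt with h | h
  · rcases hs.1.eq_or_lt with h' | h'
    · rw [← h, ← h']
    · rw [← h]; exact (key0 s ⟨h', hs.2⟩).symm
  · rcases hs.1.eq_or_lt with h' | h'
    · rw [← h']; exact key0 r ⟨h, hr.2⟩
    · exact key r ⟨h, hr.2⟩ s ⟨h', hs.2⟩

theorem circleChar_zero (θ : ℝ) : circleChar 0 θ = 1 := by simp [circleChar]

theorem circleMode_planeBessel (k : ℝ) {r : ℝ} (hr : 0 ≤ r) :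
    circleMode 0 (planeBessel k) r = 2 * Real.pi * besselJ 0 (k * r) := by
  simp [circleMode, circleChar_zero, planeBessel, norm_smul_unitVec hr]

/-- The mode of order zero of `f` is proportional to that of `J_0(k|x|)`; comparison at the centre
fixes the factor. -/
theorem circle_mean_value {f : Plane → ℂ} {ρ : ℝ}
    (hf : ContDiffOn ℝ 2 f (Metric.ball 0 ρ)) {k : ℝ}
    (hkf : ∀ x ∈ Metric.ball (0 : Plane) ρ, Δ f x = -(k : ℂ) ^ 2 * f x) {r : ℝ}
    (hr : r ∈ Ico 0 ρ) :
    ∫ θ in (0)..(2 * Real.pi), f (r • unitVec θ) = 2 * Real.pi * f 0 * besselJ 0 (k * r) := by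
  have hρ : 0 < ρ := hr.1.trans_lt hr.2
  have h := circleMode_proportional hf
    ((planeBessel_contDiff k).of_le two_le_infty).contDiffOn hkf
    (fun x _ => laplacian_planeBessel k x) 0 hr ⟨le_rfl, hρ⟩
  rw [circleMode_planeBessel k le_rfl, circleMode_planeBessel k hr.1, circleMode_zero_apply] at h
  simp only [circleMode, circleChar_zero, one_mul, mul_zero, besselJ_zero_zero] at h
  have hpi : (Real.pi : ℂ) ≠ 0 := by exact_mod_cast Real.pi_pos.ne'
  simp at h
  refine mul_right_cancel₀ (mul_ne_zero two_ne_zero hpi) ?_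
  linear_combination h

/-- The radial derivative of the mean value formula, by uniqueness of derivatives. -/
theorem circle_flux_mean_value {f : Plane → ℂ} {ρ : ℝ}
    (hf : ContDiffOn ℝ 2 f (Metric.ball 0 ρ)) {k : ℝ}
    (hkf : ∀ x ∈ Metric.ball (0 : Plane) ρ, Δ f x = -(k : ℂ) ^ 2 * f x) {r : ℝ}
    (hr : r ∈ Ioo 0 ρ) :
    ∫ θ in (0)..(2 * Real.pi), fderiv ℝ f (r • unitVec θ) (unitVec θ)
      = -(2 * Real.pi * k * f 0 * besselJ 1 (k * r)) := by
  have hr0 : (r : ℂ) ≠ 0 := by exact_mod_cast hr.1.ne'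
  have h1 := circleMode_hasDerivAt hf 0 hr
  have h2 : HasDerivAt (fun r : ℝ => 2 * Real.pi * f 0 * (besselJ 0 (k * r) : ℂ))
      (2 * Real.pi * f 0 * ((-besselJ 1 (k * r) * k : ℝ) : ℂ)) r := by
    refine HasDerivAt.const_mul _ ?_
    have h3 := (besselJ_zero_hasDerivAt (k * r)).comp r ((hasDerivAt_id r).const_mul k)
    exact (h3.congr_deriv (by ring)).ofReal_comp
  have h3 := h1.unique (h2.congr_of_eventuallyEq ?_)
  · rw [circleFluxMode, div_eq_iff hr0] at h3
    simp only [circleChar_zero, one_mul] at h3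
    rw [intervalIntegral.integral_const_mul] at h3
    refine mul_left_cancel₀ hr0 ?_
    rw [h3]
    push_cast
    ring
  · filter_upwards [Ioo_mem_nhds hr.1 hr.2] with x hx
    rw [← circle_mean_value hf hkf ⟨hx.1.le, hx.2⟩]
    simp [circleMode, circleChar_zero]

/-! ### Translation invariance of the Wronskian flux -/

theorem plane_eq_circle (e : Plane) (θ : ℝ) :
    e = inner ℝ e (unitVec θ) • unitVec θ + inner ℝ e (unitTangent θ) • unitTangent θ := by
  have h := Real.cos_sq_add_sin_sq θ
  ext i
  fin_cases i
  · simp [unitVec, unitTangent, PiLp.inner_apply]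
    linear_combination -(e 0) * h
  · simp [unitVec, unitTangent, PiLp.inner_apply]
    linear_combination -(e 1) * h

/-- Rotation by a right angle. -/
noncomputable def rotateVec (e : Plane) : Plane := !₂[-(e 1), e 0]

theorem rotateVec_eq_circle (e : Plane) (θ : ℝ) :
    rotateVec e = inner ℝ e (unitVec θ) • unitTangent θ - inner ℝ e (unitTangent θ) • unitVec θ := by
  have h := Real.cos_sq_add_sin_sq θ
  ext i
  fin_cases i
  · simp [rotateVec, unitVec, unitTangent, PiLp.inner_apply]
    linear_combination (e 1) * h
  · simp [rotateVec, unitVec, unitTangent, PiLp.inner_apply]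
    linear_combination -(e 0) * h

/-- In the frame `(ν, τ)` the component of `e` along `ν` enters the sum of the two sides multiplied
by the trace of `B`, and the components along `τ` cancel. Applied to the derivative of a
divergence-free field, this turns a derivative in the direction `e` of the normal component into a
tangential derivative. -/
theorem bilinear_traceless (B : Plane →L[ℝ] Plane →L[ℝ] ℂ)
    (hB : ∑ i, B (EuclideanSpace.single i 1) (EuclideanSpace.single i 1) = 0) (e : Plane) (θ : ℝ) :
    B (unitTangent θ) (rotateVec e) = -B e (unitVec θ) := by
  rw [← bilinear_circle_trace B θ] at hB
  rw [rotateVec_eq_circle e θ]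
  nth_rewrite 3 [plane_eq_circle e θ]
  simp only [map_add, map_sub, map_smul, add_apply, smul_apply, Complex.real_smul]
  linear_combination (inner ℝ e (unitVec θ) : ℝ) * hB

/-- The one-form `f dg - g df`. -/
noncomputable def wronskianForm (f g : Plane → ℂ) (x : Plane) : Plane →L[ℝ] ℂ :=
  f x • fderiv ℝ g x - g x • fderiv ℝ f x

section flux
variable {f g : Plane → ℂ} {Ω : Set Plane}

theorem wronskianForm_contDiffOn (hΩ : IsOpen Ω) (hf : ContDiffOn ℝ 2 f Ω)
    (hg : ContDiffOn ℝ 2 g Ω) : ContDiffOn ℝ 1 (wronskianForm f g) Ω :=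
  ((hf.of_le (by norm_num)).smul (hg.fderiv_of_isOpen hΩ (by norm_num))).sub
    ((hg.of_le (by norm_num)).smul (hf.fderiv_of_isOpen hΩ (by norm_num)))

theorem fderiv_wronskianForm (hΩ : IsOpen Ω) (hf : ContDiffOn ℝ 2 f Ω)
    (hg : ContDiffOn ℝ 2 g Ω) {x : Plane} (hx : x ∈ Ω) (e v : Plane) :
    fderiv ℝ (wronskianForm f g) x e v
      = f x * fderiv ℝ (fderiv ℝ g) x e v + fderiv ℝ f x e * fderiv ℝ g x v
        - (g x * fderiv ℝ (fderiv ℝ f) x e v + fderiv ℝ g x e * fderiv ℝ f x v) := by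
  have hf0 := (hf.contDiffAt (hΩ.mem_nhds hx)).differentiableAt (by norm_num)
  have hg0 := (hg.contDiffAt (hΩ.mem_nhds hx)).differentiableAt (by norm_num)
  have hf1 := ((hf.contDiffAt (hΩ.mem_nhds hx)).fderiv_right (m := 1)
    (by norm_num)).differentiableAt (by norm_num)
  have hg1 := ((hg.contDiffAt (hΩ.mem_nhds hx)).fderiv_right (m := 1)
    (by norm_num)).differentiableAt (by norm_num)
  have h : HasFDerivAt (wronskianForm f g) _ x :=
    (hf0.hasFDerivAt.smul hg1.hasFDerivAt).sub (hg0.hasFDerivAt.smul hf1.hasFDerivAt)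
  rw [h.fderiv]
  simp

theorem fderiv_wronskianForm_trace (hΩ : IsOpen Ω) (hf : ContDiffOn ℝ 2 f Ω)
    (hg : ContDiffOn ℝ 2 g Ω) {k : ℝ} (hkf : ∀ x ∈ Ω, Δ f x = -(k : ℂ) ^ 2 * f x)
    (hkg : ∀ x ∈ Ω, Δ g x = -(k : ℂ) ^ 2 * g x) {x : Plane} (hx : x ∈ Ω) :
    ∑ i, fderiv ℝ (wronskianForm f g) x (EuclideanSpace.single i 1)
      (EuclideanSpace.single i 1) = 0 := by
  have h1 := hkf x hx
  have h2 := hkg x hx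
  rw [laplacian_eq_sum_fderiv, Fin.sum_univ_two] at h1 h2
  simp only [fderiv_wronskianForm hΩ hf hg hx, Fin.sum_univ_two]
  linear_combination f x * h2 - g x * h1

/-- `f dg - g df` is divergence free when both functions solve the same Helmholtz equation. By
`bilinear_traceless` the integrand is then, up to the factor `-R`, the `θ`-derivative of the form
evaluated on the rotated vector, a periodic function. -/
theorem integral_fderiv_wronskianForm (hΩ : IsOpen Ω) (hf : ContDiffOn ℝ 2 f Ω)
    (hg : ContDiffOn ℝ 2 g Ω) {k : ℝ} (hkf : ∀ x ∈ Ω, Δ f x = -(k : ℂ) ^ 2 * f x)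
    (hkg : ∀ x ∈ Ω, Δ g x = -(k : ℂ) ^ 2 * g x) {R : ℝ} (hR : R ≠ 0) (c e : Plane)
    (hc : ∀ θ, c + R • unitVec θ ∈ Ω) :
    ∫ θ in (0)..(2 * Real.pi), fderiv ℝ (wronskianForm f g) (c + R • unitVec θ) e (unitVec θ)
      = 0 := by
  have hW := wronskianForm_contDiffOn hΩ hf hg
  have hcont : Continuous fun θ => fderiv ℝ (wronskianForm f g) (c + R • unitVec θ) := by
    rw [← continuousOn_univ]
    exact (hW.continuousOn_fderiv_of_isOpen hΩ le_rfl).comp (by fun_prop) fun θ _ => hc θ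
  have hd : ∀ θ, HasDerivAt (fun θ => wronskianForm f g (c + R • unitVec θ) (rotateVec e))
      (-R * fderiv ℝ (wronskianForm f g) (c + R • unitVec θ) e (unitVec θ)) θ := fun θ => by
    have h1 := ((hW.contDiffAt (hΩ.mem_nhds (hc θ))).differentiableAt
      (by norm_num)).hasFDerivAt.comp_hasDerivAt θ
      (((unitVec_hasDerivAt θ).const_smul R).const_add c)
    have h2 := h1.clm_apply (hasDerivAt_const θ (rotateVec e))
    refine h2.congr_deriv ?_
    have h3 := bilinear_traceless _ (fderiv_wronskianForm_trace hΩ hf hg hkf hkg (hc θ)) e θ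
    simp only [map_smul, smul_apply, map_zero, add_zero, h3, Complex.real_smul]
    ring
  have h := intervalIntegral.integral_eq_sub_of_hasDerivAt (a := 0) (b := 2 * Real.pi)
    (fun θ _ => hd θ) (Continuous.intervalIntegrable (by fun_prop) _ _)
  have hp : unitVec (2 * Real.pi) = unitVec 0 := by
    have := unitVec_periodic 0
    rwa [zero_add] at this
  rw [intervalIntegral.integral_const_mul, hp, sub_self] at h
  rcases mul_eq_zero.1 h with h | h
  · exact absurd h (by simpa using hR)
  · exact h

/-- The flux of the Wronskian form through a circle does not change while the circle slides inside
the domain. This replaces Green's theorem on the region between two circles. -/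
theorem integral_wronskianForm_translate (hΩ : IsOpen Ω) (hf : ContDiffOn ℝ 2 f Ω)
    (hg : ContDiffOn ℝ 2 g Ω) {k : ℝ} (hkf : ∀ x ∈ Ω, Δ f x = -(k : ℂ) ^ 2 * f x)
    (hkg : ∀ x ∈ Ω, Δ g x = -(k : ℂ) ^ 2 * g x) {R : ℝ} (hR : R ≠ 0) (e : Plane) {I : Set ℝ}
    (hI : IsOpen I) (hIc : IsPreconnected I) (hΩI : ∀ s ∈ I, ∀ θ, s • e + R • unitVec θ ∈ Ω)
    {s t : ℝ} (hs : s ∈ I) (ht : t ∈ I) :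
    ∫ θ in (0)..(2 * Real.pi), wronskianForm f g (s • e + R • unitVec θ) (unitVec θ)
      = ∫ θ in (0)..(2 * Real.pi), wronskianForm f g (t • e + R • unitVec θ) (unitVec θ) := by
  have hW := wronskianForm_contDiffOn hΩ hf hg
  have hmap : MapsTo (fun p : ℝ × ℝ => p.1 • e + R • unitVec p.2) (I ×ˢ univ) Ω :=
    fun p hp => hΩI p.1 hp.1 p.2
  have hd : ∀ s ∈ I, HasDerivAt (fun s => ∫ θ in (0)..(2 * Real.pi),
      wronskianForm f g (s • e + R • unitVec θ) (unitVec θ)) 0 s := fun s hs => by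
    refine (hasDerivAt_circle_integral (F' := fun s θ =>
      fderiv ℝ (wronskianForm f g) (s • e + R • unitVec θ) e (unitVec θ)) hI hs ?_ ?_ ?_ 0
      (2 * Real.pi)).congr_deriv (integral_fderiv_wronskianForm hΩ hf hg hkf hkg hR _ e (hΩI s hs))
    · intro x hx
      have : Continuous fun θ => wronskianForm f g (x • e + R • unitVec θ) := by
        rw [← continuousOn_univ]
        exact hW.continuousOn.comp (by fun_prop) fun θ _ => hΩI x hx θ
      fun_prop
    · have h1 : ContinuousOn (fun p : ℝ × ℝ =>
          fderiv ℝ (wronskianForm f g) (p.1 • e + R • unitVec p.2)) (I ×ˢ univ) :=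
        (hW.continuousOn_fderiv_of_isOpen hΩ le_rfl).comp (by fun_prop) hmap
      exact (h1.clm_apply (g := fun _ => e) (by fun_prop)).clm_apply
        (g := fun p : ℝ × ℝ => unitVec p.2) (by fun_prop)
    · intro x hx θ
      have h2 : HasDerivAt (fun y : ℝ => y • e + R • unitVec θ) e x := by
        simpa using ((hasDerivAt_id x).smul_const e).add_const (R • unitVec θ)
      have h1 := ((hW.contDiffAt (hΩ.mem_nhds (hΩI x hx θ))).differentiableAt
        (by norm_num)).hasFDerivAt.comp_hasDerivAt x h2
      exact (h1.clm_apply (hasDerivAt_const x (unitVec θ))).congr_deriv (by simp)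
  exact hI.is_const_of_deriv_eq_zero hIc
    (fun y hy => (hd y hy).differentiableAt.differentiableWithinAt) (fun y hy => (hd y hy).deriv)
    hs ht

end flux

/-- The left side is constant by the Bessel equation. At the origin the first term dies, and `t
N_1(t) → -2/π` gives the value. -/
theorem bessel_wronskian {t : ℝ} (ht : 0 < t) :
    t * (besselJ 1 t * neumannN 0 t - besselJ 0 t * neumannN 1 t) = 2 / Real.pi := by
  have hd : ∀ x ∈ Ioi (0 : ℝ), HasDerivAt (fun t => t * besselJ 1 t * neumannN 0 t
      - besselJ 0 t * (t * neumannN 1 t)) 0 x := fun x hx =>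
    (((mul_besselJ_one_hasDerivAt x).mul (neumannN_zero_hasDerivAt hx)).sub
      ((besselJ_zero_hasDerivAt x).mul (mul_neumannN_one_hasDerivAt hx))).congr_deriv (by ring)
  have hconst : ∀ x ∈ Ioi (0 : ℝ), x * besselJ 1 x * neumannN 0 x - besselJ 0 x * (x * neumannN 1 x)
      = t * besselJ 1 t * neumannN 0 t - besselJ 0 t * (t * neumannN 1 t) := fun x hx =>
    isOpen_Ioi.is_const_of_deriv_eq_zero isPreconnected_Ioi
      (fun y hy => (hd y hy).differentiableAt.differentiableWithinAt)
      (fun y hy => (hd y hy).deriv) hx ht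
  have hlim : Tendsto (fun x => x * besselJ 1 x * neumannN 0 x - besselJ 0 x * (x * neumannN 1 x))
      (𝓝[>] 0) (𝓝 (2 / Real.pi)) := by
    have l0 := (continuous_besselJ_zero.tendsto 0).mono_left (nhdsWithin_le_nhds (s := Ioi (0 : ℝ)))
    have l1 := (continuous_besselJ_one.tendsto 0).mono_left (nhdsWithin_le_nhds (s := Ioi (0 : ℝ)))
    have l2 : Tendsto (fun x : ℝ => x * neumannN 0 x) (𝓝[>] 0) (𝓝 0) := by
      have l3 : Tendsto (fun s : ℝ => s) (𝓝[>] 0) (𝓝 0) := nhdsWithin_le_nhds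
      have h := (l3.mul tendsto_neumannN_zero_sub_log).add
        (tendsto_log_mul_self.const_mul (2 / Real.pi))
      rw [zero_mul, mul_zero, add_zero] at h
      exact h.congr fun x => by ring
    have h := (l1.mul l2).sub (l0.mul tendsto_mul_neumannN_one)
    rw [besselJ_zero_zero] at h
    simp only [mul_zero, zero_sub, one_mul, neg_neg] at h
    exact h.congr fun x => by ring
  have := tendsto_nhds_unique (tendsto_const_nhds.congr' (by
    filter_upwards [self_mem_nhdsWithin] with x hx
    exact (hconst x hx).symm)) hlim
  linear_combination this

theorem wronskianForm_comp_sub (f g : Plane → ℂ) (a x : Plane) :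
    wronskianForm (fun x => f (x - a)) (fun x => g (x - a)) x = wronskianForm f g (x - a) := by
  simp only [wronskianForm, fderiv_comp_sub]

theorem smul_unitVec_ne_zero {R : ℝ} (hR : R ≠ 0) (θ : ℝ) : R • unitVec θ ≠ 0 := by
  intro h
  have := congrArg norm h
  rw [norm_smul, norm_unitVec, norm_zero, mul_one] at this
  exact hR (norm_eq_zero.1 this)

/-- With the singularity at the centre, `N_0` and its normal derivative are constant on the circle.
The mean value formulas evaluate the other factor, and the Wronskian of `J_0` and `N_0` collects the
result. -/
theorem integral_wronskianForm_center {k R : ℝ} (hk : 0 < k) (hR : 0 < R) (w : Plane) :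
    ∫ θ in (0)..(2 * Real.pi), wronskianForm (fun x => planeBessel k (x - w)) (planeNeumann k)
      (R • unitVec θ) (unitVec θ) = 4 * planeBessel k w / R := by
  have hpC : ContDiff ℝ 2 (planeBessel k) := (planeBessel_contDiff k).of_le two_le_infty
  have hp : ContDiff ℝ 2 (fun x => planeBessel k (x - w)) := hpC.comp (by fun_prop)
  have hlap : ∀ x ∈ Metric.ball (0 : Plane) (R + 1), Δ (fun x => planeBessel k (x - w)) x
      = -(k : ℂ) ^ 2 * planeBessel k (x - w) := fun x _ => by
    rw [laplacian_comp_sub, laplacian_planeBessel]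
  have m1 := circle_mean_value hp.contDiffOn hlap (r := R) ⟨hR.le, by linarith⟩
  have m2 := circle_flux_mean_value hp.contDiffOn hlap (r := R) ⟨hR, by linarith⟩
  have hw : planeBessel k (0 - w) = planeBessel k w := by simp [planeBessel]
  have e1 : ∀ θ, wronskianForm (fun x => planeBessel k (x - w)) (planeNeumann k)
      (R • unitVec θ) (unitVec θ) = planeBessel k (R • unitVec θ - w) * (-(k * neumannN 1 (k * R)))
        - neumannN 0 (k * R) * fderiv ℝ (fun x => planeBessel k (x - w)) (R • unitVec θ)
          (unitVec θ) := fun θ => by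
    have h1 : inner ℝ (R • unitVec θ) (unitVec θ) / R = 1 := by
      rw [inner_smul_left, real_inner_self_eq_norm_sq, norm_unitVec]
      simp [hR.ne']
    simp only [wronskianForm, sub_apply, smul_apply, smul_eq_mul]
    rw [fderiv_planeNeumann hk (smul_unitVec_ne_zero hR.ne' θ), planeNeumann,
      norm_smul_unitVec hR.le, h1]
    push_cast
    ring
  have c1 : Continuous fun θ => planeBessel k (R • unitVec θ - w) :=
    hpC.continuous.comp (by fun_prop)
  have c2 : Continuous fun θ => fderiv ℝ (fun x => planeBessel k (x - w)) (R • unitVec θ)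
      (unitVec θ) := by
    have := (hp.continuous_fderiv (by norm_num)).comp (f := fun θ => R • unitVec θ) (by fun_prop)
    simp only [Function.comp_def] at this
    fun_prop
  simp_rw [e1]
  have i1 : IntervalIntegrable (fun θ => planeBessel k (R • unitVec θ - w)
      * (-(k * neumannN 1 (k * R)) : ℂ)) volume 0 (2 * Real.pi) :=
    (c1.mul continuous_const).intervalIntegrable _ _
  have i2 : IntervalIntegrable (fun θ => (neumannN 0 (k * R) : ℂ) *
      fderiv ℝ (fun x => planeBessel k (x - w)) (R • unitVec θ) (unitVec θ)) volume 0
      (2 * Real.pi) := (continuous_const.mul c2).intervalIntegrable _ _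
  rw [intervalIntegral.integral_sub i1 i2, intervalIntegral.integral_mul_const,
    intervalIntegral.integral_const_mul, m1, m2, hw]
  have h := congrArg Complex.ofReal (bessel_wronskian (t := k * R) (by positivity))
  have hpi : (Real.pi : ℂ) ≠ 0 := by exact_mod_cast Real.pi_pos.ne'
  have hRc : (R : ℂ) ≠ 0 := by exact_mod_cast hR.ne'
  push_cast at h
  rw [eq_div_iff hRc]
  rw [eq_div_iff hpi] at h
  linear_combination 2 * planeBessel k w * h

/-- Green's identity for `J_0(k|x-y|)` and `N_0(k|x-z|)` on the circle of radius `R`. -/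
theorem integral_wronskianForm_bessel_neumann {k R : ℝ} (hk : 0 < k) (y : Plane)
    {z : Plane} (hz : z ∈ Metric.ball (0 : Plane) R) :
    ∫ θ in (0)..(2 * Real.pi), wronskianForm (fun x => planeBessel k (x - y))
      (fun x => planeNeumann k (x - z)) (R • unitVec θ) (unitVec θ)
      = 4 * planeBessel k (y - z) / R := by
  have hzR : ‖z‖ < R := mem_ball_zero_iff.1 hz
  have hR : 0 < R := (norm_nonneg z).trans_lt hzR
  have hpC : ContDiff ℝ 2 (planeBessel k) := (planeBessel_contDiff k).of_le two_le_infty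
  have hp : ContDiff ℝ 2 (fun x => planeBessel k (x - (y - z))) := hpC.comp (by fun_prop)
  -- In coordinates centred at `z` the circle has centre `-z`. It slides to centre `0` along `s •
  -- z`, from `s = -1` to `s = 0`; as long as `|s z| < R`, the circle does not meet the singularity
  -- at the origin.
  set I : Set ℝ := (fun s : ℝ => s • z) ⁻¹' Metric.ball (0 : Plane) R
  have hI : IsOpen I := Metric.isOpen_ball.preimage (by fun_prop)
  have hIc : IsPreconnected I := ((convex_ball (0 : Plane) R).is_linear_preimage
    (f := fun s : ℝ => s • z) ⟨fun a b => add_smul a b z, fun a b => by simp [mul_smul]⟩).isPreconnected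
  have h := integral_wronskianForm_translate (Ω := {0}ᶜ) (f := fun x => planeBessel k (x - (y - z)))
    (g := planeNeumann k) isOpen_compl_singleton hp.contDiffOn
    (fun x hx => ((planeNeumann_contDiffAt hk hx).of_le two_le_infty).contDiffWithinAt) (k := k)
    (fun x _ => by rw [laplacian_comp_sub, laplacian_planeBessel])
    (fun x hx => laplacian_planeNeumann hk hx) hR.ne' z hI hIc ?_ (s := -1) (t := 0) ?_ ?_
  · simp only [zero_smul, zero_add] at h
    rw [integral_wronskianForm_center hk hR] at h
    rw [← h]
    refine intervalIntegral.integral_congr fun θ _ => ?_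
    have e := wronskianForm_comp_sub (fun x => planeBessel k (x - (y - z))) (planeNeumann k) z
      (R • unitVec θ)
    have e2 : (fun x => planeBessel k (x - z - (y - z))) = fun x => planeBessel k (x - y) := by
      funext x; congr 1; abel
    have e3 : (-1 : ℝ) • z + R • unitVec θ = R • unitVec θ - z := by
      rw [neg_one_smul]; abel
    rw [e3, ← e, e2]
  · intro s hs θ h0
    have h1 : s • z = -(R • unitVec θ) := eq_neg_of_add_eq_zero_left h0
    have h2 : ‖s • z‖ < R := mem_ball_zero_iff.1 hs
    rw [h1, norm_neg, norm_smul_unitVec hR.le] at h2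
    exact lt_irrefl _ h2
  · simp only [I, mem_preimage, mem_ball_zero_iff, neg_one_smul, norm_neg]
    exact hzR
  · simp only [I, mem_preimage, mem_ball_zero_iff, zero_smul, norm_zero]
    exact hR

/-! ### Fourier coefficients and convolution on the circle -/

theorem eq_zero_of_integral_circleChar {C : ℝ → ℂ} (hc : Continuous C)
    (hp : Function.Periodic C (2 * Real.pi))
    (h : ∀ n, ∫ θ in (0)..(2 * Real.pi), circleChar n θ * C θ = 0) (θ : ℝ) : C θ = 0 := by
  have : Fact (0 < 2 * Real.pi) := ⟨Real.two_pi_pos⟩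
  let f : C(AddCircle (2 * Real.pi), ℂ) := ⟨hp.lift, continuous_coinduced_dom.2 hc⟩
  have hf : ∀ x : ℝ, f x = C x := fun x => rfl
  have hcoeff : ∀ n, fourierCoeff f n = 0 := fun n => by
    rw [fourierCoeff_eq_intervalIntegral f n 0, zero_add]
    have e : ∫ x in (0)..(2 * Real.pi), fourier (-n) (x : AddCircle (2 * Real.pi)) • f x
        = ∫ x in (0)..(2 * Real.pi), circleChar n x * C x := by
      refine intervalIntegral.integral_congr fun x _ => ?_
      simp only [hf, smul_eq_mul, fourier_coe_apply, circleChar]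
      congr 2
      have : (Real.pi : ℂ) ≠ 0 := by exact_mod_cast Real.pi_pos.ne'
      push_cast
      field_simp
    rw [e, h n, smul_zero]
  have hs : Summable (fourierCoeff f) := by
    rw [show fourierCoeff f = fun _ => 0 from funext hcoeff]
    exact summable_zero
  have h1 := has_pointwise_sum_fourier_series_of_summable hs (θ : AddCircle (2 * Real.pi))
  simp only [hcoeff, zero_smul] at h1
  rw [← hf]
  exact h1.unique hasSum_zero

theorem circle_integral_swap {F : ℝ → ℝ → ℂ} (hF : Continuous fun p : ℝ × ℝ => F p.1 p.2) {a b : ℝ}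
    (hab : a ≤ b) :
    ∫ x in a..b, ∫ y in a..b, F x y = ∫ y in a..b, ∫ x in a..b, F x y := by
  simp only [intervalIntegral.integral_of_le hab]
  refine integral_integral_swap ?_
  rw [Measure.prod_restrict]
  exact (hF.continuousOn.integrableOn_compact (isCompact_Icc.prod isCompact_Icc)).mono_set
    (prod_mono Ioc_subset_Icc_self Ioc_subset_Icc_self)

theorem integral_periodic_sub_left {h : ℝ → ℂ} (hp : Function.Periodic h (2 * Real.pi)) (α : ℝ) :
    ∫ θ in (0)..(2 * Real.pi), h (α - θ) = ∫ θ in (0)..(2 * Real.pi), h θ := by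
  rw [intervalIntegral.integral_comp_sub_left h]
  have := hp.intervalIntegral_add_eq (α - 2 * Real.pi) 0
  rw [sub_add_cancel, zero_add] at this
  rw [sub_zero, this]

theorem integral_periodic_sub_right {h : ℝ → ℂ} (hp : Function.Periodic h (2 * Real.pi)) (α : ℝ) :
    ∫ θ in (0)..(2 * Real.pi), h (θ - α) = ∫ θ in (0)..(2 * Real.pi), h θ := by
  rw [intervalIntegral.integral_comp_sub_right h]
  have := hp.intervalIntegral_add_eq (0 - α) 0
  rw [zero_add, zero_sub] at this
  rw [zero_sub, ← this]
  congr 1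
  ring

theorem circleChar_add (n : ℤ) (a b : ℝ) : circleChar n (a + b) = circleChar n a * circleChar n b := by
  rw [circleChar, circleChar, circleChar, ← Complex.exp_add]
  congr 1
  push_cast
  ring

theorem integral_circleChar_convolution {P Q : ℝ → ℂ} (hP : Continuous P) (hQ : Continuous Q)
    (hQp : Function.Periodic Q (2 * Real.pi)) (n : ℤ) :
    ∫ ψ in (0)..(2 * Real.pi), circleChar n ψ * ∫ θ in (0)..(2 * Real.pi), P θ * Q (ψ - θ)
      = (∫ θ in (0)..(2 * Real.pi), circleChar n θ * P θ)
        * ∫ θ in (0)..(2 * Real.pi), circleChar n θ * Q θ := by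
  simp_rw [← intervalIntegral.integral_const_mul]
  rw [circle_integral_swap (by fun_prop) Real.two_pi_pos.le, intervalIntegral.integral_const_mul,
    ← intervalIntegral.integral_mul_const]
  refine intervalIntegral.integral_congr fun θ _ => ?_
  have h := integral_periodic_sub_right (h := fun ψ => circleChar n ψ * Q ψ)
    (fun ψ => by simp only [circleChar_periodic n ψ, hQp ψ]) θ
  rw [← h, ← intervalIntegral.integral_const_mul]
  refine intervalIntegral.integral_congr fun ψ _ => ?_
  nth_rewrite 1 [← add_sub_cancel θ ψ]
  rw [circleChar_add]
  ring

theorem circle_convolution_eq {P Q P' Q' : ℝ → ℂ} (hP : Continuous P) (hQ : Continuous Q)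
    (hP' : Continuous P') (hQ' : Continuous Q')
    (hQp : Function.Periodic Q (2 * Real.pi))
    (hQp' : Function.Periodic Q' (2 * Real.pi))
    (h : ∀ n, (∫ θ in (0)..(2 * Real.pi), circleChar n θ * P θ)
        * (∫ θ in (0)..(2 * Real.pi), circleChar n θ * Q θ)
      = (∫ θ in (0)..(2 * Real.pi), circleChar n θ * P' θ)
        * ∫ θ in (0)..(2 * Real.pi), circleChar n θ * Q' θ) (ψ : ℝ) :
    ∫ θ in (0)..(2 * Real.pi), P θ * Q (ψ - θ) = ∫ θ in (0)..(2 * Real.pi), P' θ * Q' (ψ - θ) := by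
  have c1 : Continuous fun ψ => ∫ θ in (0)..(2 * Real.pi), P θ * Q (ψ - θ) :=
    intervalIntegral.continuous_parametric_intervalIntegral_of_continuous' (by fun_prop) _ _
  have c2 : Continuous fun ψ => ∫ θ in (0)..(2 * Real.pi), P' θ * Q' (ψ - θ) :=
    intervalIntegral.continuous_parametric_intervalIntegral_of_continuous' (by fun_prop) _ _
  refine sub_eq_zero.1 (eq_zero_of_integral_circleChar (C := fun ψ =>
    (∫ θ in (0)..(2 * Real.pi), P θ * Q (ψ - θ)) - ∫ θ in (0)..(2 * Real.pi), P' θ * Q' (ψ - θ))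
    (c1.sub c2) ?_ (fun n => ?_) ψ)
  · intro ψ
    simp only [add_sub_right_comm ψ, hQp _, hQp' _]
  · simp_rw [mul_sub]
    refine (intervalIntegral.integral_sub (((continuous_circleChar n).mul c1).intervalIntegrable _ _)
      (((continuous_circleChar n).mul c2).intervalIntegrable _ _)).trans ?_
    simp only [Pi.mul_apply]
    rw [integral_circleChar_convolution hP hQ hQp, integral_circleChar_convolution hP' hQ' hQp', h n,
      sub_self]

/-! ### Symmetry of the single layer pairing -/

theorem norm_circle_sub (R r θ α : ℝ) :
    ‖R • unitVec θ - r • unitVec α‖ ^ 2 = R ^ 2 + r ^ 2 - 2 * R * r * Real.cos (θ - α) := by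
  rw [EuclideanSpace.norm_sq_eq, Real.cos_sub]
  simp [Fin.sum_univ_two, unitVec]
  linear_combination R ^ 2 * Real.cos_sq_add_sin_sq θ + r ^ 2 * Real.cos_sq_add_sin_sq α

theorem norm_circle_sub_eq {R r θ α θ' α' : ℝ} (h : Real.cos (θ - α) = Real.cos (θ' - α')) :
    ‖R • unitVec θ - r • unitVec α‖ = ‖R • unitVec θ' - r • unitVec α'‖ := by
  rw [← sq_eq_sq₀ (norm_nonneg _) (norm_nonneg _), norm_circle_sub, norm_circle_sub, h]

theorem inner_circle_sub (R r θ α : ℝ) :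
    inner ℝ (R • unitVec θ - r • unitVec α) (unitVec θ) = R - r * Real.cos (θ - α) := by
  rw [Real.cos_sub]
  simp [unitVec, PiLp.inner_apply]
  linear_combination R * Real.cos_sq_add_sin_sq θ

theorem circle_sub_ne_zero {R r : ℝ} (hr : 0 ≤ r) (hrR : r < R) (θ α : ℝ) :
    R • unitVec θ - r • unitVec α ≠ 0 := by
  intro h
  have h1 := congrArg norm (sub_eq_zero.1 h)
  rw [norm_smul_unitVec (hr.trans hrR.le), norm_smul_unitVec hr] at h1
  exact hrR.ne' h1

theorem planeNeumann_circle_eq (k : ℝ) {R r θ α ψ : ℝ} (h : Real.cos (θ - α) = Real.cos ψ) :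
    planeNeumann k (R • unitVec θ - r • unitVec α)
      = planeNeumann k (r • unitVec ψ - R • unitVec 0) := by
  rw [planeNeumann, planeNeumann, norm_sub_rev (r • unitVec ψ),
    norm_circle_sub_eq (θ' := 0) (α' := ψ)]
  rw [h, zero_sub, Real.cos_neg]

theorem fderiv_planeBessel_circle_eq (k : ℝ) {R r θ α ψ : ℝ} (hr : 0 ≤ r) (hrR : r < R)
    (h : Real.cos (θ - α) = Real.cos ψ) :
    fderiv ℝ (planeBessel k) (R • unitVec θ - r • unitVec α) (unitVec θ)
      = fderiv ℝ (planeBessel k) (R • unitVec 0 - r • unitVec ψ) (unitVec 0) := by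
  have h' : Real.cos (θ - α) = Real.cos (0 - ψ) := by rw [h, zero_sub, Real.cos_neg]
  rw [fderiv_planeBessel k (circle_sub_ne_zero hr hrR θ α),
    fderiv_planeBessel k (circle_sub_ne_zero hr hrR 0 ψ), inner_circle_sub, inner_circle_sub,
    norm_circle_sub_eq h', h']

/-- As functions of `y` in the disc, `N_0(k|y-Re|)` and `J_0(k|y-xe|)` with `e = unitVec 0` both
solve the Helmholtz equation, so their modes at radii `r` and `s` are proportional, for every `x`.
Differentiation in `x` at `x = R` turns the second into the normal derivative of `J_0`. -/
theorem circleMode_neumann_bessel {k R : ℝ} (hk : 0 < k) (n : ℤ) {r s : ℝ} (hr : r ∈ Ico 0 R)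
    (hs : s ∈ Ico 0 R) :
    (∫ ψ in (0)..(2 * Real.pi), circleChar n ψ * planeNeumann k (r • unitVec ψ - R • unitVec 0))
      * (∫ ψ in (0)..(2 * Real.pi), circleChar n ψ *
        fderiv ℝ (planeBessel k) (R • unitVec 0 - s • unitVec ψ) (unitVec 0))
    = (∫ ψ in (0)..(2 * Real.pi), circleChar n ψ * planeNeumann k (s • unitVec ψ - R • unitVec 0))
      * (∫ ψ in (0)..(2 * Real.pi), circleChar n ψ *
        fderiv ℝ (planeBessel k) (R • unitVec 0 - r • unitVec ψ) (unitVec 0)) := by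
  have hR : 0 < R := hr.1.trans_lt hr.2
  have hpC : ContDiff ℝ 2 (planeBessel k) := (planeBessel_contDiff k).of_le two_le_infty
  have hball : ∀ y ∈ Metric.ball (0 : Plane) R, y - R • unitVec 0 ≠ 0 := fun y hy h => by
    have h1 := congrArg norm (sub_eq_zero.1 h)
    rw [norm_smul_unitVec hR.le] at h1
    rw [mem_ball_zero_iff] at hy
    exact hy.ne h1
  have hq : ContDiffOn ℝ 2 (fun y => planeNeumann k (y - R • unitVec 0)) (Metric.ball 0 R) :=
    fun y hy => (((planeNeumann_contDiffAt hk (hball y hy)).of_le two_le_infty).comp y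
      (f := fun y => y - R • unitVec 0) (by fun_prop)).contDiffWithinAt
  have hp : ∀ x : ℝ, ContDiff ℝ 2 (fun y => planeBessel k (y - x • unitVec 0)) := fun x =>
    hpC.comp (by fun_prop)
  have h1 : ∀ x : ℝ, circleMode n (fun y => planeNeumann k (y - R • unitVec 0)) r
      * circleMode n (fun y => planeBessel k (y - x • unitVec 0)) s
      = circleMode n (fun y => planeNeumann k (y - R • unitVec 0)) s
      * circleMode n (fun y => planeBessel k (y - x • unitVec 0)) r := fun x =>
    circleMode_proportional hq (hp x).contDiffOn
      (fun y hy => by rw [laplacian_comp_sub, laplacian_planeNeumann hk (hball y hy)])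
      (fun y _ => by rw [laplacian_comp_sub, laplacian_planeBessel]) n hr hs
  have hd : ∀ s : ℝ, HasDerivAt (fun x : ℝ =>
      circleMode n (fun y => planeBessel k (y - x • unitVec 0)) s)
      (∫ ψ in (0)..(2 * Real.pi), circleChar n ψ *
        fderiv ℝ (planeBessel k) (R • unitVec 0 - s • unitVec ψ) (unitVec 0)) R := fun s => by
    have e : ∀ x ψ : ℝ, planeBessel k (s • unitVec ψ - x • unitVec 0)
        = planeBessel k (x • unitVec 0 - s • unitVec ψ) := fun x ψ => by
      rw [planeBessel, planeBessel, norm_sub_rev]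
    simp only [circleMode, e]
    refine hasDerivAt_circle_integral (F' := fun x ψ => circleChar n ψ *
        fderiv ℝ (planeBessel k) (x • unitVec 0 - s • unitVec ψ) (unitVec 0)) isOpen_univ
        (mem_univ R) ?_ ?_ ?_ _ _
    · intro x _
      have := hpC.continuous
      fun_prop
    · have h2 : Continuous fun p : ℝ × ℝ => p.1 • unitVec 0 - s • unitVec p.2 := by fun_prop
      exact (((continuous_circleChar n).comp continuous_snd).mul
        (((hpC.continuous_fderiv (by norm_num)).comp h2).clm_apply continuous_const)).continuousOn
    · intro x _ ψ
      have h2 : HasDerivAt (fun y : ℝ => y • unitVec 0 - s • unitVec ψ) (unitVec 0) x := by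
        simpa using ((hasDerivAt_id x).smul_const (unitVec 0)).sub_const (s • unitVec ψ)
      have h3 := (hpC.differentiable (by norm_num)
        (x • unitVec 0 - s • unitVec ψ)).hasFDerivAt.comp_hasDerivAt x h2
      exact h3.const_mul _
  exact ((hd s).const_mul _).unique (((hd r).const_mul _).congr_of_eventuallyEq
    (Eventually.of_forall h1))

theorem continuous_circle_planeNeumann {k R r : ℝ} (hk : 0 < k) (hr : r ∈ Ico 0 R) :
    Continuous fun ψ => planeNeumann k (r • unitVec ψ - R • unitVec 0) := by
  refine continuous_iff_continuousAt.2 fun ψ => ?_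
  have h : r • unitVec ψ - R • unitVec 0 ≠ 0 := by
    rw [← neg_ne_zero, neg_sub]; exact circle_sub_ne_zero hr.1 hr.2 0 ψ
  exact ContinuousAt.comp (f := fun ψ => r • unitVec ψ - R • unitVec 0)
    (planeNeumann_contDiffAt hk h).continuousAt (by fun_prop)

theorem continuous_circle_fderiv_planeBessel (k R r : ℝ) :
    Continuous fun ψ => fderiv ℝ (planeBessel k) (R • unitVec 0 - r • unitVec ψ) (unitVec 0) := by
  have hpC : ContDiff ℝ 2 (planeBessel k) := (planeBessel_contDiff k).of_le two_le_infty
  have := hpC.continuous_fderiv (by norm_num)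
  fun_prop

theorem exists_polar (y : Plane) {R : ℝ} (hy : y ∈ Metric.ball (0 : Plane) R) :
    ∃ r ∈ Ico 0 R, ∃ α, y = r • unitVec α := by
  obtain ⟨α, _, h⟩ := exists_eq_smul_unitVec y
  exact ⟨‖y‖, ⟨norm_nonneg y, mem_ball_zero_iff.1 hy⟩, α, h⟩

/-- The pairing of `N_0(k|x-z|)` with the normal derivative of `J_0(k|x-y|)` on the circle of
radius `R` is symmetric in `y` and `z`. -/
theorem neumann_bessel_pairing_symm {k R : ℝ} (hk : 0 < k) {y z : Plane}
    (hy : y ∈ Metric.ball (0 : Plane) R) (hz : z ∈ Metric.ball (0 : Plane) R) :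
    ∫ θ in (0)..(2 * Real.pi), planeNeumann k (R • unitVec θ - z)
        * fderiv ℝ (planeBessel k) (R • unitVec θ - y) (unitVec θ)
      = ∫ θ in (0)..(2 * Real.pi), planeNeumann k (R • unitVec θ - y)
        * fderiv ℝ (planeBessel k) (R • unitVec θ - z) (unitVec θ) := by
  obtain ⟨r, hr, α, rfl⟩ := exists_polar y hy
  obtain ⟨s, hs, β, rfl⟩ := exists_polar z hz
  -- Distances between points of two concentric circles depend only on the cosine of the angle
  -- difference. Hence both pairings become convolutions on the circle at `α - β`, and equality can
  -- be tested on products of Fourier coefficients.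
  set Q : ℝ → ℝ → ℂ := fun r ψ => planeNeumann k (r • unitVec ψ - R • unitVec 0) with hQ
  set P : ℝ → ℝ → ℂ := fun r ψ =>
    fderiv ℝ (planeBessel k) (R • unitVec 0 - r • unitVec ψ) (unitVec 0) with hP
  have pQ : ∀ r, Function.Periodic (Q r) (2 * Real.pi) := fun r ψ => by
    simp only [hQ, unitVec_periodic ψ]
  have pP : ∀ r, Function.Periodic (P r) (2 * Real.pi) := fun r ψ => by
    simp only [hP, unitVec_periodic ψ]
  have e1 : ∫ θ in (0)..(2 * Real.pi), planeNeumann k (R • unitVec θ - s • unitVec β)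
        * fderiv ℝ (planeBessel k) (R • unitVec θ - r • unitVec α) (unitVec θ)
      = ∫ θ in (0)..(2 * Real.pi), P r θ * Q s (α - β - θ) := by
    have := integral_periodic_sub_left (h := fun θ => P r θ * Q s (α - β - θ))
      (fun θ => by simp only [pP r θ, ← sub_sub, (pQ s).sub_eq]) α
    rw [← this]
    refine intervalIntegral.integral_congr fun θ _ => ?_
    rw [mul_comm, planeNeumann_circle_eq k (ψ := α - β - (α - θ)) (by congr 1; ring),
      fderiv_planeBessel_circle_eq k (ψ := α - θ) hr.1 hr.2 (by rw [← Real.cos_neg]; congr 1; ring)]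
  have e2 : ∫ θ in (0)..(2 * Real.pi), planeNeumann k (R • unitVec θ - r • unitVec α)
        * fderiv ℝ (planeBessel k) (R • unitVec θ - s • unitVec β) (unitVec θ)
      = ∫ θ in (0)..(2 * Real.pi), Q r θ * P s (α - β - θ) := by
    have := integral_periodic_sub_left (h := fun θ => Q r θ * P s (α - β - θ))
      (fun θ => by simp only [pQ r θ, ← sub_sub, (pP s).sub_eq]) α
    rw [← this]
    refine intervalIntegral.integral_congr fun θ _ => ?_
    rw [fderiv_planeBessel_circle_eq k (ψ := α - β - (α - θ)) hs.1 hs.2 (by congr 1; ring),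
      planeNeumann_circle_eq k (ψ := α - θ) (by rw [← Real.cos_neg]; congr 1; ring)]
  rw [e1, e2]
  refine circle_convolution_eq (continuous_circle_fderiv_planeBessel k R r)
    (continuous_circle_planeNeumann hk hs) (continuous_circle_planeNeumann hk hr)
    (continuous_circle_fderiv_planeBessel k R s) (pQ s) (pP s) (fun n => ?_) _
  rw [circleMode_neumann_bessel hk n hr hs]
  ring

/-- The identity behind the inversion formula. -/
theorem bessel_neumann_kernel {k R : ℝ} (hk : 0 < k) {y z : Plane}
    (hy : y ∈ Metric.ball (0 : Plane) R) (hz : z ∈ Metric.ball (0 : Plane) R) :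
    ∫ θ in (0)..(2 * Real.pi),
      (planeBessel k (R • unitVec θ - y)
          * fderiv ℝ (planeNeumann k) (R • unitVec θ - z) (unitVec θ)
        - planeNeumann k (R • unitVec θ - y)
          * fderiv ℝ (planeBessel k) (R • unitVec θ - z) (unitVec θ))
      = 4 * planeBessel k (y - z) / R := by
  have hpC : ContDiff ℝ 2 (planeBessel k) := (planeBessel_contDiff k).of_le two_le_infty
  have cp := hpC.continuous
  have cp' := hpC.continuous_fderiv (by norm_num)
  have hne : ∀ z ∈ Metric.ball (0 : Plane) R, ∀ θ, R • unitVec θ - z ≠ 0 := fun z hz θ => by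
    obtain ⟨s, hs, β, rfl⟩ := exists_polar z hz
    exact circle_sub_ne_zero hs.1 hs.2 θ β
  have cq : ∀ z ∈ Metric.ball (0 : Plane) R,
      Continuous fun θ => planeNeumann k (R • unitVec θ - z) := fun z hz =>
    continuous_iff_continuousAt.2 fun θ => ContinuousAt.comp (f := fun θ => R • unitVec θ - z)
      (planeNeumann_contDiffAt hk (hne z hz θ)).continuousAt (by fun_prop)
  have cq' : Continuous fun θ => fderiv ℝ (planeNeumann k) (R • unitVec θ - z) :=
    continuous_iff_continuousAt.2 fun θ => ContinuousAt.comp (f := fun θ => R • unitVec θ - z)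
      ((planeNeumann_contDiffAt hk (hne z hz θ)).fderiv_right (m := 0)
        (by simp)).continuousAt (by fun_prop)
  have cqz := cq z hz
  have cqy := cq y hy
  have h := integral_wronskianForm_bessel_neumann hk y hz
  simp only [wronskianForm, fderiv_comp_sub, sub_apply, smul_apply, smul_eq_mul] at h
  rw [← h]
  have i1 : IntervalIntegrable (fun θ => planeBessel k (R • unitVec θ - y)
      * fderiv ℝ (planeNeumann k) (R • unitVec θ - z) (unitVec θ)) volume 0 (2 * Real.pi) :=
    Continuous.intervalIntegrable (by fun_prop) _ _
  have i2 : IntervalIntegrable (fun θ => planeNeumann k (R • unitVec θ - y)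
      * fderiv ℝ (planeBessel k) (R • unitVec θ - z) (unitVec θ)) volume 0 (2 * Real.pi) :=
    Continuous.intervalIntegrable (by fun_prop) _ _
  have i3 : IntervalIntegrable (fun θ => planeNeumann k (R • unitVec θ - z)
      * fderiv ℝ (planeBessel k) (R • unitVec θ - y) (unitVec θ)) volume 0 (2 * Real.pi) :=
    Continuous.intervalIntegrable (by fun_prop) _ _
  rw [intervalIntegral.integral_sub i1 i2, intervalIntegral.integral_sub i1 i3,
    neumann_bessel_pairing_symm hk hy hz]

/-! ### Polar coordinates on the Euclidean plane -/

/-- The measurable identification of `ℝ × ℝ` with the Euclidean plane. -/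
noncomputable def planeEquiv : ℝ × ℝ ≃ᵐ Plane :=
  (MeasurableEquiv.finTwoArrow (α := ℝ)).symm.trans (MeasurableEquiv.toLp 2 (Fin 2 → ℝ))

theorem planeEquiv_measurePreserving : MeasurePreserving planeEquiv :=
  ((volume_preserving_finTwoArrow ℝ).symm _).trans (PiLp.volume_preserving_toLp (Fin 2))

theorem planeEquiv_polarCoord_symm (p : ℝ × ℝ) :
    planeEquiv (polarCoord.symm p) = p.1 • unitVec p.2 := by
  ext i
  fin_cases i <;> simp [planeEquiv, unitVec, polarCoord]

section

variable {E : Type*} [NormedAddCommGroup E] [NormedSpace ℝ E]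

theorem integrableOn_polar_iff (f : Plane → E) :
    IntegrableOn (fun p : ℝ × ℝ => p.1 • f (p.1 • unitVec p.2)) (Ioi 0 ×ˢ Ioo (-Real.pi) Real.pi)
      ↔ Integrable f := by
  rw [← planeEquiv_measurePreserving.integrable_comp_emb planeEquiv.measurableEmbedding,
    ← integrableOn_univ, ← integrableOn_congr_set_ae polarCoord_source_ae_eq_univ,
    ← polarCoord.symm_image_target_eq_source,
    integrableOn_image_iff_integrableOn_abs_det_fderiv_smul volume polarCoord.open_target.measurableSet
      (fun p _ => (hasFDerivAt_polarCoord_symm p).hasFDerivWithinAt) polarCoord.symm.injOn]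
  refine integrableOn_congr_fun (fun p hp => ?_) polarCoord.open_target.measurableSet
  rw [det_fderivPolarCoordSymm, abs_of_pos hp.1, Function.comp, planeEquiv_polarCoord_symm]

theorem integral_polar_prod (f : Plane → E) :
    ∫ p in Ioi (0 : ℝ) ×ˢ Ioo (-Real.pi) Real.pi, p.1 • f (p.1 • unitVec p.2) = ∫ x, f x := by
  rw [← planeEquiv_measurePreserving.integral_comp planeEquiv.measurableEmbedding,
    ← integral_comp_polarCoord_symm]
  simp only [planeEquiv_polarCoord_symm]
  rfl

theorem integral_circle_shift (f : Plane → E) (r : ℝ) :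
    ∫ θ in Ioo (-Real.pi) Real.pi, f (r • unitVec θ)
      = ∫ θ in (0)..(2 * Real.pi), f (r • unitVec θ) := by
  have h : Function.Periodic (fun θ => f (r • unitVec θ)) (2 * Real.pi) := fun θ => by
    simp only [unitVec_periodic θ]
  have h1 := h.intervalIntegral_add_eq (-Real.pi) 0
  rw [← integral_Ioc_eq_integral_Ioo, ← intervalIntegral.integral_of_le (by linarith [Real.pi_pos])]
  rw [zero_add] at h1
  rw [← h1]
  congr 1
  ring

theorem integral_polar {f : Plane → E} (hf : Integrable f) :
    ∫ x, f x = ∫ r in Ioi (0 : ℝ), r • ∫ θ in (0)..(2 * Real.pi), f (r • unitVec θ) := by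
  have h := (integrableOn_polar_iff f).2 hf
  rw [← integral_polar_prod]
  rw [Measure.volume_eq_prod] at h ⊢
  rw [setIntegral_prod _ h]
  refine setIntegral_congr_fun measurableSet_Ioi fun r _ => ?_
  simp only
  rw [integral_smul, integral_circle_shift]

theorem integrableOn_norm_rpow_ball {p : ℝ} (hp : -2 < p) (ρ : ℝ) :
    IntegrableOn (fun x : Plane => ‖x‖ ^ p) (Metric.ball 0 ρ) := by
  rw [integrableOn_fun_norm_addHaar (volume : Measure Plane) (f := fun y => y ^ p)]
  have h : IntegrableOn (fun y : ℝ => y ^ (p + 1)) (Ioo 0 ρ) := by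
    rcases le_or_gt ρ 0 with h | h
    · simp [h]
    · have := (intervalIntegral.intervalIntegrable_rpow' (r := p + 1) (by linarith) (a := 0) (b := ρ))
      rw [intervalIntegrable_iff_integrableOn_Ioc_of_le h.le] at this
      exact this.mono_set Ioo_subset_Ioc_self
  refine h.congr_fun (fun y hy => ?_) measurableSet_Ioo
  simp only [finrank_euclideanSpace, Fintype.card_fin, smul_eq_mul]
  rw [Real.rpow_add hy.1, Real.rpow_one, Nat.add_one_sub_one, pow_one, mul_comm]

theorem integral_inv_norm_ball {ρ : ℝ} (hρ : 0 ≤ ρ) :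
    ∫ x in Metric.ball (0 : Plane) ρ, ‖x‖⁻¹ = 2 * Real.pi * ρ := by
  have hi := integrableOn_norm_rpow_ball (p := -1) (by norm_num) ρ
  simp only [Real.rpow_neg_one] at hi
  rw [← integral_indicator measurableSet_ball,
    integral_polar (hi.integrable_indicator measurableSet_ball)]
  have e : ∀ r ∈ Ioi (0 : ℝ), (r • ∫ θ in (0)..(2 * Real.pi),
      (Metric.ball (0 : Plane) ρ).indicator (fun x => ‖x‖⁻¹) (r • unitVec θ))
      = (Ioo 0 ρ).indicator (fun _ => 2 * Real.pi) r := fun r hr => by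
    have hr' : (0 : ℝ) < r := hr
    have : ∀ θ, (Metric.ball (0 : Plane) ρ).indicator (fun x => ‖x‖⁻¹) (r • unitVec θ)
        = (Ioo 0 ρ).indicator (fun r => r⁻¹) r := fun θ => by
      by_cases h : r < ρ
      · rw [indicator_of_mem, indicator_of_mem (show r ∈ Ioo 0 ρ from ⟨hr', h⟩), norm_smul_unitVec hr'.le]
        rwa [mem_ball_zero_iff, norm_smul_unitVec hr'.le]
      · rw [indicator_of_notMem, indicator_of_notMem fun h' => h h'.2]
        rwa [mem_ball_zero_iff, norm_smul_unitVec hr'.le]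
    simp only [this, intervalIntegral.integral_const, smul_eq_mul, sub_zero]
    by_cases h : r < ρ
    · rw [indicator_of_mem (show r ∈ Ioo 0 ρ from ⟨hr', h⟩), indicator_of_mem (show r ∈ Ioo 0 ρ from ⟨hr', h⟩)]
      field_simp
    · rw [indicator_of_notMem fun h' => h h'.2, indicator_of_notMem fun h' => h h'.2]
      simp
  rw [setIntegral_congr_fun measurableSet_Ioi e, setIntegral_indicator measurableSet_Ioo,
    setIntegral_const, inter_eq_right.2 Ioo_subset_Ioi_self]
  simp [hρ]
  ring

end

/-! ### The radiating fundamental solution -/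

/-- The radiating fundamental solution `(i/4) H_0(k|x|)` of the Helmholtz equation. -/
noncomputable def radiatingKernel (k : ℝ) (x : Plane) : ℂ :=
  Complex.I / 4 * hankel 0 (k * ‖x‖)

theorem radiatingKernel_contDiffAt {k : ℝ} (hk : 0 < k) {x : Plane} (hx : x ≠ 0) :
    ContDiffAt ℝ ∞ (radiatingKernel k) x :=
  contDiffAt_const.mul ((planeBessel_contDiff k).contDiffAt.add
    ((planeNeumann_contDiffAt hk hx).mul contDiffAt_const))

theorem fderiv_radiatingKernel {k : ℝ} (hk : 0 < k) {x : Plane} (hx : x ≠ 0) (v : Plane) :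
    fderiv ℝ (radiatingKernel k) x v
      = -(Complex.I / 4 * (k * (inner ℝ x v / ‖x‖ : ℝ) * hankel 1 (k * ‖x‖))) := by
  have h1 := ((planeBessel_contDiff k).differentiable (by simp) x).hasFDerivAt
  have h2 := ((planeNeumann_contDiffAt hk hx).differentiableAt (by simp)).hasFDerivAt
  have h3 := (h1.add (h2.mul_const Complex.I)).const_mul (Complex.I / 4)
  have h4 : fderiv ℝ (radiatingKernel k) x = _ := h3.fderiv
  rw [h4]
  simp only [smul_apply, add_apply, smul_eq_mul]
  rw [fderiv_planeBessel k hx, fderiv_planeNeumann hk hx, hankel]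
  push_cast
  ring

theorem aestronglyMeasurable_radiatingKernel {k : ℝ} (hk : 0 < k) :
    AEStronglyMeasurable (radiatingKernel k) volume := by
  rw [← restrict_compl_singleton (μ := (volume : Measure Plane)) 0]
  exact ContinuousOn.aestronglyMeasurable (fun x hx =>
    (radiatingKernel_contDiffAt hk hx).continuousAt.continuousWithinAt)
    (measurableSet_singleton _).compl

theorem exists_norm_radiatingKernel_le :
    ∃ C : ℝ, 0 ≤ C ∧ ∀ k : ℝ, 0 < k → ∀ x : Plane, x ≠ 0 →
      ‖radiatingKernel k x‖ ≤ C * (k * ‖x‖) ^ (-1 / 2 : ℝ) := by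
  obtain ⟨C, hC, h⟩ := exists_norm_hankel_zero_le
  refine ⟨C, hC, fun k hk x hx => ?_⟩
  have := h (k * ‖x‖) (mul_pos hk (norm_pos_iff.2 hx))
  rw [radiatingKernel, norm_mul]
  have e : ‖(Complex.I / 4 : ℂ)‖ ≤ 1 := by simp; norm_num
  calc _ ≤ 1 * ‖hankel 0 (k * ‖x‖)‖ := by gcongr
    _ ≤ _ := by rw [one_mul]; exact this

theorem integrableOn_radiatingKernel {k : ℝ} (hk : 0 < k) (ρ : ℝ) :
    IntegrableOn (radiatingKernel k) (Metric.ball 0 ρ) := by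
  obtain ⟨C, hC, h⟩ := exists_norm_radiatingKernel_le
  have h1 := (integrableOn_norm_rpow_ball (p := -1 / 2) (by norm_num) ρ).const_mul
    (C * k ^ (-1 / 2 : ℝ))
  refine h1.mono' (aestronglyMeasurable_radiatingKernel hk).restrict ?_
  have h0 : ∀ᵐ x : Plane, x ≠ 0 := by simp [ae_iff]
  filter_upwards [ae_restrict_of_ae h0] with x hx
  refine (h k hk x hx).trans (le_of_eq ?_)
  rw [Real.mul_rpow hk.le (norm_nonneg _)]
  ring

theorem integrable_radiatingKernel_mul {k : ℝ} (hk : 0 < k) {g : Plane → ℂ} (hg : Continuous g)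
    (hc : HasCompactSupport g) : Integrable fun x => radiatingKernel k x * g x := by
  obtain ⟨ρ, hρ⟩ := hc.isBounded.subset_ball 0
  obtain ⟨C, hC⟩ := hg.bounded_above_of_compact_support hc
  have h1 : IntegrableOn (fun x => radiatingKernel k x * g x) (Metric.ball 0 ρ) :=
    (integrableOn_radiatingKernel hk ρ).mul_bdd hg.aestronglyMeasurable.restrict
      (Eventually.of_forall hC)
  refine (integrableOn_iff_integrable_of_support_subset fun x hx => ?_).1 h1
  refine hρ (subset_tsupport _ fun h => hx ?_)
  simp [h]

theorem circleFluxMode_norm_le {f : Plane → ℂ} {M : ℝ} (hM : ∀ x, ‖fderiv ℝ f x‖ ≤ M) (n : ℤ)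
    {r : ℝ} (hr : 0 ≤ r) : ‖circleFluxMode n f r‖ ≤ 2 * Real.pi * M * r := by
  have h := intervalIntegral.norm_integral_le_of_norm_le_const (a := 0) (b := 2 * Real.pi)
    (f := fun θ => circleChar n θ * (r * fderiv ℝ f (r • unitVec θ) (unitVec θ))) (C := r * M)
    fun θ _ => by
      rw [norm_mul, norm_circleChar, one_mul, norm_mul, Complex.norm_real, Real.norm_of_nonneg hr]
      gcongr
      refine (ContinuousLinearMap.le_opNorm _ _).trans ?_
      rw [norm_unitVec, mul_one]
      exact hM _
  rw [sub_zero, abs_of_pos Real.two_pi_pos] at h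
  exact h.trans (le_of_eq (by ring))

theorem tendsto_mul_hankel_one :
    Tendsto (fun t : ℝ => (t : ℂ) * hankel 1 t) (𝓝[>] 0) (𝓝 (-(2 / Real.pi) * Complex.I)) := by
  have h1 : Tendsto (fun t : ℝ => t * besselJ 1 t) (𝓝[>] 0) (𝓝 (0 * besselJ 1 0)) :=
    ((continuous_id.mul continuous_besselJ_one).tendsto 0).mono_left nhdsWithin_le_nhds
  rw [zero_mul] at h1
  have h2 := ((Complex.continuous_ofReal.tendsto _).comp h1).add
    (((Complex.continuous_ofReal.tendsto _).comp tendsto_mul_neumannN_one).mul_const Complex.I)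
  refine (h2.congr fun t => ?_).trans_eq ?_
  · simp [hankel]; ring
  · simp

/-- Green's identity in one variable: the expression is `r (Φ ∂_r m - m ∂_r Φ)` with `m` the mode of
order zero of `f`, written with `H_0' = -H_1`. The terms without a Laplacian cancel by the Bessel
equation. -/
theorem radiatingKernel_flux_hasDerivAt {k : ℝ} (hk : 0 < k) {f : Plane → ℂ} (hf : ContDiff ℝ 2 f)
    {r : ℝ} (hr : 0 < r) :
    HasDerivAt (fun r : ℝ => Complex.I / 4 * (hankel 0 (k * r) * circleFluxMode 0 f r
        + ((k * r : ℝ) : ℂ) * hankel 1 (k * r) * circleMode 0 f r))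
      (r * (Complex.I / 4 * hankel 0 (k * r)
        * (circleMode 0 (Δ f) r + k ^ 2 * circleMode 0 f r))) r := by
  have hr' : r ∈ Ioo 0 (r + 1) := ⟨hr, by linarith⟩
  have hlin : HasDerivAt (fun r : ℝ => k * r) k r := by
    simpa using (hasDerivAt_id r).const_mul k
  have h0 := (hankel_zero_hasDerivAt (mul_pos hk hr)).scomp r hlin
  have h1 := (mul_hankel_one_hasDerivAt (mul_pos hk hr)).scomp r hlin
  have hA := circleFluxMode_hasDerivAt hf.contDiffOn 0 hr'
  have ha := circleMode_hasDerivAt hf.contDiffOn 0 hr'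
  have hrc : (r : ℂ) ≠ 0 := by exact_mod_cast hr.ne'
  refine (((h0.mul hA).add (h1.mul ha)).const_mul (Complex.I / 4)).congr_deriv ?_
  simp only [Complex.real_smul, Function.comp]
  push_cast
  field_simp
  ring

theorem continuous_laplacian {F : Type*} [NormedAddCommGroup F] [NormedSpace ℝ F] {f : Plane → F}
    (hf : ContDiff ℝ 2 f) : Continuous (Δ f) := by
  rw [show Δ f = fun x => _ from funext fun x => laplacian_eq_sum_fderiv f x]
  have h1 : ContDiff ℝ 1 (fderiv ℝ f) := hf.fderiv_right (by norm_num)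
  have h2 := h1.continuous_fderiv (by norm_num)
  fun_prop

theorem HasCompactSupport.laplacian {F : Type*} [NormedAddCommGroup F] [NormedSpace ℝ F]
    {f : Plane → F} (hc : HasCompactSupport f) :
    HasCompactSupport (Δ f) := by
  rw [show Δ f = fun x => _ from funext fun x => laplacian_eq_sum_fderiv f x]
  refine (hc.fderiv ℝ).fderiv ℝ |>.comp_left
    (g := fun B : Plane →L[ℝ] Plane →L[ℝ] F => ∑ i, B (EuclideanSpace.single i 1)
      (EuclideanSpace.single i 1)) ?_
  simp

/-- The first term is `O(r^(1/2))`, since the flux of `f` is `O(r)`. In the second, `t H_1(t) →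
-2i/π`, and `(i/4)(-2i/π)(2π) = 1` explains the normalisation `i/4`. -/
theorem tendsto_radiatingKernel_flux {k : ℝ} (hk : 0 < k) {f : Plane → ℂ} (hf : ContDiff ℝ 2 f)
    (hc : HasCompactSupport f) :
    Tendsto (fun r : ℝ => Complex.I / 4 * (hankel 0 (k * r) * circleFluxMode 0 f r
        + ((k * r : ℝ) : ℂ) * hankel 1 (k * r) * circleMode 0 f r)) (𝓝[>] 0) (𝓝 (f 0)) := by
  obtain ⟨M, hM⟩ := (hf.continuous_fderiv (by norm_num)).bounded_above_of_compact_support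
    (hc.fderiv ℝ)
  have hM0 : 0 ≤ M := (norm_nonneg _).trans (hM 0)
  obtain ⟨C, hC, hH⟩ := exists_norm_hankel_zero_le
  have t1 : Tendsto (fun r : ℝ => hankel 0 (k * r) * circleFluxMode 0 f r) (𝓝[>] 0) (𝓝 0) := by
    refine squeeze_zero_norm' (a := fun r => C * k ^ (-1 / 2 : ℝ) * (2 * Real.pi * M)
      * r ^ (1 / 2 : ℝ)) ?_ ?_
    · filter_upwards [self_mem_nhdsWithin] with r hr
      have hr' : (0 : ℝ) < r := hr
      rw [norm_mul]
      calc _ ≤ (C * (k * r) ^ (-1 / 2 : ℝ)) * (2 * Real.pi * M * r) :=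
            mul_le_mul (hH _ (mul_pos hk hr')) (circleFluxMode_norm_le hM 0 hr'.le)
              (norm_nonneg _) (by positivity)
        _ = _ := by
            rw [Real.mul_rpow hk.le hr'.le, show (1 / 2 : ℝ) = -1 / 2 + 1 by norm_num,
              Real.rpow_add_one hr'.ne']
            ring
    · have := (Real.continuousAt_rpow_const 0 (1 / 2 : ℝ) (Or.inr (by norm_num))).tendsto.mono_left
        (nhdsWithin_le_nhds (s := Ioi 0))
      rw [Real.zero_rpow (by norm_num)] at this
      simpa using this.const_mul (C * k ^ (-1 / 2 : ℝ) * (2 * Real.pi * M))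
  have hkr : Tendsto (fun r : ℝ => k * r) (𝓝[>] 0) (𝓝[>] 0) := by
    refine tendsto_nhdsWithin_iff.2 ⟨?_, ?_⟩
    · have : Tendsto (fun r : ℝ => k * r) (𝓝 0) (𝓝 (k * 0)) :=
        Continuous.tendsto (by fun_prop) 0
      rw [mul_zero] at this
      exact this.mono_left nhdsWithin_le_nhds
    · filter_upwards [self_mem_nhdsWithin] with r hr using mul_pos hk hr
  have t2 := (tendsto_mul_hankel_one.comp hkr).mul
    (tendsto_circleMode_zero one_pos hf.continuous.continuousOn 0)
  have t3 := (t1.add t2).const_mul (Complex.I / 4)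
  refine t3.trans_eq ?_
  rw [circleMode_zero_apply]
  simp only [circleChar_zero, intervalIntegral.integral_const, sub_zero, Complex.real_smul]
  have : (Real.pi : ℂ) ≠ 0 := by exact_mod_cast Real.pi_ne_zero
  congr 1
  push_cast
  field_simp
  linear_combination -f 0 * 4 * Complex.I_sq

theorem integral_Ioi_eq_sub_of_tendsto {F F' : ℝ → ℂ} {a b : ℂ} {c : ℝ}
    (hd : ∀ r ∈ Ioi c, HasDerivAt F (F' r) r) (hi : IntegrableOn F' (Ioi c))
    (ha : Tendsto F (𝓝[>] c) (𝓝 a)) (hb : Tendsto F atTop (𝓝 b)) :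
    ∫ r in Ioi c, F' r = b - a := by
  have key := integral_Ioi_deriv_mul_eq_sub (v := fun _ => (1 : ℂ)) (v' := fun _ => 0)
    hd (fun r _ => hasDerivAt_const r 1)
    (by simpa [Pi.mul_def, Pi.add_def] using hi) (by simpa [Pi.mul_def] using ha)
    (by simpa [Pi.mul_def] using hb)
  simpa using key

/-- `(i/4) H_0(k|x|)` is a fundamental solution of the Helmholtz equation. -/
theorem integral_radiatingKernel_mul_laplacian {k : ℝ} (hk : 0 < k) {f : Plane → ℂ}
    (hf : ContDiff ℝ 2 f) (hc : HasCompactSupport f) :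
    ∫ x, radiatingKernel k x * (Δ f x + k ^ 2 * f x) = -f 0 := by
  have hlap := continuous_laplacian hf
  have hfc := hf.continuous
  have hcs : HasCompactSupport fun x => Δ f x + k ^ 2 * f x :=
    HasCompactSupport.add (f := Δ f) (f' := fun x => k ^ 2 * f x) hc.laplacian hc.mul_left
  have hi := integrable_radiatingKernel_mul hk (g := fun x => Δ f x + k ^ 2 * f x) (by fun_prop)
    hcs
  obtain ⟨ρ, hρ⟩ := hc.isBounded.subset_ball 0
  have hmode : ∀ r ∈ Ioi (0 : ℝ), (r • ∫ θ in (0)..(2 * Real.pi), radiatingKernel k (r • unitVec θ)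
      * (Δ f (r • unitVec θ) + k ^ 2 * f (r • unitVec θ)))
      = r * (Complex.I / 4 * hankel 0 (k * r)
        * (circleMode 0 (Δ f) r + k ^ 2 * circleMode 0 f r)) := fun r hr => by
    have hr' : (0 : ℝ) < r := hr
    simp only [radiatingKernel, norm_smul_unitVec hr'.le, circleMode, circleChar_zero, one_mul]
    rw [intervalIntegral.integral_const_mul, intervalIntegral.integral_add
      (Continuous.intervalIntegrable (by fun_prop) _ _)
      (Continuous.intervalIntegrable (by fun_prop) _ _), intervalIntegral.integral_const_mul,
      Complex.real_smul]
  have hint : IntegrableOn (fun r : ℝ => r * (Complex.I / 4 * hankel 0 (k * r)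
        * (circleMode 0 (Δ f) r + k ^ 2 * circleMode 0 f r))) (Ioi 0) := by
    have h := (integrableOn_polar_iff _).2 hi
    rw [IntegrableOn, Measure.volume_eq_prod, ← Measure.prod_restrict] at h
    refine IntegrableOn.congr_fun h.integral_prod_left (fun r hr => ?_) measurableSet_Ioi
    simp only
    rw [← hmode r hr, integral_smul, integral_circle_shift (fun x => radiatingKernel k x
      * (Δ f x + k ^ 2 * f x))]
  rw [integral_polar hi, setIntegral_congr_fun measurableSet_Ioi hmode]
  have hzero := tendsto_radiatingKernel_flux hk hf hc
  have hinf : Tendsto (fun r : ℝ => Complex.I / 4 * (hankel 0 (k * r) * circleFluxMode 0 f r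
        + ((k * r : ℝ) : ℂ) * hankel 1 (k * r) * circleMode 0 f r)) atTop (𝓝 0) := by
    refine tendsto_const_nhds.congr' ?_
    filter_upwards [eventually_ge_atTop ρ, eventually_ge_atTop 0] with r hr hr0
    have hout : ∀ θ, r • unitVec θ ∉ tsupport f := fun θ h => by
      have := hρ h
      rw [mem_ball_zero_iff, norm_smul_unitVec hr0] at this
      exact this.not_ge hr
    have e1 : circleMode 0 f r = 0 := by
      simp [circleMode, image_eq_zero_of_notMem_tsupport (hout _)]
    have e2 : circleFluxMode 0 f r = 0 := by
      simp [circleFluxMode, image_eq_zero_of_notMem_tsupport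
        (fun h => hout _ (tsupport_fderiv_subset ℝ h))]
    rw [e1, e2]
    simp
  rw [integral_Ioi_eq_sub_of_tendsto (fun r hr => radiatingKernel_flux_hasDerivAt hk hf hr) hint
    hzero hinf, zero_sub]

open scoped Convolution

/-! ### Mollification of distributional solutions -/

/-- The convolution of a real kernel with a complex function. -/
noncomputable def mollify (η : Plane → ℝ) (v : Plane → ℂ) : Plane → ℂ :=
  v ⋆[(ContinuousLinearMap.lsmul ℝ ℝ).flip, volume] η

theorem mollify_eq_lsmul (η : Plane → ℝ) (v : Plane → ℂ) :
    mollify η v = η ⋆[ContinuousLinearMap.lsmul ℝ ℝ, volume] v :=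
  convolution_flip _

theorem mollify_apply (η : Plane → ℝ) (v : Plane → ℂ) (x : Plane) :
    mollify η v x = ∫ y, η (x - y) • v y := rfl

theorem mollify_apply_sub (η : Plane → ℝ) (v : Plane → ℂ) (x : Plane) :
    mollify η v x = ∫ y, η y • v (x - y) := by
  rw [mollify_eq_lsmul, convolution_lsmul]

theorem mollify_contDiff {η : Plane → ℝ} {v : Plane → ℂ} (hη : ContDiff ℝ ∞ η)
    (hc : HasCompactSupport η) (hv : LocallyIntegrable v volume) : ContDiff ℝ ∞ (mollify η v) :=
  hc.contDiff_convolution_right _ hv hη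

theorem fderiv_mollify {η : Plane → ℝ} {v : Plane → ℂ} (hη : ContDiff ℝ ∞ η)
    (hc : HasCompactSupport η) (hv : LocallyIntegrable v volume) (x e : Plane) :
    fderiv ℝ (mollify η v) x e = mollify (fun y => fderiv ℝ η y e) v x := by
  have h := (hc.hasFDerivAt_convolution_right (ContinuousLinearMap.lsmul ℝ ℝ (E := ℂ)).flip hv
    (hη.of_le (by simp)) x).fderiv
  rw [mollify, h, convolution_precompR_apply _ hv (hc.fderiv ℝ) (hη.continuous_fderiv (by simp))]
  rfl

theorem laplacian_mollify {η : Plane → ℝ} {v : Plane → ℂ} (hη : ContDiff ℝ ∞ η)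
    (hc : HasCompactSupport η) (hv : LocallyIntegrable v volume) (x : Plane) :
    Δ (mollify η v) x = mollify (Δ η) v x := by
  have hη' : ∀ e, ContDiff ℝ ∞ fun y => fderiv ℝ η y e := fun e =>
    (hη.fderiv_right (m := ∞) (by simp)).clm_apply contDiff_const
  have hc' : ∀ e, HasCompactSupport fun y => fderiv ℝ η y e := fun e => hc.fderiv_apply ℝ e
  have hη2 : ∀ e e', Continuous fun y => fderiv ℝ (fderiv ℝ η) y e e' := fun e e' => by
    have := (hη.fderiv_right (m := ∞) (by simp)).continuous_fderiv (by simp)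
    fun_prop
  have hs : ∀ e y, fderiv ℝ (fun y => fderiv ℝ η y e) y e = fderiv ℝ (fderiv ℝ η) y e e := fun e y => by
    have hd := ((hη.fderiv_right (m := ∞) (by simp)).differentiable (by simp) y).hasFDerivAt
    rw [(hd.clm_apply (hasFDerivAt_const e y)).fderiv]
    simp
  have h2 : ∀ e, fderiv ℝ (fderiv ℝ (mollify η v)) x e e
      = mollify (fun y => fderiv ℝ (fderiv ℝ η) y e e) v x := fun e => by
    have hd := (((mollify_contDiff hη hc hv).fderiv_right (m := ∞) (by simp)).differentiable
      (by simp) x).hasFDerivAt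
    have h3 := (hd.clm_apply (hasFDerivAt_const e x)).fderiv
    have h4 := fderiv_mollify (hη' e) (hc' e) hv x e
    rw [show (fun y => fderiv ℝ (mollify η v) y e) = mollify (fun y => fderiv ℝ η y e) v from
      funext fun y => fderiv_mollify hη hc hv y e] at h3
    rw [h3] at h4
    simpa [hs] using h4
  rw [laplacian_eq_sum_fderiv, show Δ η = fun y => _ from funext fun y => laplacian_eq_sum_fderiv η y]
  simp only [h2, Fin.sum_univ_two, mollify_apply, add_smul]
  have hi : ∀ e, Integrable fun y => fderiv ℝ (fderiv ℝ η) (x - y) e e • v y := fun e => by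
    have hcs : HasCompactSupport fun y => fderiv ℝ (fderiv ℝ η) y e e := by
      simp only [← hs]; exact (hc' e).fderiv_apply ℝ e
    exact hcs.convolutionExists_right (ContinuousLinearMap.lsmul ℝ ℝ (E := ℂ)).flip hv (hη2 e e) x
  rw [integral_add (hi _) (hi _)]

theorem fderiv_comp_sub_left {F : Type*} [NormedAddCommGroup F] [NormedSpace ℝ F]
    (f : Plane → F) (a x : Plane) : fderiv ℝ (fun x => f (a - x)) x = -fderiv ℝ f (a - x) := by
  have h : (fun x => f (a - x)) = fun x => (f ∘ ContinuousLinearEquiv.neg ℝ) (x - a) := by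
    funext x
    simp
  rw [h, fderiv_comp_sub, ContinuousLinearEquiv.comp_right_fderiv]
  ext v
  simp

theorem laplacian_comp_sub_left {F : Type*} [NormedAddCommGroup F] [NormedSpace ℝ F]
    (f : Plane → F) (a x : Plane) : Δ (fun x => f (a - x)) x = Δ f (a - x) := by
  rw [laplacian_eq_sum_fderiv, laplacian_eq_sum_fderiv]
  refine Finset.sum_congr rfl fun i _ => ?_
  have : fderiv ℝ (fun x => f (a - x)) = fun x => -fderiv ℝ f (a - x) :=
    funext fun x => fderiv_comp_sub_left f a x
  rw [this, fderiv_fun_neg, fderiv_comp_sub_left (fderiv ℝ f)]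
  simp

/-- The distributional equation tested with `y ↦ η(x - y)`. -/
theorem IsHelmholtzSolution.laplacian_mollify {k : ℝ} {v : Plane → ℂ}
    (h : IsHelmholtzSolution k 0 v) (hv : Continuous v) {η : Plane → ℝ} (hη : ContDiff ℝ ∞ η)
    (hc : HasCompactSupport η) (x : Plane) :
    Δ (mollify η v) x = -(k : ℂ) ^ 2 * mollify η v x := by
  have h1 := h (fun y => η (x - y)) (hη.comp (by fun_prop))
    (hc.comp_homeomorph (Homeomorph.subLeft x))
  simp only [Pi.zero_apply, zero_mul, Complex.ofReal_zero, integral_zero, neg_zero,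
    laplacian_comp_sub_left] at h1
  rw [_root_.laplacian_mollify hη hc hv.locallyIntegrable, mollify_apply, mollify_apply,
    eq_comm, ← sub_eq_zero, ← neg_eq_zero, ← h1, ← integral_const_mul, neg_sub]
  have hcl := continuous_laplacian (hη.of_le two_le_infty)
  have hcc := hc.laplacian
  have i1 : Integrable fun y => Δ η (x - y) • v y := 
    hcc.convolutionExists_right (ContinuousLinearMap.lsmul ℝ ℝ (E := ℂ)).flip
      hv.locallyIntegrable hcl x
  have i2 : Integrable fun y => η (x - y) • v y := 
    hc.convolutionExists_right (ContinuousLinearMap.lsmul ℝ ℝ (E := ℂ)).flip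
      hv.locallyIntegrable hη.continuous x
  rw [← integral_sub i1 (i2.const_mul _)]
  refine integral_congr_ae (Eventually.of_forall fun y => ?_)
  simp only [Complex.real_smul]
  push_cast
  ring

/-! ### Mean values and smoothness of continuous distributional solutions -/

/-- Mollifications are smooth solutions and so satisfy the mean value formula. They converge
pointwise to `v` with a common bound on the circle, and the formula passes to the limit. -/
theorem IsHelmholtzSolution.circle_mean_value {k : ℝ} {v : Plane → ℂ}
    (h : IsHelmholtzSolution k 0 v) (hv : Continuous v) (x : Plane) {r : ℝ} (hr : 0 ≤ r) :
    ∫ θ in (0)..(2 * Real.pi), v (x + r • unitVec θ) = 2 * Real.pi * v x * besselJ 0 (k * r) := by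
  let B : ℕ → ContDiffBump (0 : Plane) := fun n =>
    { rIn := 1 / (n + 1) / 2, rOut := 1 / (n + 1), rIn_pos := by positivity
      rIn_lt_rOut := half_lt_self (by positivity) }
  have hB : Tendsto (fun n => (B n).rOut) atTop (𝓝 0) := tendsto_one_div_add_atTop_nhds_zero_nat
  set V : ℕ → Plane → ℂ := fun n => mollify ((B n).normed volume) v with hV
  have hVc : ∀ n, ContDiff ℝ ∞ (V n) := fun n =>
    mollify_contDiff (B n).contDiff_normed (B n).hasCompactSupport_normed hv.locallyIntegrable
  have hlim : ∀ y, Tendsto (fun n => V n y) atTop (𝓝 (v y)) := fun y => by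
    simp only [hV, mollify_eq_lsmul]
    exact ContDiffBump.convolution_tendsto_right_of_continuous hB hv y
  have hmean : ∀ n, ∫ θ in (0)..(2 * Real.pi), V n (x + r • unitVec θ)
      = 2 * Real.pi * V n x * besselJ 0 (k * r) := fun n => by
    have := _root_.circle_mean_value (f := fun y => V n (y - -x)) (ρ := r + 1) (k := k) (r := r)
      (((hVc n).comp (g := V n) (f := fun y => y - -x) (by fun_prop)).of_le two_le_infty).contDiffOn
      (fun y _ => by
        rw [laplacian_comp_sub]
        exact h.laplacian_mollify hv (B n).contDiff_normed (B n).hasCompactSupport_normed _)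
      ⟨hr, by linarith⟩
    simpa only [sub_neg_eq_add, zero_add, add_comm _ x, add_zero] using this
  obtain ⟨M, hM⟩ := (isCompact_closedBall x (r + 1)).exists_bound_of_continuousOn hv.continuousOn
  have hbound : ∀ n θ, ‖V n (x + r • unitVec θ)‖ ≤ 2 * M + M := fun n θ => by
    set y := x + r • unitVec θ with hy
    have hyx : ‖y - x‖ = r := by rw [hy, add_sub_cancel_left, norm_smul_unitVec hr]
    have hvy : ‖v y‖ ≤ M := hM y (by rw [mem_closedBall_iff_norm, hyx]; linarith)
    have h1 : dist (V n y) (v y) ≤ 2 * M := by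
      simp only [hV, mollify_eq_lsmul]
      refine ContDiffBump.dist_normed_convolution_le hv.aestronglyMeasurable fun z hz => ?_
      have hz1 : ‖z - y‖ < 1 := by
        rw [mem_ball_iff_norm] at hz
        refine hz.trans_le ?_
        change 1 / ((n : ℝ) + 1) ≤ 1
        rw [div_le_one (by positivity)]
        linarith [(Nat.cast_nonneg n : (0 : ℝ) ≤ n)]
      have hvz : ‖v z‖ ≤ M := hM z (by
        rw [mem_closedBall_iff_norm]
        have := norm_add_le (z - y) (y - x)
        rw [sub_add_sub_cancel] at this
        linarith)
      rw [dist_eq_norm]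
      linarith [norm_sub_le (v z) (v y)]
    rw [dist_eq_norm] at h1
    linarith [norm_sub_norm_le (V n y) (v y)]
  have hL := intervalIntegral.tendsto_integral_filter_of_dominated_convergence (μ := volume)
    (a := 0) (b := 2 * Real.pi) (l := atTop) (F := fun n θ => V n (x + r • unitVec θ))
    (f := fun θ => v (x + r • unitVec θ)) (fun _ => 2 * M + M)
    (Eventually.of_forall fun n => by
      have := (hVc n).continuous
      exact Continuous.aestronglyMeasurable (by fun_prop))
    (Eventually.of_forall fun n => Eventually.of_forall fun θ _ => hbound n θ)
    (by simp) (Eventually.of_forall fun θ _ => hlim _)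
  simp only [hmean] at hL
  exact tendsto_nhds_unique hL (((hlim x).const_mul _).mul_const _)

/-- A smooth radial cutoff supported in the ball of radius `ε`. -/
noncomputable def radialCutoff (ε : ℝ) (x : Plane) : ℝ :=
  Real.smoothTransition (1 - ‖x‖ ^ 2 / ε ^ 2)

theorem radialCutoff_contDiff (ε : ℝ) : ContDiff ℝ ∞ (radialCutoff ε) :=
  Real.smoothTransition.contDiff.comp (contDiff_const.sub ((contDiff_norm_sq ℝ).div_const _))

theorem radialCutoff_eq_zero {ε : ℝ} (hε : 0 < ε) {x : Plane} (hx : ε ≤ ‖x‖) :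
    radialCutoff ε x = 0 := by
  refine Real.smoothTransition.zero_of_nonpos ?_
  rw [sub_nonpos, one_le_div (by positivity)]
  gcongr

theorem radialCutoff_pos {ε : ℝ} (hε : 0 < ε) {x : Plane} (hx : ‖x‖ < ε) :
    0 < radialCutoff ε x := by
  refine Real.smoothTransition.pos_of_pos ?_
  rw [sub_pos, div_lt_one (by positivity)]
  gcongr

theorem radialCutoff_hasCompactSupport {ε : ℝ} (hε : 0 < ε) :
    HasCompactSupport (radialCutoff ε) :=
  HasCompactSupport.intro (isCompact_closedBall 0 ε) fun x hx => by
    rw [mem_closedBall_zero_iff, not_le] at hx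
    exact radialCutoff_eq_zero hε hx.le

theorem radialCutoff_smul_unitVec (ε : ℝ) {r : ℝ} (hr : 0 ≤ r) (θ : ℝ) :
    radialCutoff ε (r • unitVec θ) = radialCutoff ε (r • unitVec 0) := by
  rw [radialCutoff, radialCutoff, norm_smul_unitVec hr, norm_smul_unitVec hr]

/-- A radial kernel averages `v` over circles, and every such mean is a multiple of the value at the
centre; so convolution with it only multiplies `v` by a constant. -/
theorem IsHelmholtzSolution.mollify_radialCutoff {k : ℝ} {v : Plane → ℂ}
    (h : IsHelmholtzSolution k 0 v) (hv : Continuous v) {ε : ℝ} (hε : 0 < ε) (x : Plane) :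
    mollify (radialCutoff ε) v x
      = (∫ y, radialCutoff ε y * besselJ 0 (k * ‖y‖) : ℝ) * v x := by
  have hc := (radialCutoff_contDiff ε).continuous
  have hb := continuous_besselJ_zero
  have i1 : Integrable fun y => radialCutoff ε y • v (x - y) :=
    (Continuous.integrable_of_hasCompactSupport (by fun_prop)
      (radialCutoff_hasCompactSupport hε).smul_right)
  have i2 : Integrable fun y => radialCutoff ε y * besselJ 0 (k * ‖y‖) :=
    (Continuous.integrable_of_hasCompactSupport (by fun_prop)
      (radialCutoff_hasCompactSupport hε).mul_right)
  rw [mollify_apply_sub, integral_polar i1, integral_polar i2, ← integral_complex_ofReal,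
    ← integral_mul_const]
  refine setIntegral_congr_fun measurableSet_Ioi fun r hr => ?_
  have hr' : (0 : ℝ) < r := hr
  have e : ∫ θ in (0)..(2 * Real.pi), v (x - r • unitVec θ)
      = ∫ θ in (0)..(2 * Real.pi), v (x + r • unitVec θ) := by
    have hp : Function.Periodic (fun θ => v (x + r • unitVec θ)) (2 * Real.pi) := fun θ => by
      simp only [unitVec_periodic θ]
    have h1 := integral_periodic_sub_right hp Real.pi
    rw [← h1]
    refine intervalIntegral.integral_congr fun θ _ => ?_
    have : unitVec (θ - Real.pi) = -unitVec θ := by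
      ext i; fin_cases i <;> simp [unitVec]
    simp only [this, smul_neg]
    rw [sub_eq_add_neg]
  simp only [radialCutoff_smul_unitVec ε hr'.le, norm_smul_unitVec hr'.le,
    Complex.real_smul, intervalIntegral.integral_const_mul, e, h.circle_mean_value hv x hr'.le,
    intervalIntegral.integral_const, smul_eq_mul]
  push_cast
  ring

/-- On a small enough ball `J_0(k|y|)` is positive, hence so is the integral. -/
theorem exists_integral_radialCutoff_ne_zero (k : ℝ) :
    ∃ ε > 0, (∫ y, radialCutoff ε y * besselJ 0 (k * ‖y‖)) ≠ 0 := by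
  have hb := continuous_besselJ_zero
  have hc : Continuous fun y : Plane => besselJ 0 (k * ‖y‖) := by fun_prop
  have h0 : ∀ᶠ y in 𝓝 (0 : Plane), 0 < besselJ 0 (k * ‖y‖) := by
    refine (hc.tendsto 0).eventually (lt_mem_nhds ?_)
    simp [besselJ_zero_zero]
  obtain ⟨ε, hε, hball⟩ := Metric.eventually_nhds_iff_ball.1 h0
  refine ⟨ε, hε, ?_⟩
  have hcut := (radialCutoff_contDiff ε).continuous
  have hnn : ∀ y, 0 ≤ radialCutoff ε y * besselJ 0 (k * ‖y‖) := fun y => by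
    by_cases hy : ‖y‖ < ε
    · exact mul_nonneg (radialCutoff_pos hε hy).le (hball y (mem_ball_zero_iff.2 hy)).le
    · rw [radialCutoff_eq_zero hε (not_lt.1 hy), zero_mul]
  refine (Continuous.integral_pos_of_hasCompactSupport_nonneg_nonzero (by fun_prop)
    (radialCutoff_hasCompactSupport hε).mul_right hnn (x := 0) ?_).ne'
  have := radialCutoff_pos hε (x := 0) (by simpa using hε)
  simpa [besselJ_zero_zero] using this.ne'

/-- A version of Weyl's lemma: `v` is a nonzero constant times its own mollification, hence smooth.
-/
theorem IsHelmholtzSolution.contDiff {k : ℝ} {v : Plane → ℂ}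
    (h : IsHelmholtzSolution k 0 v) (hv : Continuous v) : ContDiff ℝ ∞ v := by
  obtain ⟨ε, hε, hne⟩ := exists_integral_radialCutoff_ne_zero k
  have hne' : ((∫ y, radialCutoff ε y * besselJ 0 (k * ‖y‖) : ℝ) : ℂ) ≠ 0 := by
    exact_mod_cast hne
  have e : v = fun x => ((∫ y, radialCutoff ε y * besselJ 0 (k * ‖y‖) : ℝ) : ℂ)⁻¹
      * mollify (radialCutoff ε) v x := by
    funext x
    rw [h.mollify_radialCutoff hv hε, inv_mul_cancel_left₀ hne']
  rw [e]
  exact contDiff_const.mul (mollify_contDiff (radialCutoff_contDiff ε)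
    (radialCutoff_hasCompactSupport hε) hv.locallyIntegrable)

theorem IsHelmholtzSolution.laplacian {k : ℝ} {v : Plane → ℂ}
    (h : IsHelmholtzSolution k 0 v) (hv : Continuous v) (x : Plane) :
    Δ v x = -(k : ℂ) ^ 2 * v x := by
  obtain ⟨ε, hε, hne⟩ := exists_integral_radialCutoff_ne_zero k
  have hne' : ((∫ y, radialCutoff ε y * besselJ 0 (k * ‖y‖) : ℝ) : ℂ) ≠ 0 := by
    exact_mod_cast hne
  have h1 := h.laplacian_mollify hv (radialCutoff_contDiff ε) (radialCutoff_hasCompactSupport hε) x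
  have e : mollify (radialCutoff ε) v
      = (∫ y, radialCutoff ε y * besselJ 0 (k * ‖y‖) : ℝ) • v := funext fun x => by
    rw [h.mollify_radialCutoff hv hε, Pi.smul_apply, Complex.real_smul]
  rw [e, InnerProductSpace.laplacian_smul _ ((h.contDiff hv).of_le two_le_infty).contDiffAt, Pi.smul_apply,
    Complex.real_smul, Complex.real_smul] at h1
  refine mul_left_cancel₀ hne' (h1.trans ?_)
  ring

/-! ### Uniqueness of radiating solutions -/

/-- The (modified) energy of a solution of the radial equation. -/
noncomputable def modeEnergy (k : ℝ) (x y : ℝ → ℝ) (r : ℝ) : ℝ :=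
  y r ^ 2 / r + k ^ 2 * (r * x r ^ 2) + x r * y r / r

/-- The plain energy has derivative terms `-y^2/r^2 + k^2 x^2`, smaller than the energy only by a
factor `1/r`, which is not integrable. The correction `x y / r` cancels them, and what remains
carries `1/r^2`. -/
theorem modeEnergy_hasDerivAt {k m r : ℝ} {x y : ℝ → ℝ} (hr : 0 < r)
    (hx : HasDerivAt x (y r / r) r) (hy : HasDerivAt y ((m / r - k ^ 2 * r) * x r) r) :
    HasDerivAt (modeEnergy k x y) ((2 * m - 1) * (x r * y r) / r ^ 2 + m * x r ^ 2 / r ^ 2) r := by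
  have hid := hasDerivAt_id r
  have h := (((hy.pow 2).div hid hr.ne').add ((hid.mul (hx.pow 2)).const_mul (k ^ 2))).add
    ((hx.mul hy).div hid hr.ne')
  refine h.congr_deriv ?_
  simp only [id, Pi.pow_apply, Pi.mul_apply]
  field_simp
  ring

theorem abs_mul_div_le {k r : ℝ} (hk : 0 < k) (hr : 0 < r) (x y : ℝ) :
    |x * y| ≤ (y ^ 2 / r + k ^ 2 * (r * x ^ 2)) / (2 * k) := by
  rw [le_div_iff₀ (by positivity), ← mul_le_mul_iff_left₀ hr,
    show (y ^ 2 / r + k ^ 2 * (r * x ^ 2)) * r = y ^ 2 + (k * r * x) ^ 2 by field_simp, abs_mul]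
  have h : (k * r * x) ^ 2 = (k * r * |x|) ^ 2 := by rw [mul_pow, mul_pow _ |x|, sq_abs]
  nlinarith [sq_nonneg (|y| - k * r * |x|), sq_abs y]

/-- A solution of the radial equation whose energy decays at infinity vanishes near infinity. -/
theorem radial_eq_zero_of_tendsto {k m : ℝ} (hk : 0 < k) (hm : 0 ≤ m) {x y : ℝ → ℝ}
    (hx : ∀ r > 0, HasDerivAt x (y r / r) r)
    (hy : ∀ r > 0, HasDerivAt y ((m / r - k ^ 2 * r) * x r) r)
    (hE : Tendsto (fun r => y r ^ 2 / r + k ^ 2 * (r * x r ^ 2)) atTop (𝓝 0)) {r : ℝ}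
    (hr : 1 / k ≤ r) : x r = 0 ∧ y r = 0 := by
  set P : ℝ → ℝ := fun r => y r ^ 2 / r + k ^ 2 * (r * x r ^ 2) with hP
  set E := modeEnergy k x y with hEdef
  have hk' : 0 < 1 / k := by positivity
  have hpos : ∀ r, 1 / k ≤ r → 0 < r := fun r hr => hk'.trans_le hr
  have hP0 : ∀ r, 1 / k ≤ r → 0 ≤ P r := fun r hr => by have := hpos r hr; positivity
  have hkr : ∀ r, 1 / k ≤ r → 1 ≤ k * r := fun r hr => by
    rw [div_le_iff₀ hk] at hr; linarith
  -- For `r ≥ 1/k` the correction is at most half of the plain energy `P`, so that `P` and `E` are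
  -- comparable.
  have hX : ∀ r, 1 / k ≤ r → |x r * y r / r| ≤ P r / 2 := fun r hr => by
    have h0 := hpos r hr
    rw [abs_div, abs_of_pos h0, div_le_iff₀ h0]
    refine (abs_mul_div_le hk h0 (x r) (y r)).trans ?_
    rw [div_le_iff₀ (by positivity)]
    change P r ≤ _
    nlinarith [hP0 r hr, hkr r hr, mul_le_mul_of_nonneg_left (hkr r hr) (hP0 r hr)]
  have hEP : ∀ r, 1 / k ≤ r → P r / 2 ≤ E r ∧ E r ≤ 3 / 2 * P r := fun r hr => by
    have := abs_le.1 (hX r hr)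
    have e : E r = P r + x r * y r / r := rfl
    constructor <;> linarith
  -- The first summand is what `|x y| ≤ P/(2k) ≤ E/k` requires for the cross term, as `|2m-1| ≤
  -- 2m+1`; the second only adds slack.
  set C : ℝ := (2 * m + 1) / k + 2 * m / k with hC
  have hE' : ∀ r, 1 / k ≤ r →
      -(C * E r / r ^ 2) ≤ (2 * m - 1) * (x r * y r) / r ^ 2 + m * x r ^ 2 / r ^ 2 := fun r hr => by
    have h0 := hpos r hr
    have h1 : -((2 * m + 1) * |x r * y r|) ≤ (2 * m - 1) * (x r * y r) := by
      have := abs_le.1 (le_refl |x r * y r|)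
      nlinarith
    have h2 := abs_mul_div_le hk h0 (x r) (y r)
    have h3 : (2 * m + 1) * |x r * y r| ≤ C * E r := by
      calc _ ≤ (2 * m + 1) * (P r / (2 * k)) := by gcongr
        _ = (2 * m + 1) / k * (P r / 2) := by field_simp
        _ ≤ C * (P r / 2) := by
          have := hP0 r hr
          gcongr
          rw [hC]
          have : 0 ≤ 2 * m / k := by positivity
          linarith
        _ ≤ C * E r := by
          have := (hEP r hr).1
          gcongr
    have h4 : 0 ≤ m * x r ^ 2 / r ^ 2 := by positivity
    have h5 : -(C * E r / r ^ 2) ≤ (2 * m - 1) * (x r * y r) / r ^ 2 := by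
      rw [← neg_div]
      gcongr
      linarith
    linarith
  have hd : ∀ r, 1 / k ≤ r → HasDerivAt (fun r => E r * Real.exp (-C / r))
      (((2 * m - 1) * (x r * y r) / r ^ 2 + m * x r ^ 2 / r ^ 2) * Real.exp (-C / r)
        + E r * (Real.exp (-C / r) * (C / r ^ 2))) r := fun r hr => by
    have h0 := hpos r hr
    have h1 : HasDerivAt (fun r : ℝ => -C / r) (C / r ^ 2) r := by
      refine ((hasDerivAt_const r (-C)).div (hasDerivAt_id r) h0.ne').congr_deriv ?_
      simp
    exact (modeEnergy_hasDerivAt h0 (hx r h0) (hy r h0)).mul h1.exp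
  -- From `E' ≥ -C E / r^2`, the integrating factor `exp(-C/r)` makes `E` increasing. A nonnegative
  -- increasing function with limit zero at infinity vanishes.
  have hmono : MonotoneOn (fun r => E r * Real.exp (-C / r)) (Ici (1 / k)) := by
    refine monotoneOn_of_deriv_nonneg (convex_Ici _) (fun r hr => (hd r hr).continuousAt.continuousWithinAt)
      (fun r hr => (hd r (interior_subset hr)).differentiableAt.differentiableWithinAt) fun r hr => ?_
    have hr' := interior_subset hr
    rw [(hd r hr').deriv]
    have h1 := hE' r hr'
    have h2 := Real.exp_pos (-C / r)
    have : 0 ≤ ((2 * m - 1) * (x r * y r) / r ^ 2 + m * x r ^ 2 / r ^ 2 + C * E r / r ^ 2)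
      * Real.exp (-C / r) := mul_nonneg (by linarith) h2.le
    refine this.trans_eq ?_
    ring
  have hlim : Tendsto (fun r => E r * Real.exp (-C / r)) atTop (𝓝 0) := by
    have hE0 : Tendsto E atTop (𝓝 0) := by
      refine squeeze_zero' ?_ ?_ (by simpa using hE.const_mul (3 / 2))
      · filter_upwards [eventually_ge_atTop (1 / k)] with r hr
        linarith [(hEP r hr).1, hP0 r hr]
      · filter_upwards [eventually_ge_atTop (1 / k)] with r hr using (hEP r hr).2
    have h1 : Tendsto (fun r : ℝ => Real.exp (-C / r)) atTop (𝓝 (Real.exp 0)) :=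
      (Real.continuous_exp.tendsto 0).comp (tendsto_const_nhds.div_atTop tendsto_id)
    simpa using hE0.mul h1
  have hle : E r * Real.exp (-C / r) ≤ 0 := by
    refine ge_of_tendsto hlim ?_
    filter_upwards [eventually_ge_atTop r] with s hs
    exact hmono hr (hr.trans hs) hs
  have hE0 : E r ≤ 0 := by
    by_contra h
    exact absurd hle (not_le.2 (mul_pos (not_le.1 h) (Real.exp_pos _)))
  have hPr : P r = 0 := le_antisymm (by linarith [(hEP r hr).1]) (hP0 r hr)
  have h0 := hpos r hr
  have h1 : 0 ≤ y r ^ 2 / r := by positivity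
  have h2 : 0 ≤ k ^ 2 * (r * x r ^ 2) := by positivity
  have h3 : y r ^ 2 / r + k ^ 2 * (r * x r ^ 2) = 0 := hPr
  constructor
  · have : k ^ 2 * (r * x r ^ 2) = 0 := by linarith
    simpa [hk.ne', h0.ne'] using this
  · have : y r ^ 2 / r = 0 := by linarith
    simpa [h0.ne'] using this

theorem SommerfeldCondition.tendsto_mode {k : ℝ} {v : Plane → ℂ} (h : SommerfeldCondition k v)
    (hv : ContDiff ℝ 2 v) (n : ℤ) :
    Tendsto (fun r : ℝ => ((√r : ℝ) : ℂ) * (circleFluxMode n v r / r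
      - Complex.I * k * circleMode n v r)) atTop (𝓝 0) := by
  rw [Metric.tendsto_atTop]
  intro ε hε
  -- The mode integrates over length `2π < 8`, whence `ε / 8`.
  have h1 := (Metric.tendsto_nhds.1 h.2) (ε / 8) (by positivity)
  rw [← comap_norm_atTop, eventually_comap] at h1
  obtain ⟨N, hN⟩ := eventually_atTop.1 h1
  refine ⟨max N 1, fun r hr => ?_⟩
  have hr1 : 1 ≤ r := (le_max_right _ _).trans hr
  have hr0 : 0 < r := by linarith
  have hvc := hv.continuous
  have hvd := hv.continuous_fderiv (by norm_num)
  have hcu := continuous_unitVec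
  have hF : Continuous fun θ => fderiv ℝ v (r • unitVec θ) (unitVec θ) := by fun_prop
  have e : ((√r : ℝ) : ℂ) * (circleFluxMode n v r / r - Complex.I * k * circleMode n v r)
      = ∫ θ in (0)..(2 * Real.pi), circleChar n θ * (((√r : ℝ) : ℂ) *
        (fderiv ℝ v (r • unitVec θ) (unitVec θ) - Complex.I * k * v (r • unitVec θ))) := by
    have hrc : (r : ℂ) ≠ 0 := by exact_mod_cast hr0.ne'
    rw [circleFluxMode, circleMode, ← intervalIntegral.integral_div,
      ← intervalIntegral.integral_const_mul, ← intervalIntegral.integral_sub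
        (Continuous.intervalIntegrable (by fun_prop) _ _)
        (Continuous.intervalIntegrable (by fun_prop) _ _), ← intervalIntegral.integral_const_mul]
    refine intervalIntegral.integral_congr fun θ _ => ?_
    field_simp
  have hb := intervalIntegral.norm_integral_le_of_norm_le_const (a := 0) (b := 2 * Real.pi)
    (f := fun θ => circleChar n θ * (((√r : ℝ) : ℂ) *
        (fderiv ℝ v (r • unitVec θ) (unitVec θ) - Complex.I * k * v (r • unitVec θ))))
    (C := ε / 8) fun θ _ => by
      have h2 := hN r ((le_max_left _ _).trans hr) (r • unitVec θ) (norm_smul_unitVec hr0.le θ)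
      rw [dist_zero_right, radialDeriv, norm_smul_unitVec hr0.le, smul_smul,
        inv_mul_cancel₀ hr0.ne', one_smul] at h2
      rw [norm_mul, norm_circleChar, one_mul]
      exact h2.le
  rw [dist_zero_right, e]
  refine hb.trans_lt ?_
  rw [sub_zero, abs_of_pos Real.two_pi_pos]
  nlinarith [Real.pi_lt_four]

theorem IsRegularMode.conj {q : ℝ → ℝ} {ρ : ℝ} {a b : ℝ → ℂ} (h : IsRegularMode q ρ a b) :
    IsRegularMode q ρ (fun r => starRingEnd ℂ (a r)) (fun r => starRingEnd ℂ (b r)) where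
  hasDerivAt_fst r hr := (h.hasDerivAt_fst r hr).star.congr_deriv (by simp)
  hasDerivAt_snd r hr := (h.hasDerivAt_snd r hr).star.congr_deriv (by simp)
  tendsto_snd := by
    have := (Complex.continuous_conj.tendsto 0).comp h.tendsto_snd
    simpa [Function.comp_def] using this
  bounded_fst := by
    obtain ⟨C, hC⟩ := h.bounded_fst
    exact ⟨C, hC.mono fun r hr => by rwa [Complex.norm_conj]⟩

/-- The Wronskian of a regular mode with its own conjugate: a field that is regular at the origin
carries no net energy through any circle. -/
theorem IsRegularMode.im_eq_zero {q : ℝ → ℝ} {ρ : ℝ} {a b : ℝ → ℂ} (h : IsRegularMode q ρ a b)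
    {r : ℝ} (hr : r ∈ Ioo 0 ρ) : (a r).re * (b r).im - (a r).im * (b r).re = 0 := by
  have h1 := congrArg Complex.im (h.wronskian_eq_zero h.conj hr)
  simp only [Complex.sub_im, Complex.mul_im, Complex.conj_re, Complex.conj_im, Complex.zero_im] at h1
  linarith

theorem hasDerivAt_re {f : ℝ → ℂ} {f' : ℂ} {r : ℝ} (h : HasDerivAt f f' r) :
    HasDerivAt (fun r => (f r).re) f'.re r :=
  Complex.reCLM.hasFDerivAt.comp_hasDerivAt r h

theorem hasDerivAt_im {f : ℝ → ℂ} {f' : ℂ} {r : ℝ} (h : HasDerivAt f f' r) :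
    HasDerivAt (fun r => (f r).im) f'.im r :=
  Complex.imCLM.hasFDerivAt.comp_hasDerivAt r h

/-- In the square of `√r |b/r - ika|` the cross term is the net flux, which is zero. The radiation
condition therefore forces the energies of the real and imaginary parts to decay separately, so both
vanish at radius `1/k`, and uniqueness for the radial system carries this to every radius. -/
theorem IsRegularMode.eq_zero_of_outgoing {k m : ℝ} (hk : 0 < k) (hm : 0 ≤ m) {a b : ℝ → ℂ}
    (h : ∀ ρ, 0 < ρ → IsRegularMode (fun r => m / r - k ^ 2 * r) ρ a b)
    (hout : Tendsto (fun r : ℝ => ((√r : ℝ) : ℂ) * (b r / r - Complex.I * k * a r)) atTop (𝓝 0))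
    {r : ℝ} (hr : 0 < r) : a r = 0 := by
  have hmem : ∀ r : ℝ, 0 < r → r ∈ Ioo 0 (r + 1) := fun r hr => ⟨hr, by linarith⟩
  have ha : ∀ r > 0, HasDerivAt a (b r / r) r := fun r hr =>
    (h (r + 1) (by linarith [show (0 : ℝ) < r from hr])).hasDerivAt_fst r (hmem r hr)
  have hb : ∀ r > 0, HasDerivAt b ((m / r - k ^ 2 * r : ℝ) * a r) r := fun r hr =>
    (h (r + 1) (by linarith [show (0 : ℝ) < r from hr])).hasDerivAt_snd r (hmem r hr)
  have hnorm : ∀ r > 0, ‖((√r : ℝ) : ℂ) * (b r / r - Complex.I * k * a r)‖ ^ 2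
      = ((b r).re ^ 2 / r + k ^ 2 * (r * (a r).re ^ 2))
        + ((b r).im ^ 2 / r + k ^ 2 * (r * (a r).im ^ 2)) := fun r hr => by
    have hw := (h (r + 1) (by linarith [show (0 : ℝ) < r from hr])).im_eq_zero (hmem r hr)
    have hr' : (0 : ℝ) < r := hr
    rw [norm_mul, mul_pow, Complex.norm_real, Real.norm_of_nonneg (Real.sqrt_nonneg r),
      Real.sq_sqrt hr'.le, Complex.sq_norm, Complex.normSq_apply]
    have e1 : (b r / r - Complex.I * k * a r).re = (b r).re / r + k * (a r).im := by
      simp [Complex.mul_re, Complex.div_ofReal_re]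
    have e2 : (b r / r - Complex.I * k * a r).im = (b r).im / r - k * (a r).re := by
      simp [Complex.mul_im, Complex.div_ofReal_im]
    rw [e1, e2]
    field_simp
    linear_combination (-2 * k * r) * hw
  have hN : Tendsto (fun r : ℝ => ‖((√r : ℝ) : ℂ) * (b r / r - Complex.I * k * a r)‖ ^ 2) atTop
      (𝓝 0) := by simpa using hout.norm.pow 2
  have hre : Tendsto (fun r => (b r).re ^ 2 / r + k ^ 2 * (r * (a r).re ^ 2)) atTop (𝓝 0) := by
    refine squeeze_zero' ?_ ?_ hN <;> filter_upwards [eventually_gt_atTop 0] with r hr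
    · positivity
    · rw [hnorm r hr]
      exact le_add_of_nonneg_right (by positivity)
  have him : Tendsto (fun r => (b r).im ^ 2 / r + k ^ 2 * (r * (a r).im ^ 2)) atTop (𝓝 0) := by
    refine squeeze_zero' ?_ ?_ hN <;> filter_upwards [eventually_gt_atTop 0] with r hr
    · positivity
    · rw [hnorm r hr]
      exact le_add_of_nonneg_left (by positivity)
  have z1 := radial_eq_zero_of_tendsto hk hm (x := fun r => (a r).re) (y := fun r => (b r).re)
    (fun r hr => (hasDerivAt_re (ha r hr)).congr_deriv (Complex.div_ofReal_re _ _))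
    (fun r hr => (hasDerivAt_re (hb r hr)).congr_deriv (Complex.re_ofReal_mul _ _)) hre le_rfl
  have z2 := radial_eq_zero_of_tendsto hk hm (x := fun r => (a r).im) (y := fun r => (b r).im)
    (fun r hr => (hasDerivAt_im (ha r hr)).congr_deriv (Complex.div_ofReal_im _ _))
    (fun r hr => (hasDerivAt_im (hb r hr)).congr_deriv (Complex.im_ofReal_mul _ _)) him le_rfl
  have hk' : 0 < 1 / k := by positivity
  refine linear_system_eq_zero (q := fun r => m / r - k ^ 2 * r) (ρ := max r (1 / k) + 1)
    (ContinuousOn.sub (continuousOn_const.div continuousOn_id fun x hx => (ne_of_gt hx))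
      (by fun_prop)) (fun s hs => ha s hs.1) (fun s hs => hb s hs.1) (s := 1 / k)
    ⟨hk', by linarith [le_max_right r (1 / k)]⟩ ⟨hr, by linarith [le_max_left r (1 / k)]⟩
    (Complex.ext z1.1 z2.1) (Complex.ext z1.2 z2.2)

/-- A radiating solution without sources vanishes. -/
theorem IsRadiatingSolution.eq_zero {k : ℝ} (hk : 0 < k) {v : Plane → ℂ}
    (h : IsRadiatingSolution k 0 v) : v = 0 := by
  have hc := h.helmholtz.contDiff h.continuous
  have hc2 : ContDiff ℝ 2 v := hc.of_le two_le_infty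
  have hmode : ∀ n : ℤ, ∀ r > 0, circleMode n v r = 0 := fun n r hr =>
    IsRegularMode.eq_zero_of_outgoing hk (sq_nonneg (n : ℝ))
      (fun ρ hρ => isRegularMode_circleMode hρ hc2.contDiffOn
        (fun x _ => h.helmholtz.laplacian h.continuous x) n)
      (h.radiating.tendsto_mode hc2 n) hr
  have hout : ∀ x : Plane, x ≠ 0 → v x = 0 := fun x hx => by
    obtain ⟨θ, _, e⟩ := exists_eq_smul_unitVec x
    have hcu := continuous_unitVec
    have hvc := h.continuous
    rw [e]
    exact eq_zero_of_integral_circleChar (C := fun θ => v (‖x‖ • unitVec θ)) (by fun_prop)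
      (fun θ => by simp only [unitVec_periodic θ]) (fun n => hmode n _ (norm_pos_iff.2 hx)) θ
  funext x
  by_cases hx : x = 0
  · have h1 : Dense ({0}ᶜ : Set Plane) := dense_compl_singleton 0
    exact congrFun (h.continuous.ext_on h1 continuous_const fun y hy => hout y hy) x
  · exact hout x hx

/-! ### The field radiated by a compactly supported square integrable source -/

section

variable {S : Plane → ℝ}

theorem integrable_of_memLp_two (hS : MemLp S 2 volume) (hc : HasCompactSupport S) :
    Integrable S := by
  have := isFiniteMeasure_restrict.2 (hc.isCompact.measure_lt_top (μ := volume)).ne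
  have h : IntegrableOn S (tsupport S) := (hS.restrict (tsupport S)).integrable (by norm_num)
  exact (integrableOn_iff_integrable_of_support_subset (subset_tsupport S)).1 h

/-- The field `∫ (i/4) H_0(k|x-y|) S(y) dy`. -/
noncomputable def radiatedField (k : ℝ) (S : Plane → ℝ) (x : Plane) : ℂ :=
  ∫ y, radiatingKernel k (x - y) * S y

/-- The fundamental solution, made constant in the ball of radius `δ`. -/
noncomputable def truncatedKernel (k δ : ℝ) (x : Plane) : ℂ :=
  Complex.I / 4 * hankel 0 (k * max ‖x‖ δ)

theorem truncatedKernel_eq {k δ : ℝ} {x : Plane} (h : δ ≤ ‖x‖) :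
    truncatedKernel k δ x = radiatingKernel k x := by
  rw [truncatedKernel, radiatingKernel, max_eq_left h]

theorem continuous_truncatedKernel {k δ : ℝ} (hk : 0 < k) (hδ : 0 < δ) :
    Continuous (truncatedKernel k δ) := by
  refine continuous_const.mul (continuous_iff_continuousAt.2 fun x => ?_)
  have h : 0 < k * max ‖x‖ δ := mul_pos hk (hδ.trans_le (le_max_right _ _))
  have h1 : ContinuousAt (fun x : Plane => k * max ‖x‖ δ) x := by fun_prop
  exact ContinuousAt.comp (g := hankel 0) (f := fun x : Plane => k * max ‖x‖ δ)
    (hankel_zero_hasDerivAt h).continuousAt h1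

theorem ae_ne (x : Plane) : ∀ᵐ y : Plane, x - y ≠ 0 := by
  have h : ∀ᵐ y : Plane, y ≠ x := by simp [ae_iff]
  filter_upwards [h] with y hy
  exact sub_ne_zero.2 hy.symm

theorem aestronglyMeasurable_radiatingKernel_sub {k : ℝ} (hk : 0 < k) (x : Plane) :
    AEStronglyMeasurable (fun y => radiatingKernel k (x - y)) volume :=
  (aestronglyMeasurable_radiatingKernel hk).comp_measurePreserving
    (Measure.measurePreserving_sub_left volume x)

theorem aestronglyMeasurable_ofReal {μ : Measure Plane} (hS : AEStronglyMeasurable S μ) :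
    AEStronglyMeasurable (fun y => (S y : ℂ)) μ :=
  Complex.continuous_ofReal.comp_aestronglyMeasurable hS

/-- Young's inequality, weighted so that on a disc of radius `δ` the integral `2πδ` of `1/|x|` and
the square integral of the source both enter with the small factor `δ^(1/2)`. -/
theorem rpow_neg_half_mul_le {t δ s : ℝ} (ht : 0 < t) (hδ : 0 < δ) :
    t ^ (-1 / 2 : ℝ) * |s| ≤ δ ^ (-1 / 2 : ℝ) / 2 * t⁻¹ + δ ^ (1 / 2 : ℝ) / 2 * s ^ 2 := by
  set a := t ^ (-1 / 2 : ℝ) with ha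
  set b := δ ^ (1 / 2 : ℝ) with hb
  have hb0 : 0 < b := Real.rpow_pos_of_pos hδ _
  have e1 : t⁻¹ = a ^ 2 := by
    rw [ha, ← Real.rpow_natCast, ← Real.rpow_mul ht.le, ← Real.rpow_neg_one]
    norm_num
  have e2 : δ ^ (-1 / 2 : ℝ) = b⁻¹ := by
    rw [hb, ← Real.rpow_neg hδ.le]
    norm_num
  rw [e1, e2, ← sq_abs s]
  have h := sq_nonneg (a - b * |s|)
  have : b⁻¹ / 2 * a ^ 2 + b / 2 * |s| ^ 2 - a * |s| = (a - b * |s|) ^ 2 / (2 * b) := by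
    field_simp
    ring
  have h2 : 0 ≤ (a - b * |s|) ^ 2 / (2 * b) := by positivity
  linarith

theorem integrable_inv_norm_indicator (x : Plane) (δ : ℝ) :
    Integrable fun y => (Metric.ball (0 : Plane) δ).indicator (fun z => ‖z‖⁻¹) (x - y) := by
  have h := integrableOn_norm_rpow_ball (p := -1) (by norm_num) δ
  simp only [Real.rpow_neg_one] at h
  exact (h.integrable_indicator measurableSet_ball).comp_sub_left x

theorem integral_inv_norm_indicator (x : Plane) {δ : ℝ} (hδ : 0 ≤ δ) :
    ∫ y, (Metric.ball (0 : Plane) δ).indicator (fun z => ‖z‖⁻¹) (x - y) = 2 * Real.pi * δ := by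
  rw [integral_sub_left_eq_self (fun y => (Metric.ball (0 : Plane) δ).indicator (fun z => ‖z‖⁻¹) y)
    volume x, integral_indicator measurableSet_ball, integral_inv_norm_ball hδ]

/-- The constant in the bound of the fundamental solution. -/
theorem exists_kernel_constant {k : ℝ} (hk : 0 < k) :
    ∃ C : ℝ, 0 ≤ C ∧ (∀ x : Plane, x ≠ 0 → ‖radiatingKernel k x‖ ≤ C * ‖x‖ ^ (-1 / 2 : ℝ)) ∧
      ∀ δ > 0, ∀ x : Plane, ‖truncatedKernel k δ x‖ ≤ C * δ ^ (-1 / 2 : ℝ) := by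
  obtain ⟨C, hC, h⟩ := exists_norm_hankel_zero_le
  have hle : ∀ t > 0, ‖Complex.I / 4 * hankel 0 (k * t)‖ ≤ C * k ^ (-1 / 2 : ℝ) * t ^ (-1 / 2 : ℝ) :=
    fun t ht => by
    rw [mul_assoc, ← Real.mul_rpow hk.le (le_of_lt ht), norm_mul]
    have e : ‖(Complex.I / 4 : ℂ)‖ ≤ 1 := by simp; norm_num
    calc _ ≤ 1 * ‖hankel 0 (k * t)‖ := by gcongr
      _ ≤ _ := by rw [one_mul]; exact h _ (mul_pos hk ht)
  refine ⟨C * k ^ (-1 / 2 : ℝ), by positivity, fun x hx => hle _ (norm_pos_iff.2 hx), ?_⟩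
  intro δ hδ x
  have hm : 0 < max ‖x‖ δ := lt_of_lt_of_le hδ (le_max_right _ _)
  refine (hle _ hm).trans ?_
  exact mul_le_mul_of_nonneg_left
    (Real.rpow_le_rpow_of_nonpos hδ (le_max_right _ _) (by norm_num)) (by positivity)

theorem integrable_radiatedField {k : ℝ} (hk : 0 < k) (hS : MemLp S 2 volume)
    (hc : HasCompactSupport S) (x : Plane) :
    Integrable fun y => radiatingKernel k (x - y) * S y := by
  obtain ⟨C, hC, h, -⟩ := exists_kernel_constant hk
  have hS1 := integrable_of_memLp_two hS hc
  have hb : Integrable fun y => C * ((Metric.ball (0 : Plane) 1).indicator (fun z => ‖z‖⁻¹) (x - y)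
      + S y ^ 2 + |S y|) :=
    (((integrable_inv_norm_indicator x 1).add hS.integrable_sq).add hS1.abs).const_mul C
  refine hb.mono' ((aestronglyMeasurable_radiatingKernel_sub hk x).mul
    (aestronglyMeasurable_ofReal hS.1)) ?_
  filter_upwards [ae_ne x] with y hy
  have h0 : 0 < ‖x - y‖ := norm_pos_iff.2 hy
  rw [norm_mul, Complex.norm_real, Real.norm_eq_abs]
  calc _ ≤ C * ‖x - y‖ ^ (-1 / 2 : ℝ) * |S y| := by gcongr; exact h _ hy
    _ = C * (‖x - y‖ ^ (-1 / 2 : ℝ) * |S y|) := by ring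
    _ ≤ _ := by
      gcongr
      by_cases hlt : ‖x - y‖ < 1
      · rw [indicator_of_mem (mem_ball_zero_iff.2 hlt)]
        have h1 := rpow_neg_half_mul_le (s := S y) h0 one_pos
        rw [Real.one_rpow, Real.one_rpow] at h1
        have h2 : 0 ≤ ‖x - y‖⁻¹ := by positivity
        nlinarith [sq_nonneg (S y), abs_nonneg (S y)]
      · have h1 : ‖x - y‖ ^ (-1 / 2 : ℝ) ≤ 1 :=
          Real.rpow_le_one_of_one_le_of_nonpos (not_lt.1 hlt) (by norm_num)
        have h2 : 0 ≤ (Metric.ball (0 : Plane) 1).indicator (fun z => ‖z‖⁻¹) (x - y) :=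
          indicator_nonneg (fun z _ => by positivity) _
        nlinarith [sq_nonneg (S y), abs_nonneg (S y)]

theorem integrable_truncatedKernel {k δ : ℝ} (hk : 0 < k) (hδ : 0 < δ) (hS : Integrable S)
    (x : Plane) : Integrable fun y => truncatedKernel k δ (x - y) * S y := by
  obtain ⟨C, hC, -, h⟩ := exists_kernel_constant hk
  have := continuous_truncatedKernel hk hδ
  exact hS.ofReal.bdd_mul (Continuous.aestronglyMeasurable (by fun_prop))
    (Eventually.of_forall fun y => h δ hδ _)

/-- The fields of the kernels frozen inside the disc of radius `1/(n+1)` are continuous and converge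
uniformly, since the removed singularity contributes `O(δ^(1/2))`. -/
theorem radiatedField_continuous {k : ℝ} (hk : 0 < k) (hS : MemLp S 2 volume)
    (hc : HasCompactSupport S) : Continuous (radiatedField k S) := by
  obtain ⟨C, hC, h, h'⟩ := exists_kernel_constant hk
  have hS1 := integrable_of_memLp_two hS hc
  set U : ℕ → Plane → ℂ := fun n x => ∫ y, truncatedKernel k (1 / (n + 1)) (x - y) * S y with hU
  have hδ : ∀ n : ℕ, (0 : ℝ) < 1 / (n + 1) := fun n => by positivity
  have hUc : ∀ n, Continuous (U n) := fun n => by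
    have hcont := continuous_truncatedKernel hk (hδ n)
    refine continuous_of_dominated (bound := fun y => C * (1 / ((n : ℝ) + 1)) ^ (-1 / 2 : ℝ) * |S y|)
      (fun x => (integrable_truncatedKernel hk (hδ n) hS1 x).1) (fun x => Eventually.of_forall fun y => ?_)
      (hS1.abs.const_mul _) (Eventually.of_forall fun y => by fun_prop)
    rw [norm_mul, Complex.norm_real, Real.norm_eq_abs]
    gcongr
    exact h' _ (hδ n) _
  have hbound : ∀ (n : ℕ) x, ‖radiatedField k S x - U n x‖
      ≤ C * (2 * Real.pi + ∫ y, S y ^ 2) * (1 / ((n : ℝ) + 1)) ^ (1 / 2 : ℝ) := fun n x => by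
    set δ : ℝ := 1 / ((n : ℝ) + 1) with hδdef
    have hδ0 := hδ n
    have hb : Integrable fun y => 2 * C * (δ ^ (-1 / 2 : ℝ) / 2 *
        (Metric.ball (0 : Plane) δ).indicator (fun z => ‖z‖⁻¹) (x - y)
        + δ ^ (1 / 2 : ℝ) / 2 * S y ^ 2) :=
      (((integrable_inv_norm_indicator x δ).const_mul _).add
        (hS.integrable_sq.const_mul _)).const_mul _
    rw [radiatedField, hU]
    simp only
    rw [← integral_sub (integrable_radiatedField hk hS hc x)
      (integrable_truncatedKernel hk hδ0 hS1 x)]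
    refine (norm_integral_le_of_norm_le hb ?_).trans_eq ?_
    · filter_upwards [ae_ne x] with y hy
      have h0 : 0 < ‖x - y‖ := norm_pos_iff.2 hy
      by_cases hlt : ‖x - y‖ < δ
      · rw [indicator_of_mem (mem_ball_zero_iff.2 hlt), ← sub_mul, norm_mul, Complex.norm_real,
          Real.norm_eq_abs]
        have h1 := rpow_neg_half_mul_le (s := S y) h0 hδ0
        have h2 : ‖radiatingKernel k (x - y) - truncatedKernel k δ (x - y)‖
            ≤ 2 * C * ‖x - y‖ ^ (-1 / 2 : ℝ) := by
          refine (norm_sub_le _ _).trans ?_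
          have h3 : δ ^ (-1 / 2 : ℝ) ≤ ‖x - y‖ ^ (-1 / 2 : ℝ) :=
            Real.rpow_le_rpow_of_nonpos h0 hlt.le (by norm_num)
          have h4 := mul_le_mul_of_nonneg_left h3 hC
          linarith [h _ hy, h' δ hδ0 (x - y)]
        calc _ ≤ 2 * C * ‖x - y‖ ^ (-1 / 2 : ℝ) * |S y| := by gcongr
          _ = 2 * C * (‖x - y‖ ^ (-1 / 2 : ℝ) * |S y|) := by ring
          _ ≤ _ := by gcongr
      · rw [truncatedKernel_eq (not_lt.1 hlt), sub_self, norm_zero]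
        have h2 : 0 ≤ (Metric.ball (0 : Plane) δ).indicator (fun z => ‖z‖⁻¹) (x - y) :=
          indicator_nonneg (fun z _ => by positivity) _
        positivity
    · rw [integral_const_mul, integral_add ((integrable_inv_norm_indicator x δ).const_mul _)
        (hS.integrable_sq.const_mul _), integral_const_mul, integral_const_mul,
        integral_inv_norm_indicator x hδ0.le]
      have e : δ ^ (1 / 2 : ℝ) = δ ^ (-1 / 2 : ℝ) * δ := by
        rw [show (1 / 2 : ℝ) = -1 / 2 + 1 by norm_num, Real.rpow_add_one (show δ ≠ 0 from hδ0.ne')]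
      rw [e]
      ring
  have hlim : TendstoUniformly U (radiatedField k S) atTop := by
    rw [Metric.tendstoUniformly_iff]
    intro ε hε
    have h1 : Tendsto (fun n : ℕ => C * (2 * Real.pi + ∫ y, S y ^ 2)
        * (1 / ((n : ℝ) + 1)) ^ (1 / 2 : ℝ)) atTop (𝓝 0) := by
      have := ((Real.continuousAt_rpow_const 0 (1 / 2 : ℝ) (Or.inr (by norm_num))).tendsto.comp
        tendsto_one_div_add_atTop_nhds_zero_nat).const_mul (C * (2 * Real.pi + ∫ y, S y ^ 2))
      rw [Real.zero_rpow (by norm_num), mul_zero] at this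
      exact this
    filter_upwards [h1.eventually (gt_mem_nhds hε)] with n hn x
    rw [dist_eq_norm]
    exact (hbound n x).trans_lt hn
  exact hlim.continuous (Eventually.of_forall hUc).frequently

theorem laplacian_ofReal {w : Plane → ℝ} {x : Plane} (hw : ContDiffAt ℝ 2 w x) :
    Δ (fun x => (w x : ℂ)) x = ((Δ w x : ℝ) : ℂ) :=
  hw.laplacian_CLM_comp_left (l := Complex.ofRealCLM)

/-- After Fubini, the inner integral is `integral_radiatingKernel_mul_laplacian` for a translated
test function. -/
theorem radiatedField_helmholtz {k : ℝ} (hk : 0 < k) (hS : MemLp S 2 volume)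
    (hc : HasCompactSupport S) : IsHelmholtzSolution k S (radiatedField k S) := by
  intro w hw hwc
  have hS1 := integrable_of_memLp_two hS hc
  set f : Plane → ℂ := fun x => (w x : ℂ) with hf
  have hfC : ContDiff ℝ 2 f := Complex.ofRealCLM.contDiff.comp (hw.of_le two_le_infty)
  have hfc : HasCompactSupport f := hwc.comp_left (g := fun t : ℝ => (t : ℂ)) (by simp)
  set g : Plane → ℂ := fun x => Δ f x + k ^ 2 * f x with hg
  have hgw : ∀ x, ((Δ w x + k ^ 2 * w x : ℝ) : ℂ) = g x := fun x => by
    simp only [hg, hf]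
    rw [laplacian_ofReal (hw.of_le two_le_infty).contDiffAt]
    push_cast
    rfl
  have hgcont : Continuous g := by
    have h1 := continuous_laplacian hfC
    have h2 := hfC.continuous
    fun_prop
  have hgc : HasCompactSupport g :=
    HasCompactSupport.add (f := Δ f) (f' := fun x => k ^ 2 * f x) hfc.laplacian hfc.mul_left
  simp only [hgw, radiatedField, ← integral_const_mul]
  obtain ⟨ρ, hρ⟩ := hgc.isBounded.subset_ball 0
  obtain ⟨σ, hσ⟩ := hc.isBounded.subset_ball 0
  obtain ⟨M, hM⟩ := hgcont.bounded_above_of_compact_support hgc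
  have hint : Integrable (fun p : Plane × Plane => g p.1 * (radiatingKernel k (p.1 - p.2) * S p.2))
      (volume.prod volume) := by
    -- The kernel is only locally integrable, but on the supports of `g` and `S` its argument has
    -- norm less than `ρ + σ`; cut off there, it enters an integrable convolution integrand.
    have h1 := (integrableOn_radiatingKernel hk (ρ + σ)).integrable_indicator measurableSet_ball
    have h2 := Integrable.convolution_integrand (ContinuousLinearMap.mul ℝ ℂ) hS1.ofReal h1
    have h3 := h2.bdd_mul (f := fun p : Plane × Plane => g p.1) (c := M)
      (Continuous.aestronglyMeasurable (by fun_prop)) (Eventually.of_forall fun p => hM p.1)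
    refine h3.congr (Eventually.of_forall fun p => ?_)
    by_cases hp1 : g p.1 = 0
    · simp [hp1]
    by_cases hp2 : S p.2 = 0
    · simp [hp2]
    have m1 : ‖p.1‖ < ρ := mem_ball_zero_iff.1 (hρ (subset_tsupport _ hp1))
    have m2 : ‖p.2‖ < σ := mem_ball_zero_iff.1 (hσ (subset_tsupport _ hp2))
    have m3 : p.1 - p.2 ∈ Metric.ball (0 : Plane) (ρ + σ) := by
      rw [mem_ball_zero_iff]
      linarith [norm_sub_le p.1 p.2]
    simp only [ContinuousLinearMap.mul_apply', indicator_of_mem m3]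
    change g p.1 * ((S p.2 : ℂ) * _) = _
    ring
  rw [integral_integral_swap hint, ← integral_neg]
  refine integral_congr_ae (Eventually.of_forall fun y => ?_)
  have h1 := integral_radiatingKernel_mul_laplacian hk (f := fun x => f (x - -y))
    (hfC.comp (by fun_prop)) (hfc.comp_homeomorph (Homeomorph.subRight (-y)))
  simp only [laplacian_comp_sub (f := f) (-y)] at h1
  simp only [sub_neg_eq_add, zero_add] at h1
  simp only
  have h2 : ∫ x, g x * (radiatingKernel k (x - y) * S y)
      = (∫ x, radiatingKernel k x * g (x + y)) * S y := by
    rw [← integral_mul_const, ← integral_add_right_eq_self _ y]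
    refine integral_congr_ae (Eventually.of_forall fun x => ?_)
    simp only [add_sub_cancel_right]
    ring
  rw [h2, h1]
  simp only [hf]
  push_cast
  ring

end

/-! ### The radiation condition -/

/-- By the law of cosines `|x-y||x| - ⟨x-y, x⟩ ≤ |y|^2 / 2`: seen from far away, the direction of `x
- y` is almost radial. -/
theorem abs_cos_angle_sub_one_le {x y : Plane} (hx : x ≠ 0) (hz : x - y ≠ 0) :
    |inner ℝ (x - y) (‖x‖⁻¹ • x) / ‖x - y‖ - 1| ≤ ‖y‖ ^ 2 / (2 * ‖x - y‖ * ‖x‖) := by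
  have hx0 : 0 < ‖x‖ := norm_pos_iff.2 hx
  have hz0 : 0 < ‖x - y‖ := norm_pos_iff.2 hz
  have e1 : inner ℝ (x - y) (‖x‖⁻¹ • x) / ‖x - y‖ - 1
      = -((‖x - y‖ * ‖x‖ - inner ℝ (x - y) x) / (‖x - y‖ * ‖x‖)) := by
    rw [inner_smul_right]
    field_simp
    ring
  have e2 : ‖y‖ ^ 2 = ‖x - y‖ ^ 2 - 2 * inner ℝ (x - y) x + ‖x‖ ^ 2 := by
    rw [← norm_sub_sq_real, sub_sub_cancel_left, norm_neg]
  have h1 : 0 ≤ ‖x - y‖ * ‖x‖ - inner ℝ (x - y) x :=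
    sub_nonneg.2 (real_inner_le_norm _ _)
  rw [e1, abs_neg, abs_of_nonneg (by positivity), div_le_div_iff₀ (by positivity) (by positivity), e2]
  have h3 : (‖x - y‖ * ‖x‖ - inner ℝ (x - y) x) * 2
      ≤ ‖x - y‖ ^ 2 - 2 * inner ℝ (x - y) x + ‖x‖ ^ 2 := by
    nlinarith [sq_nonneg (‖x - y‖ - ‖x‖)]
  have := mul_le_mul_of_nonneg_right h3 (mul_pos hz0 hx0).le
  linarith

theorem norm_fderiv_radiatingKernel_le {k : ℝ} (hk : 0 < k) {x : Plane} (hx : x ≠ 0) :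
    ‖fderiv ℝ (radiatingKernel k) x‖ ≤ k * ‖hankel 1 (k * ‖x‖)‖ := by
  refine ContinuousLinearMap.opNorm_le_bound _ (by positivity) fun v => ?_
  have hx0 : 0 < ‖x‖ := norm_pos_iff.2 hx
  have h1 : |inner ℝ x v / ‖x‖| ≤ ‖v‖ := by
    rw [abs_div, abs_of_pos hx0, div_le_iff₀ hx0, mul_comm]
    exact abs_real_inner_le_norm x v
  have e : ‖(Complex.I / 4 : ℂ)‖ ≤ 1 := by simp; norm_num
  rw [fderiv_radiatingKernel hk hx, norm_neg, norm_mul, norm_mul, norm_mul, Complex.norm_real,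
    Complex.norm_real, Real.norm_of_nonneg hk.le, Real.norm_eq_abs]
  calc _ ≤ 1 * (k * ‖v‖ * ‖hankel 1 (k * ‖x‖)‖) := by gcongr
    _ = _ := by ring

theorem norm_hankel_one_le_of_le {C t t₀ : ℝ} (hC : 0 ≤ C) (ht₀ : 0 < t₀) (h : t₀ ≤ t)
    (hb : ‖hankel 1 t‖ ≤ C * (t ^ (-1 / 2 : ℝ) + t ^ (-3 / 2 : ℝ))) :
    ‖hankel 1 t‖ ≤ C * (t₀ ^ (-1 / 2 : ℝ) + t₀ ^ (-3 / 2 : ℝ)) := by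
  refine hb.trans (mul_le_mul_of_nonneg_left (add_le_add ?_ ?_) hC) <;>
  exact Real.rpow_le_rpow_of_nonpos ht₀ h (by norm_num)

section

variable {S : Plane → ℝ} {ρ : ℝ}

theorem radiatedField_eq_setIntegral (k : ℝ) (hsupp : tsupport S ⊆ Metric.ball 0 ρ) (x : Plane) :
    radiatedField k S x = ∫ y in Metric.ball 0 ρ, radiatingKernel k (x - y) * S y := by
  refine (setIntegral_eq_integral_of_forall_compl_eq_zero fun y hy => ?_).symm
  rw [image_eq_zero_of_notMem_tsupport fun h => hy (hsupp h)]
  simp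

theorem radiatedField_hasFDerivAt {k : ℝ} (hk : 0 < k) (hρ : 0 < ρ) (hS : MemLp S 2 volume)
    (hc : HasCompactSupport S) (hsupp : tsupport S ⊆ Metric.ball 0 ρ) {x : Plane}
    (hx : 2 * ρ < ‖x‖) :
    Integrable (fun y => (S y : ℂ) • fderiv ℝ (radiatingKernel k) (x - y))
      (volume.restrict (Metric.ball 0 ρ)) ∧
    HasFDerivAt (radiatedField k S)
      (∫ y in Metric.ball 0 ρ, (S y : ℂ) • fderiv ℝ (radiatingKernel k) (x - y)) x := by
  obtain ⟨C, hC, hH⟩ := exists_norm_hankel_one_le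
  have hS1 := integrable_of_memLp_two hS hc
  rw [show radiatedField k S = fun x => ∫ y in Metric.ball 0 ρ, radiatingKernel k (x - y) * S y from
    funext fun x => radiatedField_eq_setIntegral k hsupp x]
  have hs : {x : Plane | 2 * ρ < ‖x‖} ∈ 𝓝 x := (isOpen_lt continuous_const continuous_norm).mem_nhds hx
  have hz : ∀ z : Plane, 2 * ρ < ‖z‖ → ∀ y ∈ Metric.ball (0 : Plane) ρ, ρ ≤ ‖z - y‖ := fun z hz y hy => by
    rw [mem_ball_zero_iff] at hy
    linarith [norm_sub_norm_le z y]
  have hz0 : ∀ z : Plane, 2 * ρ < ‖z‖ → ∀ y ∈ Metric.ball (0 : Plane) ρ, z - y ≠ 0 := fun z h y hy =>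
    norm_pos_iff.1 (hρ.trans_le (hz z h y hy))
  have hmeas : AEStronglyMeasurable (fun y => (S y : ℂ) • fderiv ℝ (radiatingKernel k) (x - y))
      (volume.restrict (Metric.ball 0 ρ)) := by
    refine (aestronglyMeasurable_ofReal hS.1).restrict.smul ?_
    refine ContinuousOn.aestronglyMeasurable (fun y hy => ?_) measurableSet_ball
    exact (ContinuousAt.comp (f := fun y => x - y) (((radiatingKernel_contDiffAt hk
      (hz0 x hx y hy)).fderiv_right (m := 0) (by simp)).continuousAt)
      (by fun_prop)).continuousWithinAt
  have hbound : ∀ z : Plane, 2 * ρ < ‖z‖ → ∀ y ∈ Metric.ball (0 : Plane) ρ,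
      ‖(S y : ℂ) • fderiv ℝ (radiatingKernel k) (z - y)‖
        ≤ |S y| * (k * (C * ((k * ρ) ^ (-1 / 2 : ℝ) + (k * ρ) ^ (-3 / 2 : ℝ)))) := fun z h y hy => by
    rw [norm_smul, Complex.norm_real, Real.norm_eq_abs]
    refine mul_le_mul_of_nonneg_left ((norm_fderiv_radiatingKernel_le hk (hz0 z h y hy)).trans ?_)
      (abs_nonneg _)
    refine mul_le_mul_of_nonneg_left (norm_hankel_one_le_of_le hC (mul_pos hk hρ) ?_
      (hH _ (mul_pos hk (norm_pos_iff.2 (hz0 z h y hy))))) hk.le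
    exact mul_le_mul_of_nonneg_left (hz z h y hy) hk.le
  have hbase := hasFDerivAt_integral_of_dominated_of_fderiv_le
    (μ := volume.restrict (Metric.ball (0 : Plane) ρ)) (x₀ := x)
    (F := fun x y => radiatingKernel k (x - y) * (S y : ℂ))
    (F' := fun x y => (S y : ℂ) • fderiv ℝ (radiatingKernel k) (x - y))
    (bound := fun y => |S y| * (k * (C * ((k * ρ) ^ (-1 / 2 : ℝ) + (k * ρ) ^ (-3 / 2 : ℝ))))) hs
    (Eventually.of_forall fun x => (integrable_radiatedField hk hS hc x).1.restrict)
    (integrable_radiatedField hk hS hc x).restrict hmeas ?_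
    (hS1.abs.mul_const _).restrict ?_
  · refine ⟨Integrable.mono' (g := fun y => |S y| * (k * (C * ((k * ρ) ^ (-1 / 2 : ℝ)
      + (k * ρ) ^ (-3 / 2 : ℝ))))) (hS1.abs.mul_const _).restrict hmeas ?_, hbase⟩
    filter_upwards [ae_restrict_mem measurableSet_ball] with y hy using hbound x hx y hy
  · filter_upwards [ae_restrict_mem measurableSet_ball] with y hy z hz' using hbound z hz' y hy
  · filter_upwards [ae_restrict_mem measurableSet_ball] with y hy z hz'
    have h1 := ((radiatingKernel_contDiffAt hk (hz0 z hz' y hy)).differentiableAt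
      (by simp)).hasFDerivAt
    have h2 : HasFDerivAt (fun x : Plane => x - y) (ContinuousLinearMap.id ℝ Plane) z :=
      (hasFDerivAt_id z).sub_const y
    exact ((h1.comp z h2).mul_const (S y : ℂ)).congr_fderiv (by simp)

/-- With `c` the cosine of the angle between `x - y` and `x`, write `c H_1 + i H_0 = (H_1 + i H_0) +
(c-1) H_1`. The first term is small by the outgoing asymptotics, the second by the angle estimate,
and `1/|x|` beats the weight `√|x|`. -/
theorem exists_radiation_kernel_le {k : ℝ} (hk : 0 < k) (hρ : 0 < ρ) :
    ∃ D : ℝ, 0 ≤ D ∧ ∀ x y : Plane, 2 * ρ + 2 / k + 1 < ‖x‖ → y ∈ Metric.ball (0 : Plane) ρ →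
      ‖fderiv ℝ (radiatingKernel k) (x - y) (‖x‖⁻¹ • x)
        - Complex.I * k * radiatingKernel k (x - y)‖ ≤ D / ‖x‖ := by
  obtain ⟨C₀, hC₀, h₀⟩ := exists_norm_hankel_one_add_le
  obtain ⟨C, hC, hH⟩ := exists_norm_hankel_one_le
  -- In the threshold for `|x|`, the summand `2ρ` gives `|x-y| ≥ |x|/2`, the summand `2/k` then
  -- gives `k|x-y| ≥ 1`, and `1` gives `2|x-y| ≥ 1`.
  refine ⟨2 * C₀ + 2 * k * ρ ^ 2 * C, by positivity, fun x y hx hy => ?_⟩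
  have hk2 : 0 < 2 / k := by positivity
  have hx0 : 1 < ‖x‖ := by linarith
  have hxne : x ≠ 0 := norm_pos_iff.1 (by linarith)
  rw [mem_ball_zero_iff] at hy
  have hz : ‖x‖ / 2 ≤ ‖x - y‖ := by linarith [norm_sub_norm_le x y]
  have hz1 : 0 < ‖x - y‖ := by linarith
  have hzne : x - y ≠ 0 := norm_pos_iff.1 hz1
  set t := k * ‖x - y‖ with ht
  have ht1 : 1 ≤ t := by
    have : 1 / k ≤ ‖x - y‖ := by
      have : 2 / k = 2 * (1 / k) := by ring
      linarith
    rw [div_le_iff₀ hk] at this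
    rw [ht]; linarith
  have htx : k * ‖x‖ / 2 ≤ t := by rw [ht, mul_div_assoc]; gcongr
  have ht0 : 0 < t := by linarith
  set c := inner ℝ (x - y) (‖x‖⁻¹ • x) / ‖x - y‖ with hcdef
  have e : fderiv ℝ (radiatingKernel k) (x - y) (‖x‖⁻¹ • x)
        - Complex.I * k * radiatingKernel k (x - y)
      = -(Complex.I / 4) * (k * ((hankel 1 t + Complex.I * hankel 0 t)
        + ((c - 1 : ℝ) : ℂ) * hankel 1 t)) := by
    rw [fderiv_radiatingKernel hk hzne, radiatingKernel, ← hcdef, ← ht]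
    push_cast
    ring
  have hI : ‖(-(Complex.I / 4) : ℂ)‖ ≤ 1 := by simp; norm_num
  have b1 : ‖hankel 1 t + Complex.I * hankel 0 t‖ ≤ C₀ * (2 / (k * ‖x‖)) := by
    refine (h₀ t ht0).trans (mul_le_mul_of_nonneg_left ?_ hC₀)
    calc t ^ (-3 / 2 : ℝ) ≤ t ^ (-1 : ℝ) := Real.rpow_le_rpow_of_exponent_le ht1 (by norm_num)
      _ = t⁻¹ := Real.rpow_neg_one t
      _ ≤ (k * ‖x‖ / 2)⁻¹ := by gcongr
      _ = _ := by rw [inv_div]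
  have b2 : ‖hankel 1 t‖ ≤ C * 2 := by
    refine (hH t ht0).trans (mul_le_mul_of_nonneg_left ?_ hC)
    have h1 : t ^ (-1 / 2 : ℝ) ≤ 1 := Real.rpow_le_one_of_one_le_of_nonpos ht1 (by norm_num)
    have h2 : t ^ (-3 / 2 : ℝ) ≤ 1 := Real.rpow_le_one_of_one_le_of_nonpos ht1 (by norm_num)
    linarith
  have b3 : |c - 1| ≤ ρ ^ 2 / ‖x‖ := by
    refine (abs_cos_angle_sub_one_le hxne hzne).trans ?_
    have h2 : 1 ≤ 2 * ‖x - y‖ := by linarith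
    calc _ ≤ ρ ^ 2 / (1 * ‖x‖) := by gcongr
      _ = _ := by rw [one_mul]
  rw [e, norm_mul, norm_mul, Complex.norm_real, Real.norm_of_nonneg hk.le]
  calc _ ≤ 1 * (k * (‖hankel 1 t + Complex.I * hankel 0 t‖ + ‖((c - 1 : ℝ) : ℂ) * hankel 1 t‖)) := by
        gcongr
        exact norm_add_le _ _
    _ ≤ 1 * (k * (C₀ * (2 / (k * ‖x‖)) + ρ ^ 2 / ‖x‖ * (C * 2))) := by
        rw [norm_mul, Complex.norm_real, Real.norm_eq_abs]
        gcongr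
    _ = _ := by
        field_simp

theorem radiatedField_sommerfeld {k : ℝ} (hk : 0 < k) (hS : MemLp S 2 volume)
    (hc : HasCompactSupport S) : SommerfeldCondition k (radiatedField k S) := by
  obtain ⟨ρ', hsupp'⟩ := hc.isBounded.subset_ball 0
  obtain ⟨ρ, hρ, hsupp⟩ : ∃ ρ > 0, tsupport S ⊆ Metric.ball 0 ρ :=
    ⟨max ρ' 1, by positivity, hsupp'.trans (Metric.ball_subset_ball (le_max_left _ _))⟩
  have hS1 := integrable_of_memLp_two hS hc
  obtain ⟨D, hD, hK⟩ := exists_radiation_kernel_le hk hρ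
  have hk2 : 0 < 2 / k := by positivity
  have hfar : ∀ᶠ x : Plane in Bornology.cobounded Plane, 2 * ρ + 2 / k + 1 < ‖x‖ := by
    have := tendsto_norm_cobounded_atTop (E := Plane)
    exact this.eventually (eventually_gt_atTop _)
  refine ⟨hfar.mono fun x hx =>
    (radiatedField_hasFDerivAt hk hρ hS hc hsupp (by linarith)).2.differentiableAt, ?_⟩
  have hle : ∀ᶠ x : Plane in Bornology.cobounded Plane,
      ‖((√‖x‖ : ℝ) : ℂ) * (radialDeriv (radiatedField k S) x
        - Complex.I * k * radiatedField k S x)‖ ≤ D * (∫ y, |S y|) / √‖x‖ := by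
    filter_upwards [hfar] with x hx
    have hx0 : 0 < ‖x‖ := by linarith
    obtain ⟨hi, hd⟩ := radiatedField_hasFDerivAt hk hρ hS hc hsupp (x := x) (by linarith)
    have e : radialDeriv (radiatedField k S) x - Complex.I * k * radiatedField k S x
        = ∫ y in Metric.ball 0 ρ, (S y : ℂ) * (fderiv ℝ (radiatingKernel k) (x - y) (‖x‖⁻¹ • x)
        - Complex.I * k * radiatingKernel k (x - y)) := by
      rw [radialDeriv, hd.fderiv, ContinuousLinearMap.integral_apply hi,
        radiatedField_eq_setIntegral k hsupp, ← integral_const_mul, ← integral_sub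
          (hi.apply_continuousLinearMap _)
          ((integrable_radiatedField hk hS hc x).restrict.const_mul _)]
      refine integral_congr_ae (Eventually.of_forall fun y => ?_)
      simp only [smul_apply, smul_eq_mul]
      ring
    have hn : ‖radialDeriv (radiatedField k S) x - Complex.I * k * radiatedField k S x‖
        ≤ D * (∫ y, |S y|) / ‖x‖ := by
      rw [e]
      have hb : Integrable (fun y => |S y| * (D / ‖x‖)) (volume.restrict (Metric.ball 0 ρ)) :=
        (hS1.abs.mul_const _).restrict
      refine (norm_integral_le_of_norm_le hb ?_).trans ?_
      · filter_upwards [ae_restrict_mem measurableSet_ball] with y hy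
        rw [norm_mul, Complex.norm_real, Real.norm_eq_abs]
        exact mul_le_mul_of_nonneg_left (hK x y hx hy) (abs_nonneg _)
      · rw [integral_mul_const]
        have := setIntegral_le_integral (s := Metric.ball (0 : Plane) ρ) hS1.abs
          (Eventually.of_forall fun y => abs_nonneg _)
        calc _ ≤ (∫ y, |S y|) * (D / ‖x‖) := by gcongr
          _ = _ := by ring
    rw [norm_mul, Complex.norm_real, Real.norm_of_nonneg (Real.sqrt_nonneg _)]
    calc _ ≤ √‖x‖ * (D * (∫ y, |S y|) / ‖x‖) := by gcongr
      _ = _ := by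
        have h1 : √‖x‖ ≠ 0 := (Real.sqrt_pos.2 hx0).ne'
        nth_rewrite 2 [← Real.mul_self_sqrt hx0.le]
        field_simp
  refine squeeze_zero_norm' hle ?_
  exact tendsto_const_nhds.div_atTop
    (Real.tendsto_sqrt_atTop.comp (tendsto_norm_cobounded_atTop (E := Plane)))

theorem radiatedField_isRadiatingSolution {k : ℝ} (hk : 0 < k) (hS : MemLp S 2 volume)
    (hc : HasCompactSupport S) : IsRadiatingSolution k S (radiatedField k S) :=
  ⟨radiatedField_continuous hk hS hc, radiatedField_helmholtz hk hS hc,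
    radiatedField_sommerfeld hk hS hc⟩

theorem integrable_helmholtz_mul {k : ℝ} {w : Plane → ℝ} (hw : ContDiff ℝ ∞ w)
    (hwc : HasCompactSupport w) {v : Plane → ℂ} (hv : Continuous v) :
    Integrable fun x => ((Δ w x + k ^ 2 * w x : ℝ) : ℂ) * v x := by
  have hcl := continuous_laplacian (hw.of_le two_le_infty)
  have hwcont := hw.continuous
  have h1 : HasCompactSupport fun x => Δ w x + k ^ 2 * w x :=
    HasCompactSupport.add (f := Δ w) (f' := fun x => k ^ 2 * w x) hwc.laplacian hwc.mul_left
  have h2 : HasCompactSupport fun x => ((Δ w x + k ^ 2 * w x : ℝ) : ℂ) * v x :=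
    HasCompactSupport.mul_right (f := fun x => ((Δ w x + k ^ 2 * w x : ℝ) : ℂ))
      (h1.comp_left (g := fun t : ℝ => (t : ℂ)) (by simp))
  exact Continuous.integrable_of_hasCompactSupport (by fun_prop) h2

/-- Two radiating solutions with the same source agree. -/
theorem IsRadiatingSolution.unique {k : ℝ} (hk : 0 < k) {v v' : Plane → ℂ}
    (h : IsRadiatingSolution k S v) (h' : IsRadiatingSolution k S v') : v = v' := by
  have hz : IsRadiatingSolution k 0 (v - v') := by
    refine ⟨h.continuous.sub h'.continuous, fun w hw hwc => ?_, ?_, ?_⟩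
    · have hi := fun v hv => integrable_helmholtz_mul (k := k) hw hwc (v := v) hv
      simp only [Pi.sub_apply, mul_sub]
      rw [integral_sub (hi v h.continuous) (hi v' h'.continuous), h.helmholtz w hw hwc,
        h'.helmholtz w hw hwc]
      simp
    · filter_upwards [h.radiating.1, h'.radiating.1] with x h1 h2 using h1.sub h2
    · have hlim := h.radiating.2.sub h'.radiating.2
      rw [sub_zero] at hlim
      refine hlim.congr' ?_
      filter_upwards [h.radiating.1, h'.radiating.1] with x h1 h2
      rw [radialDeriv, radialDeriv, radialDeriv, fderiv_sub h1 h2]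
      simp only [sub_apply, Pi.sub_apply]
      ring
  exact sub_eq_zero.1 (hz.eq_zero hk)

theorem IsRadiatingSolution.eq_radiatedField {k : ℝ} (hk : 0 < k) (hS : MemLp S 2 volume)
    (hc : HasCompactSupport S) {v : Plane → ℂ} (h : IsRadiatingSolution k S v) :
    v = radiatedField k S :=
  h.unique hk (radiatedField_isRadiatingSolution hk hS hc)

end

/-! ### The Fourier transform of square integrable functions -/

section

open scoped FourierTransform SchwartzMap

theorem ae_eq_of_integral_test {f g : Plane → ℂ} (hf : LocallyIntegrable f volume)
    (hg : LocallyIntegrable g volume)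
    (h : ∀ w : Plane → ℝ, ContDiff ℝ ∞ w → HasCompactSupport w →
      ∫ x, (w x : ℂ) * f x = ∫ x, (w x : ℂ) * g x) : f =ᵐ[volume] g := by
  refine ae_eq_of_integral_contDiff_smul_eq hf hg fun w hw hwc => ?_
  simpa only [Complex.real_smul] using h w hw hwc

theorem integral_fourier_mul_eq_flip {f g : Plane → ℂ} (hf : Integrable f) (hg : Integrable g) :
    ∫ x, 𝓕 f x * g x = ∫ x, f x * 𝓕 g x := by
  have h := VectorFourier.integral_fourierIntegral_smul_eq_flip (L := innerₗ Plane)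
    Real.continuous_fourierChar continuous_inner hf hg
  rw [flip_innerₗ] at h
  exact h

theorem integral_fourierInv_mul_eq_flip {f g : Plane → ℂ} (hf : Integrable f)
    (hg : Integrable g) : ∫ x, 𝓕⁻ f x * g x = ∫ x, f x * 𝓕⁻ g x := by
  have h := VectorFourier.integral_fourierIntegral_smul_eq_flip (L := -innerₗ Plane)
    Real.continuous_fourierChar continuous_inner.neg hf hg
  rw [show (-innerₗ Plane).flip = -innerₗ Plane from LinearMap.ext fun x => LinearMap.ext fun y =>
    congrArg Neg.neg (real_inner_comm x y)] at h
  exact h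

theorem continuous_fourier {f : Plane → ℂ} (hf : Integrable f) : Continuous (𝓕 f) :=
  VectorFourier.fourierIntegral_continuous Real.continuous_fourierChar continuous_inner hf

theorem continuous_fourierInv {f : Plane → ℂ} (hf : Integrable f) : Continuous (𝓕⁻ f) := by
  rw [show 𝓕⁻ f = fun x => 𝓕 f (-x) from funext fun x => Real.fourierInv_eq_fourier_neg f x]
  exact (continuous_fourier hf).comp continuous_neg

theorem locallyIntegrable_coe_Lp (f : Lp ℂ 2 (volume : Measure Plane)) :
    LocallyIntegrable f volume :=
  (Lp.memLp f).locallyIntegrable (by norm_num)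

/-- The transform on `L²` and the integral transform pair in the same way with test functions: both
pairings move the transform onto the test function, by duality for tempered distributions and by
Fubini respectively. -/
theorem coe_fourier_toLp {f : Plane → ℂ} (hf : Integrable f) (h2 : MemLp f 2 volume) :
    (𝓕 (h2.toLp f) : Lp ℂ 2 volume) =ᵐ[volume] 𝓕 f := by
  refine ae_eq_of_integral_test (locallyIntegrable_coe_Lp _)
    (continuous_fourier hf).locallyIntegrable fun w hw hwc => ?_
  set G : 𝓢(Plane, ℂ) := (hwc.comp_left (g := fun t : ℝ => (t : ℂ)) (by simp)).toSchwartzMap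
    (Complex.ofRealCLM.contDiff.comp hw) with hG
  have hGw : ∀ x, G x = (w x : ℂ) := fun x => rfl
  have h := congrArg (fun T => T G) (Lp.fourier_toTemperedDistribution_eq (h2.toLp f))
  simp only [TemperedDistribution.fourier_apply, Lp.toTemperedDistribution_apply, smul_eq_mul] at h
  simp only [← hGw]
  rw [← h, ← integral_fourier_mul_eq_flip G.integrable hf]
  refine integral_congr_ae ?_
  filter_upwards [h2.coeFn_toLp] with x hx
  rw [hx, SchwartzMap.fourier_coe]

theorem coe_fourierInv_toLp {f : Plane → ℂ} (hf : Integrable f) (h2 : MemLp f 2 volume) :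
    (𝓕⁻ (h2.toLp f) : Lp ℂ 2 volume) =ᵐ[volume] 𝓕⁻ f := by
  refine ae_eq_of_integral_test (locallyIntegrable_coe_Lp _)
    (continuous_fourierInv hf).locallyIntegrable fun w hw hwc => ?_
  set G : 𝓢(Plane, ℂ) := (hwc.comp_left (g := fun t : ℝ => (t : ℂ)) (by simp)).toSchwartzMap
    (Complex.ofRealCLM.contDiff.comp hw) with hG
  have hGw : ∀ x, G x = (w x : ℂ) := fun x => rfl
  have h := congrArg (fun T => T G) (Lp.fourierInv_toTemperedDistribution_eq (h2.toLp f))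
  simp only [TemperedDistribution.fourierInv_apply, Lp.toTemperedDistribution_apply, smul_eq_mul] at h
  simp only [← hGw]
  rw [← h, ← integral_fourierInv_mul_eq_flip G.integrable hf]
  refine integral_congr_ae ?_
  filter_upwards [h2.coeFn_toLp] with x hx
  rw [hx, SchwartzMap.fourierInv_coe]

theorem memLp_fourier {f : Plane → ℂ} (hf : Integrable f) (h2 : MemLp f 2 volume) :
    MemLp (𝓕 f) 2 volume :=
  (memLp_congr_ae (coe_fourier_toLp hf h2)).1 (Lp.memLp _)

/-! ### Frequency cutoffs. -/

/-- The part of `f` with frequencies in the ball of radius `ρ`. -/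
noncomputable def frequencyCutoff (f : Plane → ℂ) (ρ : ℝ) : Plane → ℂ :=
  𝓕⁻ ((Metric.ball 0 ρ).indicator (𝓕 f))

theorem memLp_indicator_fourier {f : Plane → ℂ} (hf : Integrable f) (h2 : MemLp f 2 volume)
    (ρ : ℝ) : MemLp ((Metric.ball 0 ρ).indicator (𝓕 f)) 2 volume :=
  (memLp_fourier hf h2).indicator measurableSet_ball

theorem integrable_indicator_fourier {f : Plane → ℂ} (hf : Integrable f) (ρ : ℝ) :
    Integrable ((Metric.ball 0 ρ).indicator (𝓕 f)) := by
  refine IntegrableOn.integrable_indicator ?_ measurableSet_ball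
  exact ((continuous_fourier hf).continuousOn.integrableOn_compact
    (isCompact_closedBall 0 ρ)).mono_set Metric.ball_subset_closedBall

theorem memLp_frequencyCutoff {f : Plane → ℂ} (hf : Integrable f) (h2 : MemLp f 2 volume)
    (ρ : ℝ) : MemLp (frequencyCutoff f ρ) 2 volume :=
  (memLp_congr_ae (coe_fourierInv_toLp (integrable_indicator_fourier hf ρ)
    (memLp_indicator_fourier hf h2 ρ))).1 (Lp.memLp _)

theorem tendsto_eLpNorm_indicator_ball {g : Plane → ℂ} (hg : MemLp g 2 volume)
    (hgm : Measurable g) :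
    Tendsto (fun ρ : ℝ => eLpNorm ((Metric.ball 0 ρ).indicator g - g) 2 volume) atTop (𝓝 0) := by
  have key : Tendsto (fun ρ : ℝ => ∫⁻ x, ‖((Metric.ball 0 ρ).indicator g - g) x‖ₑ ^ (2 : ℝ)) atTop
      (𝓝 (∫⁻ _ : Plane, 0)) := by
    refine tendsto_lintegral_filter_of_dominated_convergence (fun x => ‖g x‖ₑ ^ (2 : ℝ))
      (Eventually.of_forall fun ρ => ?_) (Eventually.of_forall fun ρ => Eventually.of_forall fun x => ?_)
      ?_ (Eventually.of_forall fun x => ?_)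
    · exact ((hgm.indicator measurableSet_ball).sub hgm).enorm.pow_const _
    · by_cases hx : x ∈ Metric.ball (0 : Plane) ρ
      · simp [indicator_of_mem hx]
      · simp [indicator_of_notMem hx]
    · have h := lintegral_rpow_enorm_lt_top_of_eLpNorm_lt_top (by norm_num) (by norm_num) hg.2
      simpa using h.ne
    · refine tendsto_const_nhds.congr' ?_
      filter_upwards [eventually_gt_atTop ‖x‖] with ρ hρ
      simp [indicator_of_mem (mem_ball_zero_iff.2 hρ)]
  have h1 := (ENNReal.continuous_rpow_const (y := (1 / 2 : ℝ))).tendsto (∫⁻ _ : Plane, 0)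
  have h2 := h1.comp key
  rw [lintegral_zero, ENNReal.zero_rpow_of_pos (by norm_num)] at h2
  refine h2.congr fun ρ => ?_
  rw [eLpNorm_eq_lintegral_rpow_enorm_toReal (by norm_num) (by norm_num)]
  simp

/-- By Plancherel the error has the norm of the tail of the transform outside the ball. -/
theorem tendsto_eLpNorm_frequencyCutoff {f : Plane → ℂ} (hf : Integrable f)
    (h2 : MemLp f 2 volume) :
    Tendsto (fun ρ : ℝ => eLpNorm (frequencyCutoff f ρ - f) 2 volume) atTop (𝓝 0) := by
  have hF := memLp_fourier hf h2
  have e1 : ∀ ρ, eLpNorm (frequencyCutoff f ρ - f) 2 volume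
      = eLpNorm ((Metric.ball 0 ρ).indicator (𝓕 f) - 𝓕 f) 2 volume := fun ρ => by
    set A := (memLp_indicator_fourier hf h2 ρ).toLp with hA
    have hA2 : hF.toLp = 𝓕 (h2.toLp f) := by
      ext1
      exact (hF.coeFn_toLp).trans (coe_fourier_toLp hf h2).symm
    have hsub : (𝓕⁻ (A - hF.toLp) : Lp ℂ 2 volume) = 𝓕⁻ A - 𝓕⁻ hF.toLp :=
      map_sub (Lp.fourierTransformₗᵢ Plane ℂ).symm _ _
    have h3 : (𝓕⁻ (A - hF.toLp) : Lp ℂ 2 volume) =ᵐ[volume] frequencyCutoff f ρ - f := by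
      rw [hsub, hA2, FourierTransform.fourierInv_fourier_eq]
      exact (Lp.coeFn_sub _ _).trans ((coe_fourierInv_toLp (integrable_indicator_fourier hf ρ)
        (memLp_indicator_fourier hf h2 ρ)).sub h2.coeFn_toLp)
    have h4 : (A - hF.toLp : Lp ℂ 2 volume) =ᵐ[volume] (Metric.ball 0 ρ).indicator (𝓕 f) - 𝓕 f :=
      (Lp.coeFn_sub _ _).trans ((memLp_indicator_fourier hf h2 ρ).coeFn_toLp.sub hF.coeFn_toLp)
    rw [← eLpNorm_congr_ae h3, ← eLpNorm_congr_ae h4, ← Lp.enorm_def, ← Lp.enorm_def]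
    have h5 : ‖(𝓕⁻ (A - hF.toLp) : Lp ℂ 2 volume)‖ = ‖A - hF.toLp‖ :=
      (Lp.fourierTransformₗᵢ Plane ℂ).symm.norm_map _
    rw [← ofReal_norm, ← ofReal_norm, h5]
  simp only [e1]
  exact tendsto_eLpNorm_indicator_ball hF (continuous_fourier hf).measurable

/-- For smooth compactly supported `f` the frequency cutoffs converge pointwise. -/
theorem tendsto_frequencyCutoff {f : Plane → ℂ} (hf : ContDiff ℝ ∞ f) (hc : HasCompactSupport f)
    (z : Plane) : Tendsto (fun ρ : ℝ => frequencyCutoff f ρ z) atTop (𝓝 (f z)) := by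
  set G : 𝓢(Plane, ℂ) := hc.toSchwartzMap hf with hG
  have hGf : (G : Plane → ℂ) = f := rfl
  have hint : Integrable (𝓕 f) := by
    rw [← hGf, ← SchwartzMap.fourier_coe]
    exact (𝓕 G).integrable
  have hf1 : Integrable f := hf.continuous.integrable_of_hasCompactSupport hc
  have hinv : 𝓕⁻ (𝓕 f) z = f z := by
    rw [hf1.fourierInv_fourier_eq hint hf.continuous.continuousAt]
  rw [← hinv]
  simp only [frequencyCutoff, Real.fourierInv_eq']
  refine tendsto_integral_filter_of_dominated_convergence (fun x => ‖𝓕 f x‖)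
    (Eventually.of_forall fun ρ => ?_) (Eventually.of_forall fun ρ => Eventually.of_forall fun x => ?_)
    hint.norm (Eventually.of_forall fun x => ?_)
  · have hexp : Continuous fun x : Plane =>
        Complex.exp (((2 * Real.pi * inner ℝ x z : ℝ) : ℂ) * Complex.I) := by fun_prop
    exact hexp.aestronglyMeasurable.smul (integrable_indicator_fourier hf1 ρ).1
  · rw [norm_smul, Complex.norm_exp_ofReal_mul_I, one_mul]
    exact norm_indicator_le_norm_self _ _
  · refine tendsto_const_nhds.congr' ?_
    filter_upwards [eventually_gt_atTop ‖x‖] with ρ hρ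
    rw [indicator_of_mem (mem_ball_zero_iff.2 hρ)]

/-! ### The frequency cutoff in terms of Bessel functions -/

theorem fderiv_exp_inner (x ξ v : Plane) :
    fderiv ℝ (fun ξ : Plane => Complex.exp ((inner ℝ x ξ : ℝ) * Complex.I)) ξ v
      = (inner ℝ x v : ℝ) * Complex.I * Complex.exp ((inner ℝ x ξ : ℝ) * Complex.I) := by
  have h1 : HasFDerivAt (fun ξ : Plane => (inner ℝ x ξ : ℝ)) (innerSL ℝ x) ξ :=
    (innerSL ℝ x).hasFDerivAt
  have h2 : HasFDerivAt (fun ξ : Plane => ((inner ℝ x ξ : ℝ) : ℂ))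
      (Complex.ofRealCLM.comp (innerSL ℝ x)) ξ := Complex.ofRealCLM.hasFDerivAt.comp ξ h1
  rw [((h2.mul_const Complex.I).cexp).fderiv]
  simp
  ring

theorem laplacian_exp_inner (x ξ : Plane) :
    Δ (fun ξ : Plane => Complex.exp ((inner ℝ x ξ : ℝ) * Complex.I)) ξ
      = -(‖x‖ : ℂ) ^ 2 * Complex.exp ((inner ℝ x ξ : ℝ) * Complex.I) := by
  have hc : ContDiff ℝ ∞ fun ξ : Plane => Complex.exp ((inner ℝ x ξ : ℝ) * Complex.I) :=
    (((Complex.ofRealCLM.contDiff.comp (innerSL ℝ x).contDiff).mul contDiff_const)).cexp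
  have h2 : ∀ e, fderiv ℝ (fderiv ℝ fun ξ : Plane =>
      Complex.exp ((inner ℝ x ξ : ℝ) * Complex.I)) ξ e e
      = ((inner ℝ x e : ℝ) * Complex.I) ^ 2 * Complex.exp ((inner ℝ x ξ : ℝ) * Complex.I) := fun e => by
    have hd := ((hc.fderiv_right (m := ∞) (by simp)).differentiable (by simp) ξ).hasFDerivAt
    have h3 := (hd.clm_apply (hasFDerivAt_const e ξ)).fderiv
    rw [show (fun y => fderiv ℝ (fun ξ : Plane => Complex.exp ((inner ℝ x ξ : ℝ) * Complex.I)) y e)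
      = fun y => (inner ℝ x e : ℝ) * Complex.I * Complex.exp ((inner ℝ x y : ℝ) * Complex.I) from
      funext fun y => fderiv_exp_inner x y e] at h3
    have h4 := congrArg (fun T => T e) h3
    rw [fderiv_const_mul (hc.differentiable (by simp) ξ)] at h4
    simp only [smul_apply, fderiv_exp_inner] at h4
    simp only [smul_eq_mul] at h4
    simp at h4
    rw [← h4]
    ring
  rw [laplacian_eq_sum_fderiv, Fin.sum_univ_two, h2, h2]
  have e : (‖x‖ : ℂ) ^ 2 = (x 0 : ℂ) ^ 2 + (x 1 : ℂ) ^ 2 := by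
    have := EuclideanSpace.norm_sq_eq x
    rw [Fin.sum_univ_two] at this
    simp only [Real.norm_eq_abs, sq_abs] at this
    exact_mod_cast this
  rw [e]
  simp only [EuclideanSpace.inner_single_right, conj_trivial, one_mul]
  linear_combination ((x 0 : ℂ) ^ 2 + (x 1 : ℂ) ^ 2)
    * Complex.exp ((inner ℝ x ξ : ℝ) * Complex.I) * Complex.I_sq

/-- As a function of `ξ`, the plane wave solves the Helmholtz equation with wave number `|x|`, so
this is the mean value formula at the origin. -/
theorem integral_exp_inner_unitVec (x : Plane) {r : ℝ} (hr : 0 ≤ r) :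
    ∫ θ in (0)..(2 * Real.pi), Complex.exp ((inner ℝ x (r • unitVec θ) : ℝ) * Complex.I)
      = 2 * Real.pi * besselJ 0 (r * ‖x‖) := by
  have hc : ContDiff ℝ 2 fun ξ : Plane => Complex.exp ((inner ℝ x ξ : ℝ) * Complex.I) :=
    (((Complex.ofRealCLM.contDiff.comp (innerSL ℝ x).contDiff).mul contDiff_const)).cexp
  have h := circle_mean_value (ρ := r + 1) hc.contDiffOn (fun ξ _ => laplacian_exp_inner x ξ)
    ⟨hr, by linarith⟩
  simpa [mul_comm r] using h

/-- `∫ S(y) J_0(k|z-y|) dy`. -/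
noncomputable def besselTransform (S : Plane → ℝ) (k : ℝ) (z : Plane) : ℝ :=
  ∫ y, besselJ 0 (k * ‖z - y‖) * S y

theorem integral_exp_mul_fourier {S : Plane → ℝ} (hS : Integrable S) (z : Plane) {r : ℝ}
    (hr : 0 ≤ r) :
    ∫ θ in (0)..(2 * Real.pi),
      Complex.exp (((2 * Real.pi * inner ℝ (r • unitVec θ) z : ℝ) : ℂ) * Complex.I)
        * 𝓕 (fun y => (S y : ℂ)) (r • unitVec θ)
      = ((2 * Real.pi * besselTransform S (2 * Real.pi * r) z : ℝ) : ℂ) := by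
  have e : ∀ θ y, Complex.exp (((2 * Real.pi * inner ℝ (r • unitVec θ) z : ℝ) : ℂ) * Complex.I)
      * (Complex.exp (((-2 * Real.pi * inner ℝ y (r • unitVec θ) : ℝ) : ℂ) * Complex.I) * S y)
      = Complex.exp ((inner ℝ ((2 * Real.pi) • (z - y)) (r • unitVec θ) : ℝ) * Complex.I) * S y :=
    fun θ y => by
    rw [← mul_assoc, ← Complex.exp_add, ← add_mul, ← Complex.ofReal_add]
    congr 4
    rw [real_inner_comm z, real_inner_smul_left (z - y), inner_sub_left]
    ring
  have hcu := continuous_unitVec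
  have hint : Integrable (fun p : ℝ × Plane =>
      Complex.exp ((inner ℝ ((2 * Real.pi) • (z - p.2)) (r • unitVec p.1) : ℝ) * Complex.I) * S p.2)
      ((volume.restrict (Ioc 0 (2 * Real.pi))).prod volume) := by
    have h1 : Integrable (fun p : ℝ × Plane => (S p.2 : ℂ))
        ((volume.restrict (Ioc 0 (2 * Real.pi))).prod volume) := by
      have h0 : Integrable (fun y => (S y : ℂ)) := hS.ofReal
      exact h0.comp_snd _
    have hexp : Continuous fun p : ℝ × Plane => Complex.exp
        ((inner ℝ ((2 * Real.pi) • (z - p.2)) (r • unitVec p.1) : ℝ) * Complex.I) := by fun_prop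
    exact h1.bdd_mul (c := 1) hexp.aestronglyMeasurable
      (Eventually.of_forall fun p => by rw [Complex.norm_exp_ofReal_mul_I])
  simp only [Real.fourier_eq', smul_eq_mul, ← integral_const_mul, e]
  rw [intervalIntegral.integral_of_le Real.two_pi_pos.le, integral_integral_swap hint,
    besselTransform, ← integral_const_mul, ← integral_complex_ofReal]
  refine integral_congr_ae (Eventually.of_forall fun y => ?_)
  simp only
  rw [integral_mul_const, ← intervalIntegral.integral_of_le Real.two_pi_pos.le,
    integral_exp_inner_unitVec _ hr, norm_smul, Real.norm_of_nonneg Real.two_pi_pos.le,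
    show r * (2 * Real.pi * ‖z - y‖) = 2 * Real.pi * r * ‖z - y‖ by ring]
  push_cast
  ring

/-- `(1/2π) ∫_0^K k ∫ S(y) J_0(k|z-y|) dy dk`. -/
noncomputable def lowPass (S : Plane → ℝ) (K : ℝ) (z : Plane) : ℝ :=
  (2 * Real.pi)⁻¹ * ∫ k in (0)..K, k * besselTransform S k z

/-- Fourier inversion in polar coordinates: the angular integral turns plane waves into `J_0`. The
substitution `k = 2πr` accounts for the radius `K/2π` and the prefactor. -/
theorem frequencyCutoff_eq_lowPass {S : Plane → ℝ} (hS : Integrable S) {K : ℝ} (hK : 0 ≤ K)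
    (z : Plane) :
    frequencyCutoff (fun y => (S y : ℂ)) (K / (2 * Real.pi)) z = (lowPass S K z : ℂ) := by
  set ρ := K / (2 * Real.pi) with hρ
  have hρ0 : 0 ≤ ρ := div_nonneg hK Real.two_pi_pos.le
  have hi := integrable_indicator_fourier hS.ofReal ρ
  have hi' : Integrable fun ξ : Plane => Complex.exp (((2 * Real.pi * inner ℝ ξ z : ℝ) : ℂ)
      * Complex.I) * (Metric.ball 0 ρ).indicator (𝓕 fun y => (S y : ℂ)) ξ := by
    have hexp : Continuous fun x : Plane =>
        Complex.exp (((2 * Real.pi * inner ℝ x z : ℝ) : ℂ) * Complex.I) := by fun_prop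
    exact hi.bdd_mul (c := 1) hexp.aestronglyMeasurable
      (Eventually.of_forall fun p => by rw [Complex.norm_exp_ofReal_mul_I])
  have hmode : ∀ r ∈ Ioi (0 : ℝ), (r • ∫ θ in (0)..(2 * Real.pi),
      Complex.exp (((2 * Real.pi * inner ℝ (r • unitVec θ) z : ℝ) : ℂ) * Complex.I)
        * (Metric.ball 0 ρ).indicator (𝓕 fun y => (S y : ℂ)) (r • unitVec θ))
      = (Ioo 0 ρ).indicator (fun r : ℝ =>
        ((2 * Real.pi * r * besselTransform S (2 * Real.pi * r) z : ℝ) : ℂ)) r := fun r hr => by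
    have hr' : (0 : ℝ) < r := hr
    by_cases hlt : r < ρ
    · have hm : ∀ θ, r • unitVec θ ∈ Metric.ball (0 : Plane) ρ := fun θ => by
        rwa [mem_ball_zero_iff, norm_smul_unitVec hr'.le]
      rw [indicator_of_mem (show r ∈ Ioo 0 ρ from ⟨hr', hlt⟩)]
      simp only [fun θ => indicator_of_mem (hm θ) (𝓕 fun y => (S y : ℂ))]
      rw [integral_exp_mul_fourier hS z hr'.le, Complex.real_smul]
      push_cast
      ring
    · have hm : ∀ θ, r • unitVec θ ∉ Metric.ball (0 : Plane) ρ := fun θ => by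
        rwa [mem_ball_zero_iff, norm_smul_unitVec hr'.le]
      rw [indicator_of_notMem fun h => hlt h.2]
      simp only [fun θ => indicator_of_notMem (hm θ) (𝓕 fun y => (S y : ℂ))]
      simp
  rw [frequencyCutoff, Real.fourierInv_eq']
  simp only [smul_eq_mul]
  rw [integral_polar hi', setIntegral_congr_fun measurableSet_Ioi hmode,
    setIntegral_indicator measurableSet_Ioo, inter_eq_right.2 Ioo_subset_Ioi_self,
    ← integral_Ioc_eq_integral_Ioo, ← intervalIntegral.integral_of_le hρ0,
    intervalIntegral.integral_ofReal, lowPass]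
  congr 1
  have h := intervalIntegral.integral_comp_mul_left (a := 0) (b := ρ)
    (fun k => k * besselTransform S k z) (c := 2 * Real.pi) Real.two_pi_pos.ne'
  rw [h, mul_zero, hρ, mul_div_cancel₀ _ Real.two_pi_pos.ne', smul_eq_mul]

theorem lowPass_eq_re {S : Plane → ℝ} (hS : Integrable S) {K : ℝ} (hK : 0 ≤ K) :
    lowPass S K = fun z => (frequencyCutoff (fun y => (S y : ℂ)) (K / (2 * Real.pi)) z).re := by
  funext z
  rw [frequencyCutoff_eq_lowPass hS hK, Complex.ofReal_re]

theorem memLp_lowPass {S : Plane → ℝ} (hS : Integrable S) (h2 : MemLp S 2 volume) {K : ℝ}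
    (hK : 0 ≤ K) : MemLp (lowPass S K) 2 volume := by
  rw [lowPass_eq_re hS hK]
  exact (memLp_frequencyCutoff hS.ofReal h2.ofReal _).re

theorem tendsto_eLpNorm_lowPass {S : Plane → ℝ} (hS : Integrable S) (h2 : MemLp S 2 volume) :
    Tendsto (fun K : ℝ => eLpNorm (fun z => lowPass S K z - S z) 2 volume) atTop (𝓝 0) := by
  have h := (tendsto_eLpNorm_frequencyCutoff hS.ofReal h2.ofReal).comp
    (tendsto_id.atTop_div_const Real.two_pi_pos)
  refine h.congr' ?_
  filter_upwards [eventually_ge_atTop 0] with K hK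
  refine eLpNorm_congr_norm_ae (Eventually.of_forall fun z => ?_)
  have e := frequencyCutoff_eq_lowPass hS hK z
  simp only [Pi.sub_apply, id]
  rw [show (RCLike.ofReal (S z) : ℂ) = (S z : ℂ) from rfl]
  erw [e]
  rw [← Complex.ofReal_sub, Complex.norm_real]

theorem tendsto_lowPass {S : Plane → ℝ} (hS : ContDiff ℝ ∞ S) (hc : HasCompactSupport S)
    (z : Plane) : Tendsto (fun K : ℝ => lowPass S K z) atTop (𝓝 (S z)) := by
  have hS1 : Integrable S := hS.continuous.integrable_of_hasCompactSupport hc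
  have h := (tendsto_frequencyCutoff (f := fun y => (S y : ℂ)) (Complex.ofRealCLM.contDiff.comp hS)
    (hc.comp_left (g := fun t : ℝ => (t : ℂ)) (by simp)) z).comp
    (tendsto_id.atTop_div_const Real.two_pi_pos)
  have h2 := (Complex.continuous_re.tendsto _).comp h
  refine h2.congr' ?_
  filter_upwards [eventually_ge_atTop 0] with K hK
  rw [lowPass_eq_re hS1 hK]
  rfl

end

/-! ### Boundary data of the radiated field -/

theorem dist_circle_le {R ρ : ℝ} (hR : 0 ≤ R) {y : Plane} (hy : ‖y‖ ≤ ρ) (θ : ℝ) :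
    R - ρ ≤ ‖R • unitVec θ - y‖ := by
  have := norm_sub_norm_le (R • unitVec θ) y
  rw [norm_smul_unitVec hR] at this
  linarith

theorem abs_directionFactor_le (R : ℝ) (z : Plane) (θ : ℝ) : |directionFactor R z θ| ≤ 1 := by
  rw [directionFactor, real_inner_smul_left, abs_mul, abs_inv, abs_norm]
  by_cases h : z - R • unitVec θ = 0
  · simp [h]
  · have h0 : 0 < ‖z - R • unitVec θ‖ := norm_pos_iff.2 h
    rw [inv_mul_le_iff₀ h0, mul_one]
    simpa [norm_unitVec] using abs_real_inner_le_norm (z - R • unitVec θ) (unitVec θ)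

theorem abs_besselJ_one_le (t : ℝ) : |besselJ 1 t| ≤ ‖hankel 1 t‖ := by
  simpa [hankel] using Complex.abs_re_le_norm (hankel 1 t)

theorem abs_neumannN_one_le (t : ℝ) : |neumannN 1 t| ≤ ‖hankel 1 t‖ := by
  simpa [hankel] using Complex.abs_im_le_norm (hankel 1 t)

/-- The field radiated by `S`, as a function of position and wave number. -/
noncomputable def sourceField (S : Plane → ℝ) (x : Plane) (k : ℝ) : ℂ := radiatedField k S x

section

variable {S : Plane → ℝ} {R ρ : ℝ}

theorem eq_zero_of_norm_gt (hρ : tsupport S ⊆ Metric.closedBall 0 ρ) {y : Plane} (hy : ρ < ‖y‖) :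
    S y = 0 :=
  image_eq_zero_of_notMem_tsupport fun h => hy.not_ge (mem_closedBall_zero_iff.1 (hρ h))

/-- Points of the circle stay at distance at least `R - ρ` from the support, so the singularity of
the kernel is never met and the bound is uniform in the angle. -/
theorem exists_norm_sourceField_le (hR : 0 ≤ R) (hρR : ρ < R) (hS : Integrable S)
    (hρ : tsupport S ⊆ Metric.closedBall 0 ρ) :
    ∃ C : ℝ, 0 ≤ C ∧ ∀ k > 0, ∀ θ, ‖sourceField S (R • unitVec θ) k‖ ≤ C * k ^ (-1 / 2 : ℝ) := by
  obtain ⟨C, hC, h⟩ := exists_norm_radiatingKernel_le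
  have hδ : 0 < R - ρ := sub_pos.2 hρR
  have hi : 0 ≤ ∫ y, |S y| := integral_nonneg fun y => abs_nonneg _
  refine ⟨C * (R - ρ) ^ (-1 / 2 : ℝ) * ∫ y, |S y|, by positivity, fun k hk θ => ?_⟩
  have hk' : (0 : ℝ) < k := hk
  have hb : Integrable fun y => C * (k * (R - ρ)) ^ (-1 / 2 : ℝ) * |S y| := hS.abs.const_mul _
  refine (norm_integral_le_of_norm_le hb (Eventually.of_forall fun y => ?_)).trans_eq ?_
  · by_cases hy : ‖y‖ ≤ ρ
    · have hd := dist_circle_le hR hy θ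
      have hne : R • unitVec θ - y ≠ 0 := norm_pos_iff.1 (hδ.trans_le hd)
      rw [norm_mul, Complex.norm_real, Real.norm_eq_abs]
      refine mul_le_mul_of_nonneg_right ((h k hk' _ hne).trans ?_) (abs_nonneg _)
      exact mul_le_mul_of_nonneg_left (Real.rpow_le_rpow_of_nonpos (mul_pos hk' hδ)
        (mul_le_mul_of_nonneg_left hd hk'.le) (by norm_num)) hC
    · rw [eq_zero_of_norm_gt hρ (not_le.1 hy)]
      simp
  · rw [integral_const_mul, Real.mul_rpow hk'.le hδ.le]
    ring

theorem continuousOn_sourceField (hR : 0 ≤ R) (hρR : ρ < R) (hS : MemLp S 2 volume)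
    (hc : HasCompactSupport S) (hρ : tsupport S ⊆ Metric.closedBall 0 ρ) :
    ContinuousOn (fun p : ℝ × ℝ => sourceField S (R • unitVec p.1) p.2) (univ ×ˢ Ioi 0) := by
  obtain ⟨C, hC, h⟩ := exists_norm_radiatingKernel_le
  have hδ : 0 < R - ρ := sub_pos.2 hρR
  have hS1 := integrable_of_memLp_two hS hc
  rintro ⟨θ₀, k₀⟩ ⟨-, hk₀⟩
  have hk₀' : (0 : ℝ) < k₀ := hk₀
  have hcu := continuous_unitVec
  refine ContinuousAt.continuousWithinAt ?_
  have hev : ∀ᶠ p : ℝ × ℝ in 𝓝 (θ₀, k₀), k₀ / 2 < p.2 :=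
    (continuous_snd.tendsto (θ₀, k₀)).eventually (lt_mem_nhds (by simpa using half_lt_self hk₀'))
  refine continuousAt_of_dominated
    (bound := fun y => C * (k₀ / 2 * (R - ρ)) ^ (-1 / 2 : ℝ) * |S y|) ?_ ?_ (hS1.abs.const_mul _)
    (Eventually.of_forall fun y => ?_)
  · filter_upwards [hev] with p hp
    exact (integrable_radiatedField (by linarith) hS hc _).1
  · filter_upwards [hev] with p hp
    have hp0 : 0 < p.2 := by linarith
    refine Eventually.of_forall fun y => ?_
    by_cases hy : ‖y‖ ≤ ρ
    · have hd := dist_circle_le hR hy p.1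
      have hne : R • unitVec p.1 - y ≠ 0 := norm_pos_iff.1 (hδ.trans_le hd)
      rw [norm_mul, Complex.norm_real, Real.norm_eq_abs]
      refine mul_le_mul_of_nonneg_right ((h _ hp0 _ hne).trans ?_) (abs_nonneg _)
      exact mul_le_mul_of_nonneg_left (Real.rpow_le_rpow_of_nonpos (by positivity)
        (mul_le_mul hp.le hd hδ.le hp0.le) (by norm_num)) hC
    · rw [eq_zero_of_norm_gt hρ (not_le.1 hy)]
      simp
  · by_cases hy : ‖y‖ ≤ ρ
    · have hd := dist_circle_le hR hy θ₀
      have hpos : 0 < k₀ * ‖R • unitVec θ₀ - y‖ := mul_pos hk₀' (hδ.trans_le hd)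
      have h1 : ContinuousAt (fun p : ℝ × ℝ => p.2 * ‖R • unitVec p.1 - y‖) (θ₀, k₀) := by fun_prop
      exact (continuousAt_const.mul (ContinuousAt.comp (g := hankel 0)
        (f := fun p : ℝ × ℝ => p.2 * ‖R • unitVec p.1 - y‖)
        (hankel_zero_hasDerivAt hpos).continuousAt h1)).mul continuousAt_const
    · simp only [eq_zero_of_norm_gt hρ (not_le.1 hy), Complex.ofReal_zero, mul_zero]
      exact continuousAt_const

theorem norm_sub_circle_pos (hR : 0 ≤ R) {z : Plane} (hz : z ∈ Metric.ball (0 : Plane) R) (θ : ℝ) :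
    0 < ‖z - R • unitVec θ‖ := by
  have h := dist_circle_le hR (le_refl ‖z‖) θ
  rw [norm_sub_rev] at h
  rw [mem_ball_zero_iff] at hz
  linarith

theorem continuous_directionFactor (hR : 0 ≤ R) {z : Plane} (hz : z ∈ Metric.ball (0 : Plane) R) :
    Continuous (directionFactor R z) := by
  have hcu := continuous_unitVec
  have h : Continuous fun θ => ‖z - R • unitVec θ‖⁻¹ :=
    Continuous.inv₀ (by fun_prop) fun θ => (norm_sub_circle_pos hR hz θ).ne'
  unfold directionFactor
  fun_prop

theorem continuousOn_integrand (hR : 0 ≤ R) (hρR : ρ < R) (hS : MemLp S 2 volume)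
    (hc : HasCompactSupport S) (hρ : tsupport S ⊆ Metric.closedBall 0 ρ) {z : Plane}
    (hz : z ∈ Metric.ball (0 : Plane) R) :
    ContinuousOn (fun p : ℝ × ℝ => directionFactor R z p.1
      * waveIntegrand R (sourceField S) z p.1 p.2) (univ ×ˢ Ioi 0) := by
  have hcu := continuous_unitVec
  have h1 := continuousOn_sourceField hR hρR hS hc hρ
  have hd : ContinuousOn (fun p : ℝ × ℝ => directionFactor R z p.1) (univ ×ˢ Ioi 0) :=
    ((continuous_directionFactor hR hz).comp continuous_fst).continuousOn
  have hdist : Continuous fun p : ℝ × ℝ => p.2 * ‖z - R • unitVec p.1‖ := by fun_prop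
  have hJ : ContinuousOn (fun p : ℝ × ℝ => besselJ 1 (p.2 * ‖z - R • unitVec p.1‖))
      (univ ×ˢ Ioi 0) := (continuous_besselJ_one.comp hdist).continuousOn
  have hN : ContinuousOn (fun p : ℝ × ℝ => neumannN 1 (p.2 * ‖z - R • unitVec p.1‖))
      (univ ×ˢ Ioi 0) := fun p hp =>
    (ContinuousAt.comp (g := neumannN 1) (f := fun p : ℝ × ℝ => p.2 * ‖z - R • unitVec p.1‖)
      (neumannN_one_continuousAt (mul_pos hp.2 (norm_sub_circle_pos hR hz p.1)))
      hdist.continuousAt).continuousWithinAt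
  have hre := Complex.continuous_re.comp_continuousOn h1
  have him := Complex.continuous_im.comp_continuousOn h1
  exact hd.mul ((continuous_snd.pow 2).continuousOn.mul ((him.mul hN).add (hre.mul hJ)))

theorem abs_integrand_le {C : ℝ} (hR : 0 ≤ R) (hC : 0 ≤ C)
    (hH : ∀ t : ℝ, 0 < t → ‖hankel 1 t‖ ≤ C * (t ^ (-1 / 2 : ℝ) + t ^ (-3 / 2 : ℝ))) {z : Plane}
    (hz : z ∈ Metric.ball (0 : Plane) R) {u : Plane → ℝ → ℂ} {k : ℝ} (hk : 0 < k) (θ : ℝ) {B : ℝ}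
    (hB : ‖u (R • unitVec θ) k‖ ≤ B) :
    |directionFactor R z θ * waveIntegrand R u z θ k|
      ≤ 2 * k ^ 2 * B * (C * ((k * (R - ‖z‖)) ^ (-1 / 2 : ℝ) + (k * (R - ‖z‖)) ^ (-3 / 2 : ℝ))) := by
  have hB0 : 0 ≤ B := (norm_nonneg _).trans hB
  have hδ : 0 < R - ‖z‖ := sub_pos.2 (mem_ball_zero_iff.1 hz)
  have hd : R - ‖z‖ ≤ ‖z - R • unitVec θ‖ := by
    rw [norm_sub_rev]; exact dist_circle_le hR le_rfl θ
  set t := k * ‖z - R • unitVec θ‖ with ht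
  have ht0 : 0 < t := mul_pos hk (norm_sub_circle_pos hR hz θ)
  have hle := norm_hankel_one_le_of_le hC (mul_pos hk hδ)
    (show k * (R - ‖z‖) ≤ t from mul_le_mul_of_nonneg_left hd hk.le) (hH t ht0)
  set D := C * ((k * (R - ‖z‖)) ^ (-1 / 2 : ℝ) + (k * (R - ‖z‖)) ^ (-3 / 2 : ℝ)) with hD
  have h1 : |(u (R • unitVec θ) k).im * neumannN 1 t| ≤ B * D := by
    rw [abs_mul]
    exact mul_le_mul ((Complex.abs_im_le_norm _).trans hB) ((abs_neumannN_one_le t).trans hle)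
      (abs_nonneg _) hB0
  have h2 : |(u (R • unitVec θ) k).re * besselJ 1 t| ≤ B * D := by
    rw [abs_mul]
    exact mul_le_mul ((Complex.abs_re_le_norm _).trans hB) ((abs_besselJ_one_le t).trans hle)
      (abs_nonneg _) hB0
  rw [waveIntegrand, ← ht, abs_mul, abs_mul, abs_of_nonneg (sq_nonneg k)]
  have h3 : |(u (R • unitVec θ) k).im * neumannN 1 t + (u (R • unitVec θ) k).re * besselJ 1 t|
      ≤ 2 * (B * D) := (abs_add_le _ _).trans (by linarith)
  calc _ ≤ 1 * (k ^ 2 * (2 * (B * D))) :=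
        mul_le_mul (abs_directionFactor_le R z θ)
          (mul_le_mul_of_nonneg_left h3 (sq_nonneg k)) (by positivity) zero_le_one
    _ = _ := by ring

/-- Near `k = 0` the field contributes at worst `k^(-1/2)` and the Bessel factors `k^(-3/2)`; the
weight `k^2` compensates exactly, so the integrand is bounded. -/
theorem indicatorConvergesOn_Ioc (hR : 0 ≤ R) (hρR : ρ < R) (hS : MemLp S 2 volume)
    (hc : HasCompactSupport S) (hρ : tsupport S ⊆ Metric.closedBall 0 ρ) {z : Plane}
    (hz : z ∈ Metric.ball (0 : Plane) R) (K : ℝ) :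
    IndicatorConvergesOn (Ioc 0 K) R (sourceField S) z := by
  obtain ⟨C, hC, hH⟩ := exists_norm_hankel_one_le
  obtain ⟨B, hB, hu⟩ := exists_norm_sourceField_le hR hρR (integrable_of_memLp_two hS hc) hρ
  have hδ : 0 < R - ‖z‖ := sub_pos.2 (mem_ball_zero_iff.1 hz)
  have hfin : (volume.prod volume) (Ioc 0 (2 * Real.pi) ×ˢ Ioc 0 K) ≠ ⊤ := by
    rw [Measure.prod_prod]
    exact (ENNReal.mul_lt_top measure_Ioc_lt_top measure_Ioc_lt_top).ne
  refine Integrable.mono' (integrableOn_const (C := 2 * B * C * (K * (R - ‖z‖) ^ (-1 / 2 : ℝ)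
    + (R - ‖z‖) ^ (-3 / 2 : ℝ))) hfin) ?_ ?_
  · exact ((continuousOn_integrand hR hρR hS hc hρ hz).mono
      (prod_mono (subset_univ _) Ioc_subset_Ioi_self)).aestronglyMeasurable
      (measurableSet_Ioc.prod measurableSet_Ioc)
  · filter_upwards [ae_restrict_mem (measurableSet_Ioc.prod measurableSet_Ioc)] with p hp
    have hk : 0 < p.2 := hp.2.1
    rw [Real.norm_eq_abs]
    refine (abs_integrand_le hR hC hH hz hk p.1 (hu _ hk p.1)).trans ?_
    have e : 2 * p.2 ^ 2 * (B * p.2 ^ (-1 / 2 : ℝ)) * (C * ((p.2 * (R - ‖z‖)) ^ (-1 / 2 : ℝ)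
        + (p.2 * (R - ‖z‖)) ^ (-3 / 2 : ℝ)))
        = 2 * B * C * (p.2 * (R - ‖z‖) ^ (-1 / 2 : ℝ) + (R - ‖z‖) ^ (-3 / 2 : ℝ)) := by
      rw [Real.mul_rpow hk.le hδ.le, Real.mul_rpow hk.le hδ.le]
      have e1 : p.2 ^ 2 * p.2 ^ (-1 / 2 : ℝ) * p.2 ^ (-1 / 2 : ℝ) = p.2 := by
        rw [← Real.rpow_natCast, ← Real.rpow_add hk, ← Real.rpow_add hk]
        norm_num
      have e2 : p.2 ^ 2 * p.2 ^ (-1 / 2 : ℝ) * p.2 ^ (-3 / 2 : ℝ) = 1 := by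
        rw [← Real.rpow_natCast, ← Real.rpow_add hk, ← Real.rpow_add hk]
        norm_num
      linear_combination 2 * B * C * (R - ‖z‖) ^ (-1 / 2 : ℝ) * e1
        + 2 * B * C * (R - ‖z‖) ^ (-3 / 2 : ℝ) * e2
    rw [e]
    have := hp.2.2
    gcongr

/-! ### The angular integral -/

/-- The minus sign in `N_0' = -N_1` is absorbed by the direction factor, which points from the
circle towards `z`. -/
theorem fderiv_planeNeumann_circle {k : ℝ} (hk : 0 < k) (hR : 0 ≤ R) {z : Plane}
    (hz : z ∈ Metric.ball (0 : Plane) R) (θ : ℝ) :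
    fderiv ℝ (planeNeumann k) (R • unitVec θ - z) (unitVec θ)
      = ((k * directionFactor R z θ * neumannN 1 (k * ‖z - R • unitVec θ‖) : ℝ) : ℂ) := by
  have h0 := norm_sub_circle_pos hR hz θ
  have hne : R • unitVec θ - z ≠ 0 := by
    rw [← norm_pos_iff, norm_sub_rev]; exact h0
  rw [fderiv_planeNeumann hk hne, directionFactor, norm_sub_rev, real_inner_smul_left,
    ← neg_sub z, inner_neg_left]
  congr 1
  ring

theorem fderiv_planeBessel_circle (k : ℝ) (hR : 0 ≤ R) {z : Plane}
    (hz : z ∈ Metric.ball (0 : Plane) R) (θ : ℝ) :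
    fderiv ℝ (planeBessel k) (R • unitVec θ - z) (unitVec θ)
      = ((k * directionFactor R z θ * besselJ 1 (k * ‖z - R • unitVec θ‖) : ℝ) : ℂ) := by
  have h0 := norm_sub_circle_pos hR hz θ
  have hne : R • unitVec θ - z ≠ 0 := by
    rw [← norm_pos_iff, norm_sub_rev]; exact h0
  rw [fderiv_planeBessel k hne, directionFactor, norm_sub_rev, real_inner_smul_left,
    ← neg_sub z, inner_neg_left]
  congr 1
  ring

/-- The contribution of a point source at `y` to the indicator function at `z`. -/
noncomputable def boundaryKernel (R k : ℝ) (z : Plane) (θ : ℝ) (y : Plane) : ℝ :=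
  k * directionFactor R z θ * (besselJ 0 (k * ‖R • unitVec θ - y‖)
      * neumannN 1 (k * ‖z - R • unitVec θ‖)
    - neumannN 0 (k * ‖R • unitVec θ - y‖) * besselJ 1 (k * ‖z - R • unitVec θ‖))

theorem integral_boundaryKernel {k : ℝ} (hk : 0 < k) (hR : 0 ≤ R) {y z : Plane}
    (hy : y ∈ Metric.ball (0 : Plane) R) (hz : z ∈ Metric.ball (0 : Plane) R) :
    ∫ θ in (0)..(2 * Real.pi), boundaryKernel R k z θ y = 4 * besselJ 0 (k * ‖y - z‖) / R := by
  have h := bessel_neumann_kernel hk hy hz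
  simp only [fderiv_planeNeumann_circle hk hR hz, fderiv_planeBessel_circle k hR hz, planeBessel,
    planeNeumann] at h
  have e : ∀ θ, (besselJ 0 (k * ‖R • unitVec θ - y‖) : ℂ)
      * ((k * directionFactor R z θ * neumannN 1 (k * ‖z - R • unitVec θ‖) : ℝ) : ℂ)
      - (neumannN 0 (k * ‖R • unitVec θ - y‖) : ℂ)
      * ((k * directionFactor R z θ * besselJ 1 (k * ‖z - R • unitVec θ‖) : ℝ) : ℂ)
      = ((boundaryKernel R k z θ y : ℝ) : ℂ) := fun θ => by
    rw [boundaryKernel]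
    push_cast
    ring
  simp only [e, intervalIntegral.integral_ofReal] at h
  exact_mod_cast h

theorem continuousOn_boundaryKernel {k : ℝ} (hk : 0 < k) (hR : 0 ≤ R) (hρR : ρ < R) {z : Plane}
    (hz : z ∈ Metric.ball (0 : Plane) R) :
    ContinuousOn (fun p : ℝ × Plane => boundaryKernel R k z p.1 p.2)
      (univ ×ˢ Metric.closedBall 0 ρ) := by
  have hcu := continuous_unitVec
  have hd : Continuous fun p : ℝ × Plane => directionFactor R z p.1 :=
    (continuous_directionFactor hR hz).comp continuous_fst
  have hJ0 : Continuous fun p : ℝ × Plane => besselJ 0 (k * ‖R • unitVec p.1 - p.2‖) :=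
    continuous_besselJ_zero.comp (by fun_prop)
  have hJ1 : Continuous fun p : ℝ × Plane => besselJ 1 (k * ‖z - R • unitVec p.1‖) :=
    continuous_besselJ_one.comp (by fun_prop)
  have hN1 : Continuous fun p : ℝ × Plane => neumannN 1 (k * ‖z - R • unitVec p.1‖) :=
    continuous_iff_continuousAt.2 fun p => ContinuousAt.comp (g := neumannN 1)
      (f := fun p : ℝ × Plane => k * ‖z - R • unitVec p.1‖)
      (neumannN_one_continuousAt (mul_pos hk (norm_sub_circle_pos hR hz p.1)))
      (Continuous.continuousAt (by fun_prop))
  have hN0 : ContinuousOn (fun p : ℝ × Plane => neumannN 0 (k * ‖R • unitVec p.1 - p.2‖))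
      (univ ×ˢ Metric.closedBall 0 ρ) := fun p hp => by
    have hpos : 0 < ‖R • unitVec p.1 - p.2‖ :=
      (sub_pos.2 hρR).trans_le (dist_circle_le hR (mem_closedBall_zero_iff.1 hp.2) p.1)
    exact (ContinuousAt.comp (g := neumannN 0)
      (f := fun p : ℝ × Plane => k * ‖R • unitVec p.1 - p.2‖)
      (neumannN_zero_continuousAt (mul_pos hk hpos))
      (Continuous.continuousAt (by fun_prop))).continuousWithinAt
  exact (continuous_const.mul hd).continuousOn.mul
    ((hJ0.mul hN1).continuousOn.sub (hN0.mul hJ1.continuousOn))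

/-- The imaginary and real parts of `Φ` are `J_0/4` and `-N_0/4`, which is why the indicator pairs
`Im u` with `N_1` and `Re u` with `J_1`. -/
theorem integrand_eq_integral {k : ℝ} (hk : 0 < k) (hS : MemLp S 2 volume)
    (hc : HasCompactSupport S) (hρ : tsupport S ⊆ Metric.closedBall 0 ρ) (z : Plane) (θ : ℝ) :
    directionFactor R z θ * waveIntegrand R (sourceField S) z θ k
      = k / 4 * ∫ y in Metric.closedBall 0 ρ, S y * boundaryKernel R k z θ y := by
  have hi := integrable_radiatedField hk hS hc (R • unitVec θ)
  have him : (sourceField S (R • unitVec θ) k).im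
      = ∫ y, besselJ 0 (k * ‖R • unitVec θ - y‖) / 4 * S y := by
    have h := Complex.imCLM.integral_comp_comm hi
    refine Eq.trans h.symm (integral_congr_ae (Eventually.of_forall fun y => ?_))
    simp [radiatingKernel, hankel]
    left
    ring
  have hre : (sourceField S (R • unitVec θ) k).re
      = ∫ y, -(neumannN 0 (k * ‖R • unitVec θ - y‖) / 4) * S y := by
    have h := Complex.reCLM.integral_comp_comm hi
    refine Eq.trans h.symm (integral_congr_ae (Eventually.of_forall fun y => ?_))
    simp [radiatingKernel, hankel]
    left
    ring
  have i1 : Integrable fun y => besselJ 0 (k * ‖R • unitVec θ - y‖) / 4 * S y := by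
    refine (Complex.imCLM.integrable_comp hi).congr (Eventually.of_forall fun y => ?_)
    simp [radiatingKernel, hankel]
    left
    ring
  have i2 : Integrable fun y => -(neumannN 0 (k * ‖R • unitVec θ - y‖) / 4) * S y := by
    refine (Complex.reCLM.integrable_comp hi).congr (Eventually.of_forall fun y => ?_)
    simp [radiatingKernel, hankel]
    left
    ring
  rw [setIntegral_eq_integral_of_forall_compl_eq_zero fun y hy => by
    rw [eq_zero_of_norm_gt hρ (not_le.1 fun h => hy (mem_closedBall_zero_iff.2 h)), zero_mul]]
  rw [waveIntegrand, him, hre, ← integral_mul_const, ← integral_mul_const,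
    ← integral_add (i1.mul_const _) (i2.mul_const _), ← integral_const_mul, ← integral_const_mul,
    ← integral_const_mul]
  refine integral_congr_ae (Eventually.of_forall fun y => ?_)
  simp only [boundaryKernel]
  ring

/-- Fubini over the circle and the support of `S`, then the kernel identity: `k/4` times `4/R`. -/
theorem integral_integrand {k : ℝ} (hk : 0 < k) (hR : 0 ≤ R) (hρR : ρ < R) (hS : MemLp S 2 volume)
    (hc : HasCompactSupport S) (hρ : tsupport S ⊆ Metric.closedBall 0 ρ) {z : Plane}
    (hz : z ∈ Metric.ball (0 : Plane) R) :
    ∫ θ in Ioc 0 (2 * Real.pi), directionFactor R z θ * waveIntegrand R (sourceField S) z θ k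
      = k / R * besselTransform S k z := by
  have hS1 := integrable_of_memLp_two hS hc
  have hW := continuousOn_boundaryKernel hk hR hρR hz
  obtain ⟨M, hM⟩ := ((isCompact_Icc (a := (0 : ℝ)) (b := 2 * Real.pi)).prod
    (isCompact_closedBall (0 : Plane) ρ)).exists_bound_of_continuousOn
    (hW.mono (prod_mono (subset_univ _) Subset.rfl))
  have hint : Integrable (fun p : ℝ × Plane => S p.2 * boundaryKernel R k z p.1 p.2)
      ((volume.restrict (Ioc 0 (2 * Real.pi))).prod (volume.restrict (Metric.closedBall 0 ρ))) := by
    have h1 : Integrable (fun p : ℝ × Plane => S p.2)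
        ((volume.restrict (Ioc 0 (2 * Real.pi))).prod (volume.restrict (Metric.closedBall 0 ρ))) :=
      (hS1.restrict (s := Metric.closedBall 0 ρ)).comp_snd _
    refine h1.mul_bdd (c := M) ?_ ?_ <;> rw [Measure.prod_restrict]
    · exact (hW.mono (prod_mono (subset_univ _) Subset.rfl)).aestronglyMeasurable
        (measurableSet_Ioc.prod measurableSet_closedBall)
    · filter_upwards [ae_restrict_mem (measurableSet_Ioc.prod measurableSet_closedBall)] with p hp
      exact hM p ⟨Ioc_subset_Icc_self hp.1, hp.2⟩
  simp only [integrand_eq_integral hk hS hc hρ]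
  rw [integral_const_mul, integral_integral_swap hint, besselTransform,
    ← integral_const_mul, ← integral_const_mul,
    ← setIntegral_eq_integral_of_forall_compl_eq_zero (s := Metric.closedBall (0 : Plane) ρ)
      (f := fun y => k / R * (besselJ 0 (k * ‖z - y‖) * S y)) fun y hy => by
        rw [eq_zero_of_norm_gt hρ (not_le.1 fun h => hy (mem_closedBall_zero_iff.2 h)), mul_zero,
          mul_zero]]
  refine setIntegral_congr_fun measurableSet_closedBall fun y hy => ?_
  have hy' : y ∈ Metric.ball (0 : Plane) R :=
    mem_ball_zero_iff.2 ((mem_closedBall_zero_iff.1 hy).trans_lt hρR)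
  beta_reduce
  rw [integral_const_mul, ← intervalIntegral.integral_of_le Real.two_pi_pos.le,
    integral_boundaryKernel hk hR hy' hz, norm_sub_rev y z]
  ring

end

/-! ### The indicator function as a low-pass filter -/

section

variable {S : Plane → ℝ} {R ρ : ℝ} {A : Set ℝ}

theorem indicatorOn_congr (hA : MeasurableSet A) (hpos : A ⊆ Ioi 0) {u v : Plane → ℝ → ℂ}
    (h : ∀ k > 0, ∀ x, u x k = v x k) : indicatorOn A R u = indicatorOn A R v := by
  funext z
  unfold indicatorOn
  congr 2 with θ
  congr 1
  refine setIntegral_congr_fun hA fun k hk => ?_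
  simp only [waveIntegrand, h k (hpos hk)]

theorem indicatorConvergesOn_congr (hA : MeasurableSet A) (hpos : A ⊆ Ioi 0)
    {u v : Plane → ℝ → ℂ} (h : ∀ k > 0, ∀ x, u x k = v x k) (z : Plane) :
    IndicatorConvergesOn A R u z ↔ IndicatorConvergesOn A R v z := by
  refine integrableOn_congr_fun (fun p hp => ?_) (measurableSet_Ioc.prod hA)
  simp only [waveIntegrand, h p.2 (hpos hp.2)]

/-- Absolute convergence is what allows the angular integral to be done first; it also makes the
remaining integral over `k` converge. -/
theorem indicatorOn_eq_setIntegral (hA : MeasurableSet A) (hpos : A ⊆ Ioi 0) (hR : 0 < R)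
    (hρR : ρ < R) (hS : MemLp S 2 volume) (hc : HasCompactSupport S)
    (hρ : tsupport S ⊆ Metric.closedBall 0 ρ) {z : Plane} (hz : z ∈ Metric.ball (0 : Plane) R)
    (h : IndicatorConvergesOn A R (sourceField S) z) :
    IntegrableOn (fun k => k * besselTransform S k z) A ∧
      indicatorOn A R (sourceField S) z
        = (2 * Real.pi)⁻¹ * ∫ k in A, k * besselTransform S k z := by
  have hint : Integrable (Function.uncurry fun θ k =>
      directionFactor R z θ * waveIntegrand R (sourceField S) z θ k)
      ((volume.restrict (Ioc 0 (2 * Real.pi))).prod (volume.restrict A)) := by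
    rw [Measure.prod_restrict]
    exact h
  have heq : ∀ k ∈ A, ∫ θ in Ioc 0 (2 * Real.pi),
      directionFactor R z θ * waveIntegrand R (sourceField S) z θ k
      = R⁻¹ * (k * besselTransform S k z) := fun k hk => by
    rw [integral_integrand (hpos hk) hR.le hρR hS hc hρ hz]
    ring
  constructor
  · have h1 : IntegrableOn (fun k => R⁻¹ * (k * besselTransform S k z)) A :=
      (integrableOn_congr_fun heq hA).1 hint.integral_prod_right
    refine (Integrable.const_mul h1 R).congr (Eventually.of_forall fun k => ?_)
    simp only
    field_simp
  · have hswap : ∫ θ in Ioc 0 (2 * Real.pi), directionFactor R z θ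
        * ∫ k in A, waveIntegrand R (sourceField S) z θ k
        = R⁻¹ * ∫ k in A, k * besselTransform S k z := by
      simp only [← integral_const_mul]
      rw [integral_integral_swap hint]
      exact setIntegral_congr_fun hA heq
    rw [indicatorOn, hswap]
    field_simp

theorem indicatorOn_Ioc_eq_lowPass (hR : 0 < R) (hρR : ρ < R) (hS : MemLp S 2 volume)
    (hc : HasCompactSupport S) (hρ : tsupport S ⊆ Metric.closedBall 0 ρ) {z : Plane}
    (hz : z ∈ Metric.ball (0 : Plane) R) {K : ℝ} (hK : 0 ≤ K) :
    indicatorOn (Ioc 0 K) R (sourceField S) z = lowPass S K z := by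
  rw [(indicatorOn_eq_setIntegral measurableSet_Ioc Ioc_subset_Ioi_self hR hρR hS hc hρ hz
    (indicatorConvergesOn_Ioc hR.le hρR hS hc hρ hz K)).2, lowPass,
    intervalIntegral.integral_of_le hK]

theorem tendsto_lowPass_indicatorOn_Ioi (hR : 0 < R) (hρR : ρ < R) (hS : MemLp S 2 volume)
    (hc : HasCompactSupport S) (hρ : tsupport S ⊆ Metric.closedBall 0 ρ) {z : Plane}
    (hz : z ∈ Metric.ball (0 : Plane) R) (h : IndicatorConvergesOn (Ioi 0) R (sourceField S) z) :
    Tendsto (fun K => lowPass S K z) atTop (𝓝 (indicatorOn (Ioi 0) R (sourceField S) z)) := by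
  obtain ⟨hi, he⟩ := indicatorOn_eq_setIntegral measurableSet_Ioi Subset.rfl hR hρR hS hc hρ hz h
  rw [he]
  exact (intervalIntegral_tendsto_integral_Ioi 0 hi tendsto_id).const_mul _

end

/-! ### Smooth sources -/

theorem ContDiff.laplacian_of_infty {f : Plane → ℝ} (hf : ContDiff ℝ ∞ f) :
    ContDiff ℝ ∞ (Δ f) := by
  rw [show Δ f = fun x => _ from funext fun x => laplacian_eq_sum_fderiv f x]
  have h : ContDiff ℝ ∞ (fderiv ℝ (fderiv ℝ f)) :=
    (hf.fderiv_right (m := ∞) le_rfl).fderiv_right le_rfl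
  exact ContDiff.sum fun i _ => (h.clm_apply contDiff_const).clm_apply contDiff_const

theorem tsupport_laplacian_subset (f : Plane → ℝ) : tsupport (Δ f) ⊆ tsupport f := by
  refine Subset.trans (closure_mono fun x hx => ?_)
    ((tsupport_fderiv_subset ℝ).trans (tsupport_fderiv_subset ℝ (f := f)))
  contrapose! hx
  rw [Function.notMem_support] at hx ⊢
  rw [laplacian_eq_sum_fderiv, hx]
  simp

/-- The fundamental solution identity for `y ↦ S(x - y)` gives `Φ * ΔS + k^2 Φ * S = -S`, and the
right side vanishes at `x`. -/
theorem radiatedField_laplacian {S : Plane → ℝ} (hS : ContDiff ℝ ∞ S) (hc : HasCompactSupport S)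
    {k : ℝ} (hk : 0 < k) {x : Plane} (hx : S x = 0) :
    radiatedField k (Δ S) x = -(k : ℂ) ^ 2 * radiatedField k S x := by
  have hS2 : ContDiff ℝ 2 S := hS.of_le two_le_infty
  have hw : ContDiff ℝ 2 fun y => S (x - y) := hS2.comp (contDiff_const.sub contDiff_id)
  have hf : ContDiff ℝ 2 fun y => (S (x - y) : ℂ) := Complex.ofRealCLM.contDiff.comp hw
  have hcw : HasCompactSupport fun y => S (x - y) := hc.comp_homeomorph (Homeomorph.subLeft x)
  have hcf : HasCompactSupport fun y => (S (x - y) : ℂ) :=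
    hcw.comp_left (g := Complex.ofReal) Complex.ofReal_zero
  have h := integral_radiatingKernel_mul_laplacian hk hf hcf
  have hLc : HasCompactSupport (Δ S) := hc.laplacian
  have i1 := integrable_radiatedField hk (hS2.continuous.memLp_of_hasCompactSupport hc) hc x
  have i2 := integrable_radiatedField hk
    ((continuous_laplacian hS2).memLp_of_hasCompactSupport hLc) hLc x
  rw [← integral_sub_left_eq_self _ volume x] at h
  have e : ∀ y, radiatingKernel k (x - y) * (Δ (fun y => (S (x - y) : ℂ)) (x - y)
      + (k : ℂ) ^ 2 * (S (x - (x - y)) : ℂ))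
      = radiatingKernel k (x - y) * ((Δ S y : ℝ) : ℂ)
        + (k : ℂ) ^ 2 * (radiatingKernel k (x - y) * S y) := fun y => by
    rw [laplacian_ofReal (w := fun y => S (x - y)) hw.contDiffAt, laplacian_comp_sub_left,
      sub_sub_cancel]
    ring
  simp only [e] at h
  rw [integral_add i2 (i1.const_mul _), integral_const_mul, sub_zero, hx, Complex.ofReal_zero,
    neg_zero] at h
  unfold radiatedField
  linear_combination h

/-- Two Laplacians improve the decay of the field on the circle from `k^(-1/2)` to `k^(-9/2)`, so
the integrand is `O(k^(-5/2))` even with the Bessel factors merely bounded. With a single Laplacian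
the same estimates reach only `k^(-1)`. -/
theorem indicatorConvergesOn_Ioi {S : Plane → ℝ} {R ρ : ℝ} (hR : 0 ≤ R) (hρR : ρ < R)
    (hS : ContDiff ℝ ∞ S) (hc : HasCompactSupport S) (hρ : tsupport S ⊆ Metric.closedBall 0 ρ)
    {z : Plane} (hz : z ∈ Metric.ball (0 : Plane) R) :
    IndicatorConvergesOn (Ioi 0) R (sourceField S) z := by
  have hL := hS.laplacian_of_infty
  have hLL := hL.laplacian_of_infty
  have hLc : HasCompactSupport (Δ S) := hc.laplacian
  have hLLc : HasCompactSupport (Δ (Δ S)) := hLc.laplacian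
  have hρL := (tsupport_laplacian_subset S).trans hρ
  have hρLL := (tsupport_laplacian_subset (Δ S)).trans hρL
  have hS2 : MemLp S 2 volume := hS.continuous.memLp_of_hasCompactSupport hc
  obtain ⟨C, hC, hH⟩ := exists_norm_hankel_one_le
  obtain ⟨B, hB, hu⟩ := exists_norm_sourceField_le hR hρR
    (hLL.continuous.integrable_of_hasCompactSupport hLLc) hρLL
  have hδ : 0 < R - ‖z‖ := sub_pos.2 (mem_ball_zero_iff.1 hz)
  have hu' : ∀ k > 0, ∀ θ, ‖sourceField S (R • unitVec θ) k‖ ≤ B * k ^ (-9 / 2 : ℝ) := by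
    intro k hk θ
    have hx : ρ < ‖R • unitVec θ‖ := by rwa [norm_smul_unitVec hR]
    have h4 : sourceField (Δ (Δ S)) (R • unitVec θ) k
        = (k : ℂ) ^ 4 * sourceField S (R • unitVec θ) k := by
      unfold sourceField
      rw [radiatedField_laplacian hL hLc hk (eq_zero_of_norm_gt hρL hx),
        radiatedField_laplacian hS hc hk (eq_zero_of_norm_gt hρ hx)]
      ring
    have h := hu k hk θ
    rw [h4, norm_mul, norm_pow, Complex.norm_real, Real.norm_of_nonneg hk.le, mul_comm,
      ← le_div_iff₀ (pow_pos hk 4)] at h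
    refine h.trans_eq ?_
    rw [mul_div_assoc, ← Real.rpow_natCast, ← Real.rpow_sub hk]
    norm_num
  have hfar : IndicatorConvergesOn (Ioi 1) R (sourceField S) z := by
    unfold IndicatorConvergesOn IntegrableOn
    rw [← Measure.prod_restrict]
    set c := 2 * B * (C * ((R - ‖z‖) ^ (-1 / 2 : ℝ) + (R - ‖z‖) ^ (-3 / 2 : ℝ))) with hcdef
    have hb : Integrable (fun p : ℝ × ℝ => c * p.2 ^ (-5 / 2 : ℝ))
        ((volume.restrict (Ioc 0 (2 * Real.pi))).prod (volume.restrict (Ioi 1))) :=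
      Integrable.comp_snd (f := fun k : ℝ => c * k ^ (-5 / 2 : ℝ))
        ((integrableOn_Ioi_rpow_of_lt (by norm_num) one_pos).const_mul c) _
    refine hb.mono' ?_ ?_ <;> rw [Measure.prod_restrict]
    · exact ((continuousOn_integrand hR hρR hS2 hc hρ hz).mono
        (prod_mono (subset_univ _) (Ioi_subset_Ioi zero_le_one))).aestronglyMeasurable
        (measurableSet_Ioc.prod measurableSet_Ioi)
    · filter_upwards [ae_restrict_mem (measurableSet_Ioc.prod measurableSet_Ioi)] with p hp
      have hk1 : 1 < p.2 := hp.2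
      have hk : 0 < p.2 := one_pos.trans hk1
      rw [Real.norm_eq_abs]
      refine (abs_integrand_le hR hC hH hz hk p.1 (hu' _ hk p.1)).trans ?_
      have hle : R - ‖z‖ ≤ p.2 * (R - ‖z‖) := le_mul_of_one_le_left hδ.le hk1.le
      have h1 : (p.2 * (R - ‖z‖)) ^ (-1 / 2 : ℝ) ≤ (R - ‖z‖) ^ (-1 / 2 : ℝ) :=
        Real.rpow_le_rpow_of_nonpos hδ hle (by norm_num)
      have h2 : (p.2 * (R - ‖z‖)) ^ (-3 / 2 : ℝ) ≤ (R - ‖z‖) ^ (-3 / 2 : ℝ) :=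
        Real.rpow_le_rpow_of_nonpos hδ hle (by norm_num)
      have e : p.2 ^ 2 * p.2 ^ (-9 / 2 : ℝ) = p.2 ^ (-5 / 2 : ℝ) := by
        rw [← Real.rpow_natCast, ← Real.rpow_add hk]
        norm_num
      calc _ ≤ 2 * p.2 ^ 2 * (B * p.2 ^ (-9 / 2 : ℝ))
            * (C * ((R - ‖z‖) ^ (-1 / 2 : ℝ) + (R - ‖z‖) ^ (-3 / 2 : ℝ))) := by gcongr
        _ = c * (p.2 ^ 2 * p.2 ^ (-9 / 2 : ℝ)) := by rw [hcdef]; ring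
        _ = _ := by rw [e]
  have hunion := (indicatorConvergesOn_Ioc hR hρR hS2 hc hρ hz 1).union hfar
  rwa [← prod_union, Ioc_union_Ioi_eq_Ioi zero_le_one] at hunion

/-! ### Proof of the inversion theorem. -/

theorem exists_subset_closedBall_of_subset_ball {s : Set Plane} (hs : IsCompact s) {R : ℝ}
    (h : s ⊆ Metric.ball 0 R) : ∃ ρ < R, s ⊆ Metric.closedBall 0 ρ := by
  rcases s.eq_empty_or_nonempty with rfl | hne
  · exact ⟨R - 1, sub_one_lt R, empty_subset _⟩
  · obtain ⟨x, hx, hmax⟩ := hs.exists_isMaxOn hne continuous_norm.continuousOn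
    exact ⟨‖x‖, mem_ball_zero_iff.1 (h hx), fun y hy => mem_closedBall_zero_iff.2 (hmax hy)⟩

theorem theorem2p1 (R : ℝ) (hR : 0 < R) (S : Plane → ℝ)
    (hS : MemLp S 2 (volume : Measure Plane))
    (hcomp : HasCompactSupport S) (hsupp : tsupport S ⊆ Metric.ball (0 : Plane) R)
    (u : Plane → ℝ → ℂ)
    (hu : ∀ k : ℝ, 0 < k → IsRadiatingSolution k S (fun x => u x k)) :
    -- every truncated indicator is given by absolutely convergent integrals and is in `L²(B_R)`
    (∀ K : ℝ, 0 < K →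
      (∀ z ∈ Metric.ball (0 : Plane) R, IndicatorConvergesOn (Ioc 0 K) R u z) ∧
      MemLp (indicatorOn (Ioc 0 K) R u) 2 (volume.restrict (Metric.ball (0 : Plane) R))) ∧
    -- `I_S = S` in `L²(B_R)`, the integral over `(0, ∞)` being the `L²(B_R)` limit of `∫_0^K`
    Tendsto (fun K : ℝ => eLpNorm (fun z => indicatorOn (Ioc 0 K) R u z - S z) 2
        (volume.restrict (Metric.ball (0 : Plane) R))) atTop (𝓝 0) ∧
    -- `I_S(z) = S(z)` at almost every point at which `I_S` is an absolutely convergent integral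
    (∀ᵐ z ∂(volume.restrict (Metric.ball (0 : Plane) R)),
      IndicatorConvergesOn (Ioi 0) R u z → indicatorOn (Ioi 0) R u z = S z) ∧
    -- for smooth sources the integral converges absolutely and `I_S(z) = S(z)` at every point
    (ContDiff ℝ ∞ S → ∀ z ∈ Metric.ball (0 : Plane) R,
      IndicatorConvergesOn (Ioi 0) R u z ∧ indicatorOn (Ioi 0) R u z = S z) := by
  obtain ⟨ρ, hρR, hρ⟩ := exists_subset_closedBall_of_subset_ball hcomp.isCompact hsupp
  have hS1 := integrable_of_memLp_two hS hcomp
  have huS : ∀ k > 0, ∀ x, u x k = sourceField S x k := fun k hk x =>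
    congrFun ((hu k hk).eq_radiatedField hk hS hcomp) x
  have hconv : ∀ K, ∀ z ∈ Metric.ball (0 : Plane) R, IndicatorConvergesOn (Ioc 0 K) R u z :=
    fun K z hz => (indicatorConvergesOn_congr measurableSet_Ioc Ioc_subset_Ioi_self huS z).2
      (indicatorConvergesOn_Ioc hR.le hρR hS hcomp hρ hz K)
  have hlow : ∀ K : ℝ, 0 ≤ K → ∀ᵐ z ∂(volume.restrict (Metric.ball (0 : Plane) R)),
      indicatorOn (Ioc 0 K) R u z = lowPass S K z := fun K hK => by
    filter_upwards [ae_restrict_mem Metric.isOpen_ball.measurableSet] with z hz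
    rw [indicatorOn_congr measurableSet_Ioc Ioc_subset_Ioi_self huS]
    exact indicatorOn_Ioc_eq_lowPass hR hρR hS hcomp hρ hz hK
  have hIoi : ∀ z ∈ Metric.ball (0 : Plane) R, IndicatorConvergesOn (Ioi 0) R u z →
      Tendsto (fun K => lowPass S K z) atTop (𝓝 (indicatorOn (Ioi 0) R u z)) := fun z hz h => by
    rw [indicatorOn_congr measurableSet_Ioi Subset.rfl huS]
    exact tendsto_lowPass_indicatorOn_Ioi hR hρR hS hcomp hρ hz
      ((indicatorConvergesOn_congr measurableSet_Ioi Subset.rfl huS z).1 h)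
  have hlim := tendsto_eLpNorm_lowPass hS1 hS
  refine ⟨fun K hK => ⟨hconv K, ?_⟩, ?_, ?_, fun hsm z hz => ?_⟩
  · exact (memLp_congr_ae (hlow K hK.le)).2 ((memLp_lowPass hS1 hS hK.le).restrict _)
  · refine tendsto_of_tendsto_of_tendsto_of_le_of_le' tendsto_const_nhds hlim
      (Eventually.of_forall fun K => zero_le) ?_
    filter_upwards [eventually_ge_atTop 0] with K hK
    rw [eLpNorm_congr_ae (g := fun z => lowPass S K z - S z)
      ((hlow K hK).mono fun z hz => by simp only [hz])]
    exact eLpNorm_restrict_le _ _ _ _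
  -- Convergence in `L²` gives almost everywhere convergence to `S` along some sequence of cutoffs.
  -- Where the integral converges absolutely, all cutoffs converge to `I_S(z)`, so the two limits
  -- agree.
  · have hm : TendstoInMeasure volume (fun n : ℕ => lowPass S n) atTop S :=
      tendstoInMeasure_of_tendsto_eLpNorm two_ne_zero
        (fun n => (memLp_lowPass hS1 hS n.cast_nonneg).1) hS.1
        (hlim.comp tendsto_natCast_atTop_atTop)
    obtain ⟨ns, hns, hae⟩ := hm.exists_seq_tendsto_ae
    filter_upwards [ae_restrict_mem Metric.isOpen_ball.measurableSet, ae_restrict_of_ae hae]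
      with z hz hlimz h
    exact tendsto_nhds_unique
      ((hIoi z hz h).comp (tendsto_natCast_atTop_atTop.comp hns.tendsto_atTop)) hlimz
  · have h : IndicatorConvergesOn (Ioi 0) R u z :=
      (indicatorConvergesOn_congr measurableSet_Ioi Subset.rfl huS z).2
        (indicatorConvergesOn_Ioi hR.le hρR hsm hcomp hρ hz)
    exact ⟨h, tendsto_nhds_unique (hIoi z hz h) (tendsto_lowPass hsm hcomp z)⟩
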